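/- **Model.** A word RAM with word length $w$ has finitely many registers and a memory addressed by words, all holding $w$-bit words and initially zero; in one step it performs an assignment of a constant or of $w$, an unsigned operation modulo $2^w$ ($+,-,\cdot$, integer division and remainder, bitwise and/or/xor, shifts), a memory read or write, the generation of a uniformly random word, or a comparison with a branch. A dynamic predecessor structure consists of three fixed programs, the same for every $w$, for inserting an element with a given key, deleting one element with a given key (no effect if there is none), and the query that returns the largest stored key less than a given word $q$, or reports that there is none. Different elements may have equal keys; $n$ denotes the current number of stored elements. **Smoothness.** A probability distribution $\mu$ with a density on an interval $[a,b]$ is $(f_1,f_2)$-smooth with constant $\beta$ if for all $a\le c_1<c_2\le c_3\le b$ and all integers $s\ge 1$, $$\Pr_{X\sim\mu}\Big[X\in\big[c_2-\tfrac{c_3-c_1}{f_1(s)},\,c_2\big]\ \Big|\ X\in[c_1,c_3]\Big]\le\frac{\beta f_2(s)}{s}.$$ **Input model.** An arbitrary finite sequence of operations (insert, delete, or query with an arbitrary word $q$) is fixed in advance and applied to the empty structure. Each insertion draws a fresh real from $\mu$ and inserts an element whose key is the nearest integer in $\{0,\dots,2^w-1\}$; each deletion removes a uniformly random one of the contained elements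 (nothing happens if there is none). All these choices and the random words of the machine are independent. **Theorem.** There are a dynamic predecessor structure and a constant $K$ such that: 1. (Correctness and linear space.) For every $w$ and every sequence of requests with arbitrary $w$-bit keys, such that $K(n+1)\le 2^w$ at all times (that is, the words are long enough to address the memory), with probability one over the random words all programs halt, all queries are answered correctly, and only the first $K(n+1)$ memory cells are in use: a request that finds $n$ elements accesses only addresses below $K(n+1)$, and after a request that leaves $n$ elements all cells with addresses at least $K(n+1)$ hold zero. 2. (Time.) For all $\alpha,\delta>0$ and all $\beta$ there is a constant $C$ such that for every $w$, every interval $[a,b]$, every probability distribution $\mu$ with a density on $[a,b]$ that is $(s^{\alpha},s^{1-\delta})$-smooth with constant $\beta$, and every sequence of $m$ operations during which $K(n+1)\le 2^w$ always holds, the expected total number of steps is at most $$C\sum_{i=1}^{m}\max\{1,\log\log n_i\},$$ where $n_i$ is the number of elements before the $i$-th operation and $\log\log n_i$ is read as $0$ for $n_i\le 1$. That is, the expected amortized time per operation is $O(\log\log n)$. The programs and $K$ do not depend on $\mu$, $a$, $b$, $\alpha$, $\delta$, $\beta$. -/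

import Mathlib

open MeasureTheory ProbabilityTheory

namespace WordRAM

/-! ### The word RAM

Words have `w` bits. A program uses finitely many registers (numbered by `ℕ`) and one memory
whose cells are addressed by words. A program is a fixed finite text, the same for every `w`. -/

/-- Binary word instructions (arithmetic modulo `2 ^ w`, everything unsigned). -/
inductive BinOp where
  | add | sub | mul | div | mod | and | or | xor | shl | shr

/-- The value of a word instruction; division by zero gives `0`, and `x` modulo zero gives `x`. -/
def BinOp.eval {w : ℕ} : BinOp → BitVec w → BitVec w → BitVec w
  | .add, x, y => x + y
  | .sub, x, y => x - y
  | .mul, x, y => x * y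
  | .div, x, y => x / y
  | .mod, x, y => x % y
  | .and, x, y => x &&& y
  | .or, x, y => x ||| y
  | .xor, x, y => x ^^^ y
  | .shl, x, y => x <<< y
  | .shr, x, y => x >>> y

/-- Comparisons of two registers. -/
inductive Test where
  | eq (x y : ℕ)
  | lt (x y : ℕ)

/-- Word-RAM programs; the arguments of type `ℕ` are register numbers,
except for the literal in `const`. -/
inductive Cmd where
  /-- do nothing -/
  | skip
  /-- `R[d] := c` (reduced modulo `2 ^ w`) -/
  | const (d c : ℕ)
  /-- `R[d] := w` (reduced modulo `2 ^ w`) -/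
  | width (d : ℕ)
  /-- `R[d] := R[x] o R[y]` -/
  | op (o : BinOp) (d x y : ℕ)
  /-- `R[d] := M[R[x]]` -/
  | load (d x : ℕ)
  /-- `M[R[x]] := R[y]` -/
  | store (x y : ℕ)
  /-- `R[d] :=` a fresh uniformly random word -/
  | rand (d : ℕ)
  | seq (c₁ c₂ : Cmd)
  | ifelse (t : Test) (c₁ c₂ : Cmd)
  | loop (t : Test) (c : Cmd)

/-- States of the machine. -/
@[ext] structure State (w : ℕ) where
  /-- registers -/
  reg : ℕ → BitVec w
  /-- memory -/
  mem : BitVec w → BitVec w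
  /-- number of random words consumed so far -/
  coins : ℕ
  /-- number of unit-cost steps executed so far -/
  time : ℕ
  /-- one more than the largest memory address accessed since the last call (`0` if none) -/
  peak : ℕ

/-- The initial state: registers and memory hold zeros. -/
def State.zero (w : ℕ) : State w := ⟨fun _ => 0, fun _ => 0, 0, 0, 0⟩

/-- One unit of time passes. -/
def State.tick {w : ℕ} (σ : State w) : State w := { σ with time := σ.time + 1 }

/-- A one-step assignment to a register. -/
def State.set {w : ℕ} (σ : State w) (d : ℕ) (v : BitVec w) : State w :=
  { σ.tick with reg := Function.update σ.reg d v }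

/-- Record an access to the memory address `x`. -/
def State.touch {w : ℕ} (σ : State w) (x : BitVec w) : State w :=
  { σ with peak := max σ.peak (x.toNat + 1) }

/-- A one-step assignment to a memory cell. -/
def State.put {w : ℕ} (σ : State w) (x v : BitVec w) : State w :=
  { (σ.tick.touch x) with mem := Function.update σ.mem x v }

/-- The outcome of a comparison in a state. -/
def Test.Holds {w : ℕ} : Test → State w → Prop
  | .eq x y, σ => σ.reg x = σ.reg y
  | .lt x y, σ => σ.reg x < σ.reg y

/-- `Exec ω c σ τ`: with the random words `ω 0, ω 1, …`, the program `c` started in state `σ`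
halts in state `τ`. Every instruction and every evaluation of a test costs one step. -/
inductive Exec {w : ℕ} (ω : ℕ → Fin (2 ^ w)) : Cmd → State w → State w → Prop
  | skip (σ) : Exec ω .skip σ σ
  | const (σ d c) : Exec ω (.const d c) σ (σ.set d (BitVec.ofNat w c))
  | width (σ d) : Exec ω (.width d) σ (σ.set d (BitVec.ofNat w w))
  | op (σ o d x y) : Exec ω (.op o d x y) σ (σ.set d (o.eval (σ.reg x) (σ.reg y)))
  | load (σ d x) : Exec ω (.load d x) σ ((σ.touch (σ.reg x)).set d (σ.mem (σ.reg x)))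
  | store (σ x y) : Exec ω (.store x y) σ (σ.put (σ.reg x) (σ.reg y))
  | rand (σ d) : Exec ω (.rand d) σ
      { σ.set d (BitVec.ofFin (ω σ.coins)) with coins := σ.coins + 1 }
  | seq {c₁ c₂ σ τ ρ} (h₁ : Exec ω c₁ σ τ) (h₂ : Exec ω c₂ τ ρ) : Exec ω (.seq c₁ c₂) σ ρ
  | ifelse_true {t c₁ c₂ σ τ} (ht : t.Holds σ) (h : Exec ω c₁ σ.tick τ) :
      Exec ω (.ifelse t c₁ c₂) σ τ
  | ifelse_false {t c₁ c₂ σ τ} (ht : ¬ t.Holds σ) (h : Exec ω c₂ σ.tick τ) :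
      Exec ω (.ifelse t c₁ c₂) σ τ
  | loop_true {t c σ τ ρ} (ht : t.Holds σ) (h₁ : Exec ω c σ.tick τ)
      (h₂ : Exec ω (.loop t c) τ ρ) : Exec ω (.loop t c) σ ρ
  | loop_false {t c σ} (ht : ¬ t.Holds σ) : Exec ω (.loop t c) σ σ.tick

/-- The law of the random words of the machine: independent and uniform. -/
noncomputable def coinLaw (w : ℕ) : Measure (ℕ → Fin (2 ^ w)) :=
  Measure.infinitePi fun _ => (PMF.uniformOfFintype (Fin (2 ^ w))).toMeasure

/-! ### The dynamic predecessor problem -/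

/-- Requests to the data structure; keys are words. -/
inductive Request (w : ℕ) where
  | insert (k : BitVec w)
  | delete (k : BitVec w)
  | pred (q : BitVec w)

/-- The argument of a request. -/
def Request.key {w : ℕ} : Request w → BitVec w
  | .insert k => k
  | .delete k => k
  | .pred q => q

/-- The effect of a request on the stored keys. A multiset, since two elements may
have equal keys; `delete k` removes one element with key `k`, if there is one. -/
def Request.apply {w : ℕ} : Request w → Multiset (BitVec w) → Multiset (BitVec w)
  | .insert k, S => k ::ₘ S
  | .delete k, S => S.erase k
  | .pred _, S => S

/-- The keys stored after a sequence of requests to the empty structure. -/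
def contents {w : ℕ} (rs : List (Request w)) : Multiset (BitVec w) :=
  rs.foldl (fun S r => r.apply S) 0

/-- A query `pred q` is answered correctly in `τ` when the stored keys are `S`: register 0 is zero
if no stored key is less than `q`; otherwise it is nonzero and register 1 holds the largest
stored key less than `q`. Updates have no answer. -/
def Request.Answered {w : ℕ} : Request w → Multiset (BitVec w) → State w → Prop
  | .insert _, _, _ => True
  | .delete _, _, _ => True
  | .pred q, S, τ => (τ.reg 0 = 0 ∧ ∀ k ∈ S, ¬ k < q) ∨
      (τ.reg 0 ≠ 0 ∧ IsGreatest {k | k ∈ S ∧ k < q} (τ.reg 1))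

/-- A data structure: a program for each kind of request. -/
structure DataStructure where
  insert : Cmd
  delete : Cmd
  pred : Cmd

/-- The program that serves a request. -/
def DataStructure.program (D : DataStructure) {w : ℕ} : Request w → Cmd
  | .insert _ => D.insert
  | .delete _ => D.delete
  | .pred _ => D.pred

/-- A call: the argument `k` is placed into register 0. -/
def State.call {w : ℕ} (σ : State w) (k : BitVec w) : State w :=
  { σ with reg := Function.update σ.reg 0 k, peak := 0 }

/-- From state `σ`, in which the keys `S` are stored, all the requests are served: every program
halts, every query is answered correctly, and with `n` stored elements only the first
`K * (n + 1)` memory cells are in use (a request that finds `n` elements accesses no other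
cell, and after a request that leaves `n` elements all the other cells are zero). -/
def DataStructure.Serves (D : DataStructure) (K : ℕ) {w : ℕ} (ω : ℕ → Fin (2 ^ w)) :
    List (Request w) → Multiset (BitVec w) → State w → Prop
  | [], _, _ => True
  | r :: rs, S, σ => ∃ τ, Exec ω (D.program r) (σ.call r.key) τ ∧ r.Answered S τ ∧
      τ.peak ≤ K * (S.card + 1) ∧
      (∀ x, K * ((r.apply S).card + 1) ≤ x.toNat → τ.mem x = 0) ∧
      D.Serves K ω rs (r.apply S) τ

/-- The sequence of requests, started in state `σ`, terminates in state `τ`. -/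
def DataStructure.ExecAll (D : DataStructure) {w : ℕ} (ω : ℕ → Fin (2 ^ w)) :
    List (Request w) → State w → State w → Prop
  | [], σ, τ => σ = τ
  | r :: rs, σ, τ => ∃ ρ, Exec ω (D.program r) (σ.call r.key) ρ ∧ D.ExecAll ω rs ρ τ

/-- The total number of steps for a sequence of requests to the empty structure
(`⊤` if some program does not halt). -/
noncomputable def DataStructure.totalTime (D : DataStructure) {w : ℕ} (ω : ℕ → Fin (2 ^ w))
    (rs : List (Request w)) : ENNReal :=
  ⨅ (τ : State w) (_ : D.ExecAll ω rs (State.zero w) τ), (τ.time : ENNReal)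

/-! ### Smooth distributions and the input model -/

/-- `μ` has a density defined over the interval `[a, b]`. -/
def HasDensityOn (μ : Measure ℝ) (a b : ℝ) : Prop :=
  ∃ f : ℝ → ENNReal, Measurable f ∧ μ = (volume.restrict (Set.Icc a b)).withDensity f

/-- `μ` on `[a, b]` is `(f₁, f₂)`-smooth with the constant `β`. -/
def SmoothWith (f₁ f₂ : ℕ → ℝ) (β : ℝ) (μ : Measure ℝ) (a b : ℝ) : Prop :=
  ∀ c₁ c₂ c₃ : ℝ, a ≤ c₁ → c₁ < c₂ → c₂ ≤ c₃ → c₃ ≤ b → ∀ s : ℕ, 1 ≤ s →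
    (μ[|Set.Icc c₁ c₃]).real (Set.Icc (c₂ - (c₃ - c₁) / f₁ s) c₂) ≤ β * f₂ s / s

/-- The word nearest to a real number. -/
noncomputable def nearestWord (w : ℕ) (x : ℝ) : BitVec w :=
  BitVec.ofNat w (min ⌊x + 1 / 2⌋₊ (2 ^ w - 1))

/-- Kinds of operations. Inserted and deleted keys are random; queries are arbitrary. -/
inductive Kind (w : ℕ) where
  | insert
  | delete
  | pred (q : BitVec w)

/-- The number of contained elements after an operation. -/
def Kind.next {w : ℕ} (n : ℕ) : Kind w → ℕ
  | .insert => n + 1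
  | .delete => n - 1
  | .pred _ => n

/-- The number of contained elements after a sequence of operations. -/
def size {w : ℕ} (ks : List (Kind w)) : ℕ := ks.foldl Kind.next 0

/-- The requests issued from time `t` on, when the keys of the contained elements are listed in
`L`. An insertion at time `t` takes the key `X t`, rounded. A deletion at time `t` from `n + 1`
elements removes the one at position `U (t, n)`; with no element contained, nothing is done. -/
noncomputable def requests {w : ℕ} (X : ℕ → ℝ) (U : (p : ℕ × ℕ) → Fin (p.2 + 1)) :
    ℕ → List (BitVec w) → List (Kind w) → List (Request w)
  | _, _, [] => []
  | t, L, .insert :: ks =>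
      .insert (nearestWord w (X t)) :: requests X U (t + 1) (nearestWord w (X t) :: L) ks
  | t, [], .delete :: ks => requests X U (t + 1) [] ks
  | t, k :: L, .delete :: ks =>
      .delete ((k :: L).get (U (t, L.length))) ::
        requests X U (t + 1) ((k :: L).eraseIdx (U (t, L.length))) ks
  | t, L, .pred q :: ks => .pred q :: requests X U (t + 1) L ks

/-- The joint law of the randomness: the inserted keys are drawn from `μ`, the positions of the
deleted elements are uniform, the machine's random words are uniform, all independently. -/
noncomputable def inputLaw (μ : Measure ℝ) [IsProbabilityMeasure μ] (w : ℕ) :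
    Measure ((ℕ → ℝ) × ((p : ℕ × ℕ) → Fin (p.2 + 1)) × (ℕ → Fin (2 ^ w))) :=
  (Measure.infinitePi fun _ : ℕ => μ).prod
    ((Measure.infinitePi fun p : ℕ × ℕ =>
      (PMF.uniformOfFintype (Fin (p.2 + 1))).toMeasure).prod (coinLaw w))

/-- The expected total time for a sequence of operations on the empty structure. -/
noncomputable def DataStructure.expectedTime (D : DataStructure) (μ : Measure ℝ)
    [IsProbabilityMeasure μ] {w : ℕ} (ks : List (Kind w)) : ENNReal :=
  ∫⁻ z, D.totalTime z.2.2 (requests z.1 z.2.1 0 [] ks) ∂inputLaw μ w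

end WordRAM

/-!
The data structure is a dynamic form of interpolation search. Time is divided into epochs: when
about half as many updates have been made as there were elements at the start of the epoch,
everything is rebuilt. An epoch has a static part, made from the keys present at its start, and a
linked list of all nodes sorted by key, into which later keys are inserted. A deletion only lowers
the multiplicity of a node.

*The static part.* Every `g`-th key is a sample, where `g` is about `log n`. Over the samples there
is a tree of grids: a node with `s` samples divides its range of keys into `s` cells of equal width,
which are its children, and has a table of the first sample of each cell (`node`, `cellStart`). With
`O(log n)` levels over `n / log n` samples the tables take linear space (`size_bound`). A search
alternates one step down this tree with one halving step of binary search (`gridSearch_spec`), so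
that it never takes more than logarithmically many iterations, whatever the keys are
(`searchDepth_le_log`). A binary search among the `g` keys between two samples takes `log log n`
further steps, and a walk along the list passes the nodes that are no longer or not yet static.

*Correctness, space and amortization* hold for arbitrary keys and make no use of random words. The
programs are written in a small structured language with variables and arrays (`Stm`), verified with
the rules for `Wp`, and compiled to the machine (`Stm.code_correct`). The invariant `Inv` relates
a state to the abstract state `Epoch`; every update leaves a credit that pays for the next
rebuilding (`finish_spec`). What results is `serves`, and a bound of the running time by the sum
of `Epoch.cost` over the requests (`totalTime_le`), where the cost consists of the depth of the
search in the tree of grids, of `log log n`, and of the length of the walk.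

*The depth of the search.* Cut the interval into `n / (2 log n)` blocks of equal mass. By a
Chernoff bound it is very likely that every block contains a sample point, and at most `O(log n)`
of them (`prob_unbalanced`). Then the number of keys in any interval is determined by its mass up
to factors `O(log n)`, and smoothness says that a part of an interval has at most about the
`γ`-th power of the ratio of the lengths as its share of the mass, for `γ = min (δ / α) 1`
(`Balanced.spread`). A child in a node with `s` samples has at most the fraction `1 / s` of its
length, whence the size of the child is at most a power of `log n` times the `1 - γ`-th power of the
size of the node (`spreadSize_child_le`). The sizes decrease doubly exponentially: after
`O(log log n)` levels a node has only a power of `log n` elements (`node_card_le`), and halving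
finishes the search in `O(log log n)` further iterations (`searchDepth_le_of_spread`). One
subtlety is that rounding may give many elements the same key; the size of a node is therefore the
minimum of the number of its elements and a power of its length (`spreadSize`). Since the samples
are unbalanced with probability `O(1 / n)` only, the expected depth is `O(log log n)`
(`lintegral_searchDepth_le`).

*The length of the walk.* At any time of an epoch, most nodes belong to elements that have been
present throughout it. The walk passes a node that does not only if its key is closer to the search
key, on one side, than the keys of all of these. By exchangeability this has probability about
`1 / N`, where `N` is their number (`prob_first_le`), so that the expected length is `O(1)`
(`lintegral_card_first_le`).

*Summation.* The positions of the deletions are independent of the samples, so they can be fixed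
first. Then the elements in the structure at each time are a fixed set of samples, the two bounds
apply to each operation, and linearity of expectation gives the claim (`lintegral_totalCost_le`,
`expectedTime_le`).
-/

namespace WordRAM

/-! ### A small structured language and its compilation to the word RAM -/

/-- Side-effect free expressions over variables and eight arrays. -/
inductive Ex where
  | var (i : ℕ)
  | lit (c : ℕ)
  | add (a b : Ex)
  | sub (a b : Ex)
  | mul (a b : Ex)
  | div (a b : Ex)
  /-- the entry of array `f` at the index `e` -/
  | arr (f : ℕ) (e : Ex)
  /-- `1` if `a < b`, else `0` -/
  | lt (a b : Ex)
  /-- `1` if `a = b`, else `0` -/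
  | eq (a b : Ex)
  /-- short-circuit conjunction: the value of `b` if `a ≠ 0`, else `0` -/
  | and (a b : Ex)

/-- Statements of the structured language. Conditions hold when their value is nonzero. -/
inductive Stm where
  | skip
  | asg (i : ℕ) (e : Ex)
  /-- store the value of `e₂` into array `f` at the index `e₁` -/
  | sto (f : ℕ) (e₁ e₂ : Ex)
  | seq (s₁ s₂ : Stm)
  | ite (e : Ex) (s₁ s₂ : Stm)
  | loop (e : Ex) (s : Stm)

/-- States of the structured language: natural-number variables and arrays. -/
@[ext] structure HS where
  /-- variables -/
  v : ℕ → ℕ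
  /-- arrays -/
  a : ℕ → ℕ → ℕ

/-- Assignment to a variable. -/
def HS.set (s : HS) (i x : ℕ) : HS := { s with v := Function.update s.v i x }

/-- Assignment to an array entry. -/
def HS.put (s : HS) (f i x : ℕ) : HS :=
  { s with a := Function.update s.a f (Function.update (s.a f) i x) }

@[simp] lemma HS.set_v (s : HS) (i x j : ℕ) : (s.set i x).v j = if j = i then x else s.v j := by
  simp [HS.set, Function.update_apply]

@[simp] lemma HS.set_a (s : HS) (i x : ℕ) : (s.set i x).a = s.a := rfl

@[simp] lemma HS.put_v (s : HS) (f i x : ℕ) : (s.put f i x).v = s.v := rfl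

@[simp] lemma HS.put_a (s : HS) (f i x g j : ℕ) :
    (s.put f i x).a g j = if g = f ∧ j = i then x else s.a g j := by
  by_cases h : g = f
  · subst h; simp [HS.put, Function.update_apply]
  · simp [HS.put, h]

/-- The value of an expression. -/
def Ex.ev (s : HS) : Ex → ℕ
  | var i => s.v i
  | lit c => c
  | add a b => a.ev s + b.ev s
  | sub a b => a.ev s - b.ev s
  | mul a b => a.ev s * b.ev s
  | div a b => a.ev s / b.ev s
  | arr f e => s.a f (e.ev s)
  | lt a b => if a.ev s < b.ev s then 1 else 0
  | eq a b => if a.ev s = b.ev s then 1 else 0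
  | and a b => if a.ev s = 0 then 0 else b.ev s

/-- The evaluation of an expression causes neither an overflow modulo `W` nor an access to an
address outside `[0, B)`. Entry `i` of array `f` lives at the address `8 * i + f`. -/
def Ex.ok (W B : ℕ) (s : HS) : Ex → Prop
  | var i => i < 64
  | lit c => c < W
  | add a b => a.ok W B s ∧ b.ok W B s ∧ a.ev s + b.ev s < W
  | sub a b => a.ok W B s ∧ b.ok W B s ∧ b.ev s ≤ a.ev s
  | mul a b => a.ok W B s ∧ b.ok W B s ∧ a.ev s * b.ev s < W
  | div a b => a.ok W B s ∧ b.ok W B s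
  | arr f e => e.ok W B s ∧ f < 8 ∧ 8 * e.ev s + f < B
  | lt a b => a.ok W B s ∧ b.ok W B s
  | eq a b => a.ok W B s ∧ b.ok W B s
  | and a b => a.ok W B s ∧ (a.ev s ≠ 0 → b.ok W B s)

/-- Big-step semantics; the last argument counts assignments, stores and tests. -/
inductive BS (W B : ℕ) : Stm → HS → HS → ℕ → Prop
  | skip (s) : BS W B .skip s s 0
  | asg (s) {i e} (hi : i < 64) (he : e.ok W B s) : BS W B (.asg i e) s (s.set i (e.ev s)) 1
  | sto (s) {f e₁ e₂} (h₁ : e₁.ok W B s) (h₂ : e₂.ok W B s) (hf : f < 8)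
      (hB : 8 * e₁.ev s + f < B) : BS W B (.sto f e₁ e₂) s (s.put f (e₁.ev s) (e₂.ev s)) 1
  | seq {s₁ s₂ s t r m n} (h₁ : BS W B s₁ s t m) (h₂ : BS W B s₂ t r n) :
      BS W B (.seq s₁ s₂) s r (m + n)
  | ite_true {e s₁ s₂ s t n} (he : e.ok W B s) (hv : e.ev s ≠ 0) (h : BS W B s₁ s t n) :
      BS W B (.ite e s₁ s₂) s t (1 + n)
  | ite_false {e s₁ s₂ s t n} (he : e.ok W B s) (hv : e.ev s = 0) (h : BS W B s₂ s t n) :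
      BS W B (.ite e s₁ s₂) s t (1 + n)
  | while_true {e s₁ s t r m n} (he : e.ok W B s) (hv : e.ev s ≠ 0) (h : BS W B s₁ s t m)
      (h' : BS W B (.loop e s₁) t r n) : BS W B (.loop e s₁) s r (1 + m + n)
  | while_false {e s₁ s} (he : e.ok W B s) (hv : e.ev s = 0) : BS W B (.loop e s₁) s s 1

/-- Code that evaluates an expression into register `k`, using the registers from `k` on. -/
def Ex.code : Ex → ℕ → Cmd
  | var i, k => .op .or k i i
  | lit c, k => .const k c
  | add a b, k => .seq (a.code k) (.seq (b.code (k + 1)) (.op .add k k (k + 1)))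
  | sub a b, k => .seq (a.code k) (.seq (b.code (k + 1)) (.op .sub k k (k + 1)))
  | mul a b, k => .seq (a.code k) (.seq (b.code (k + 1)) (.op .mul k k (k + 1)))
  | div a b, k => .seq (a.code k) (.seq (b.code (k + 1)) (.op .div k k (k + 1)))
  | arr f e, k => .seq (e.code k) (.seq (.const (k + 1) 8) (.seq (.op .mul k k (k + 1))
      (.seq (.const (k + 1) f) (.seq (.op .add k k (k + 1)) (.load k k)))))
  | lt a b, k => .seq (a.code k) (.seq (b.code (k + 1))
      (.ifelse (.lt k (k + 1)) (.const k 1) (.const k 0)))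
  | eq a b, k => .seq (a.code k) (.seq (b.code (k + 1))
      (.ifelse (.eq k (k + 1)) (.const k 1) (.const k 0)))
  | and a b, k => .seq (a.code k) (.seq (.const (k + 1) 0)
      (.ifelse (.eq k (k + 1)) .skip (b.code k)))

/-- A bound for the number of machine steps of `Ex.code`. -/
def Ex.size : Ex → ℕ
  | var _ => 1
  | lit _ => 1
  | add a b | sub a b | mul a b | div a b => a.size + b.size + 1
  | arr _ e => e.size + 5
  | lt a b | eq a b | and a b => a.size + b.size + 2

/-- Compilation; variable `i < 64` is held in register `i`. -/
def Stm.code : Stm → Cmd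
  | skip => .skip
  | asg i e => .seq (e.code 64) (.op .or i 64 64)
  | sto f e₁ e₂ => .seq (e₁.code 64) (.seq (.const 65 8) (.seq (.op .mul 64 64 65)
      (.seq (.const 65 f) (.seq (.op .add 64 64 65) (.seq (e₂.code 65) (.store 64 65))))))
  | seq s₁ s₂ => .seq s₁.code s₂.code
  | ite e s₁ s₂ => .seq (e.code 64) (.seq (.const 65 0) (.ifelse (.eq 64 65) s₂.code s₁.code))
  | loop e s => .seq (.seq (e.code 64) (.const 65 0))
      (.loop (.lt 65 64) (.seq s.code (.seq (e.code 64) (.const 65 0))))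

/-- A bound for the number of machine steps per unit of cost in `BS`. -/
def Stm.unit : Stm → ℕ
  | skip => 0
  | asg _ e => e.size + 1
  | sto _ e₁ e₂ => e₁.size + e₂.size + 5
  | seq s₁ s₂ => max s₁.unit s₂.unit
  | ite e s₁ s₂ => max (e.size + 2) (max s₁.unit s₂.unit)
  | loop e s => max (e.size + 2) s.unit

/-- The machine state `σ` represents the state `s`: register `i < 64` holds the variable `i`, and
the entry `i` of array `f` is kept at the address `8 * i + f`. -/
def Rel {w : ℕ} (σ : State w) (s : HS) : Prop :=
  (∀ i < 64, (σ.reg i).toNat = s.v i) ∧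
    ∀ x : BitVec w, (σ.mem x).toNat = s.a (x.toNat % 8) (x.toNat / 8)

section Compile

variable {w : ℕ} {ω : ℕ → Fin (2 ^ w)} {B : ℕ}

lemma Rel.of_eq {σ τ : State w} {s : HS} (h : Rel σ s) (hr : ∀ i < 64, τ.reg i = σ.reg i)
    (hm : τ.mem = σ.mem) : Rel τ s :=
  ⟨fun i hi => by rw [hr i hi, h.1 i hi], fun x => by rw [hm, h.2 x]⟩

/-- The effect of a piece of code that evaluates an expression. -/
def Evals (ω : ℕ → Fin (2 ^ w)) (B : ℕ) (c : Cmd) (k t : ℕ) (σ : State w) (x : ℕ) : Prop :=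
  ∃ τ, Exec ω c σ τ ∧ (τ.reg k).toNat = x ∧ (∀ i < k, τ.reg i = σ.reg i) ∧ τ.mem = σ.mem ∧
    τ.time ≤ σ.time + t ∧ τ.peak ≤ max σ.peak B

/-- Code that evaluates both operands into successive registers and applies an operation. -/
lemma Evals.binop {o : BinOp} {a b : Cmd} {k t₁ t₂ x y z : ℕ} {σ : State w}
    (ha : Evals ω B a k t₁ σ x)
    (hb : ∀ σ' : State w, (∀ i < k, σ'.reg i = σ.reg i) → σ'.mem = σ.mem →
      Evals ω B b (k + 1) t₂ σ' y)
    (hz : ∀ u v : BitVec w, u.toNat = x → v.toNat = y → (o.eval u v).toNat = z) :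
    Evals ω B (.seq a (.seq b (.op o k k (k + 1)))) k (t₁ + t₂ + 1) σ z := by
  obtain ⟨τ, h1, h2, h3, h4, h5, h6⟩ := ha
  obtain ⟨ρ, g1, g2, g3, g4, g5, g6⟩ := hb τ h3 h4
  refine ⟨_, .seq h1 (.seq g1 (.op ..)), ?_, ?_, ?_, ?_, ?_⟩
  · simp only [State.set, Function.update_self]
    exact hz _ _ (by rw [g3 k (by omega), h2]) g2
  · intro i hi
    simp only [State.set]
    rw [Function.update_of_ne (by omega), g3 i (by omega), h3 i hi]
  · simp [State.set, State.tick, g4, h4]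
  · simp only [State.set, State.tick]; omega
  · simp only [State.set, State.tick]; omega

/-- Code that evaluates both operands into successive registers and turns a test into `0` or
`1`. -/
lemma Evals.test {t : Test} {a b : Cmd} {k t₁ t₂ x y z : ℕ} {σ : State w} (hw : 1 < 2 ^ w)
    (hz : z ≤ 1)
    (ha : Evals ω B a k t₁ σ x)
    (hb : ∀ σ' : State w, (∀ i < k, σ'.reg i = σ.reg i) → σ'.mem = σ.mem →
      Evals ω B b (k + 1) t₂ σ' y)
    (ht : ∀ ρ : State w, (ρ.reg k).toNat = x → (ρ.reg (k + 1)).toNat = y →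
      (t.Holds ρ ↔ z = 1)) :
    Evals ω B (.seq a (.seq b (.ifelse t (.const k 1) (.const k 0)))) k (t₁ + t₂ + 2) σ z := by
  obtain ⟨τ, h1, h2, h3, h4, h5, h6⟩ := ha
  obtain ⟨ρ, g1, g2, g3, g4, g5, g6⟩ := hb τ h3 h4
  have key := ht ρ (by rw [g3 k (by omega), h2]) g2
  by_cases hT : t.Holds ρ
  · refine ⟨_, .seq h1 (.seq g1 (.ifelse_true hT (.const ..))), ?_, ?_, ?_, ?_, ?_⟩
    · simp only [State.set, Function.update_self]
      rw [key.1 hT, BitVec.toNat_ofNat, Nat.mod_eq_of_lt hw]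
    · intro i hi
      simp only [State.set, State.tick]
      rw [Function.update_of_ne (by omega), g3 i (by omega), h3 i hi]
    · simp [State.set, State.tick, g4, h4]
    · simp only [State.set, State.tick]; omega
    · simp only [State.set, State.tick]; omega
  · refine ⟨_, .seq h1 (.seq g1 (.ifelse_false hT (.const ..))), ?_, ?_, ?_, ?_, ?_⟩
    · simp only [State.set, Function.update_self]
      have : z ≠ 1 := fun h => hT (key.2 h)
      have : z = 0 := by omega
      simp [this]
    · intro i hi
      simp only [State.set, State.tick]
      rw [Function.update_of_ne (by omega), g3 i (by omega), h3 i hi]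
    · simp [State.set, State.tick, g4, h4]
    · simp only [State.set, State.tick]; omega
    · simp only [State.set, State.tick]; omega

lemma toNat_or_self (x : BitVec w) : x ||| x = x := by simp

/-- Turning an index in register `k` into the address of an entry of array `f`. -/
lemma Evals.address {a : Cmd} {k t x f : ℕ} {σ : State w} (hB : B ≤ 2 ^ w) (hw : 8 < 2 ^ w)
    (hf : f < 8) (hx : 8 * x + f < B) (ha : Evals ω B a k t σ x) (rest : Cmd)
    {Q : State w → Prop}
    (hr : ∀ τ : State w, (τ.reg k).toNat = 8 * x + f → (∀ i < k, τ.reg i = σ.reg i) →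
      τ.mem = σ.mem → τ.time ≤ σ.time + t + 4 → τ.peak ≤ max σ.peak B →
      ∃ ρ, Exec ω rest τ ρ ∧ Q ρ) :
    ∃ ρ, Exec ω (.seq a (.seq (.const (k + 1) 8) (.seq (.op .mul k k (k + 1))
      (.seq (.const (k + 1) f) (.seq (.op .add k k (k + 1)) rest))))) σ ρ ∧ Q ρ := by
  obtain ⟨τ, h1, h2, h3, h4, h5, h6⟩ := ha
  let τ₁ := τ.set (k + 1) (BitVec.ofNat w 8)
  let τ₂ := τ₁.set k (BinOp.mul.eval (τ₁.reg k) (τ₁.reg (k + 1)))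
  let τ₃ := τ₂.set (k + 1) (BitVec.ofNat w f)
  let τ₄ := τ₃.set k (BinOp.add.eval (τ₃.reg k) (τ₃.reg (k + 1)))
  have e : (τ₄.reg k).toNat = 8 * x + f := by
    have hm : x * 8 < 2 ^ w := by omega
    have hf' : f < 2 ^ w := by omega
    simp only [τ₄, τ₃, τ₂, τ₁, State.set, Function.update_self, BinOp.eval,
      Function.update_of_ne (show k ≠ k + 1 by omega), BitVec.toNat_add,
        BitVec.toNat_mul, BitVec.toNat_ofNat, h2,
      Nat.mod_eq_of_lt hw, Nat.mod_eq_of_lt hm, Nat.mod_eq_of_lt hf']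
    rw [Nat.mod_eq_of_lt (by omega)]; omega
  obtain ⟨ρ, hρ, hQ⟩ := hr τ₄ e (fun i hi => by
    simp only [τ₄, τ₃, τ₂, τ₁, State.set, State.tick]
    rw [Function.update_of_ne (by omega), Function.update_of_ne (by omega),
      Function.update_of_ne (by omega), Function.update_of_ne (by omega), h3 i hi])
    (by simp [τ₄, τ₃, τ₂, τ₁, State.set, State.tick, h4])
    (by simp only [τ₄, τ₃, τ₂, τ₁, State.set, State.tick]; omega)
    (by simp only [τ₄, τ₃, τ₂, τ₁, State.set, State.tick]; omega)
  exact ⟨ρ, .seq h1 (.seq (.const ..) (.seq (.op ..) (.seq (.const ..) (.seq (.op ..) hρ)))), hQ⟩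

/-- The code of an expression whose evaluation stays within the words and the addresses below
`B` computes its value, although the machine computes modulo `2 ^ w`. -/
theorem Ex.code_correct (hB : B ≤ 2 ^ w) (hw : 8 < 2 ^ w) (s : HS) (e : Ex)
    (he : e.ok (2 ^ w) B s) : ∀ (k : ℕ) (_ : 64 ≤ k) (σ : State w) (_ : Rel σ s),
      Evals ω B (e.code k) k e.size σ (e.ev s) := by
  have step : ∀ {k : ℕ} {σ σ' : State w}, 64 ≤ k → Rel σ s → (∀ i < k, σ'.reg i = σ.reg i) →
      σ'.mem = σ.mem → Rel σ' s := fun hk hσ h h' => hσ.of_eq (fun i hi => h i (by omega)) h'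
  induction e with
  | var i =>
    intro k hk σ hσ
    refine ⟨_, .op .., ?_, ?_, rfl, le_rfl, by simp [State.set, State.tick]⟩
    · simp only [State.set, Function.update_self, BinOp.eval, toNat_or_self]
      exact hσ.1 i he
    · intro j hj; simp only [State.set]; rw [Function.update_of_ne (by omega)]
  | lit c =>
    intro k hk σ hσ
    refine ⟨_, .const .., ?_, ?_, rfl, le_rfl, by simp [State.set, State.tick]⟩
    · simp only [State.set, Function.update_self, BitVec.toNat_ofNat]
      exact Nat.mod_eq_of_lt he
    · intro j hj; simp only [State.set]; rw [Function.update_of_ne (by omega)]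
  | add a b iha ihb =>
    intro k hk σ hσ
    refine Evals.binop (iha he.1 k hk σ hσ)
      (fun σ' h h' => ihb he.2.1 (k + 1) (by omega) σ' (step hk hσ h h')) fun u v hu hv => ?_
    simp only [BinOp.eval, BitVec.toNat_add, hu, hv]
    exact Nat.mod_eq_of_lt he.2.2
  | sub a b iha ihb =>
    intro k hk σ hσ
    refine Evals.binop (iha he.1 k hk σ hσ)
      (fun σ' h h' => ihb he.2.1 (k + 1) (by omega) σ' (step hk hσ h h')) fun u v hu hv => ?_
    have := he.2.2
    simp only [BinOp.eval]
    rw [BitVec.toNat_sub_of_le (by rw [BitVec.le_def]; omega), hu, hv]; rfl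
  | mul a b iha ihb =>
    intro k hk σ hσ
    refine Evals.binop (iha he.1 k hk σ hσ)
      (fun σ' h h' => ihb he.2.1 (k + 1) (by omega) σ' (step hk hσ h h')) fun u v hu hv => ?_
    simp only [BinOp.eval, BitVec.toNat_mul, hu, hv]
    exact Nat.mod_eq_of_lt he.2.2
  | div a b iha ihb =>
    intro k hk σ hσ
    refine Evals.binop (iha he.1 k hk σ hσ)
      (fun σ' h h' => ihb he.2 (k + 1) (by omega) σ' (step hk hσ h h')) fun u v hu hv => ?_
    simp only [BinOp.eval, BitVec.toNat_udiv, hu, hv]; rfl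
  | arr f e ih =>
    intro k hk σ hσ
    refine Evals.address hB hw he.2.1 he.2.2 (ih he.1 k hk σ hσ) (.load k k) ?_
    intro τ h1 h2 h3 h4 h5
    refine ⟨_, .load .., ?_, ?_, ?_, ?_, ?_⟩
    · simp only [State.set, Function.update_self]
      rw [h3, hσ.2, h1]
      have := he.2.1
      rw [show (8 * e.ev s + f) % 8 = f by omega, show (8 * e.ev s + f) / 8 = e.ev s by omega]
      rfl
    · intro i hi
      simp only [State.set, State.touch, State.tick]
      rw [Function.update_of_ne (by omega), h2 i hi]
    · simp [State.set, State.touch, State.tick, h3]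
    · simp only [State.set, State.touch, State.tick, Ex.size]; omega
    · have := he.2.2
      simp only [State.set, State.touch, State.tick]; omega
  | lt a b iha ihb =>
    intro k hk σ hσ
    refine Evals.test (by omega) (by simp only [Ex.ev]; split <;> simp) (iha he.1 k hk σ hσ)
      (fun σ' h h' => ihb he.2 (k + 1) (by omega) σ' (step hk hσ h h')) fun ρ hu hv => ?_
    simp only [Test.Holds, BitVec.lt_def, hu, hv, Ex.ev]; split <;> simp_all
  | eq a b iha ihb =>
    intro k hk σ hσ
    refine Evals.test (by omega) (by simp only [Ex.ev]; split <;> simp) (iha he.1 k hk σ hσ)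
      (fun σ' h h' => ihb he.2 (k + 1) (by omega) σ' (step hk hσ h h')) fun ρ hu hv => ?_
    simp only [Test.Holds, ← BitVec.toNat_inj, hu, hv, Ex.ev]; split <;> simp_all
  | and a b iha ihb =>
    intro k hk σ hσ
    obtain ⟨τ, h1, h2, h3, h4, h5, h6⟩ := iha he.1 k hk σ hσ
    let ρ := τ.set (k + 1) (BitVec.ofNat w 0)
    have hk0 : (ρ.reg k).toNat = a.ev s := by
      simp only [ρ, State.set]; rw [Function.update_of_ne (by omega), h2]
    have hk1 : (ρ.reg (k + 1)).toNat = 0 := by simp [ρ, State.set]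
    have hreg : ∀ i < k, ρ.reg i = σ.reg i := fun i hi => by
      simp only [ρ, State.set, State.tick]; rw [Function.update_of_ne (by omega), h3 i hi]
    by_cases h0 : a.ev s = 0
    · refine ⟨_, .seq h1 (.seq (.const ..) (.ifelse_true (σ := ρ) ?_ (.skip _))),
        ?_, hreg, ?_, ?_, ?_⟩
      · simp only [Test.Holds, ← BitVec.toNat_inj, hk0, hk1, h0]
      · simp only [State.tick, hk0, Ex.ev, h0, if_true]
      · simp [ρ, State.set, State.tick, h4]
      · simp only [ρ, State.set, State.tick, Ex.size]; omega
      · simp only [ρ, State.set, State.tick]; omega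
    · have hρ : Rel ρ.tick s := step hk hσ hreg (by simp [ρ, State.set, State.tick, h4])
      obtain ⟨π, g1, g2, g3, g4, g5, g6⟩ := ihb (he.2 h0) k hk ρ.tick hρ
      refine ⟨π, .seq h1 (.seq (.const ..) (.ifelse_false (σ := ρ) ?_ g1)), ?_, ?_, ?_, ?_, ?_⟩
      · simp only [Test.Holds, ← BitVec.toNat_inj, hk0, hk1, h0, not_false_eq_true]
      · simp only [g2, Ex.ev, h0, if_false]
      · intro i hi; rw [g3 i hi]; exact hreg i hi
      · rw [g4]; simp [ρ, State.set, State.tick, h4]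
      · simp only [ρ, State.set, State.tick, Ex.size] at g5 ⊢; omega
      · simp only [ρ, State.set, State.tick] at g6; omega

/-- Evaluating a condition for a branch: its value in register 64, zero in register 65. -/
lemma Ex.test_code (hB : B ≤ 2 ^ w) (hw : 8 < 2 ^ w) {s : HS} {e : Ex} (he : e.ok (2 ^ w) B s)
    {σ : State w} (hσ : Rel σ s) : ∃ τ, Exec ω (.seq (e.code 64) (.const 65 0)) σ τ ∧ Rel τ s ∧
      (τ.reg 64).toNat = e.ev s ∧ (τ.reg 65).toNat = 0 ∧ τ.time ≤ σ.time + e.size + 1 ∧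
      τ.peak ≤ max σ.peak B := by
  obtain ⟨τ, h1, h2, h3, h4, h5, h6⟩ := Ex.code_correct (ω := ω) hB hw s e he 64 le_rfl σ hσ
  refine ⟨_, .seq h1 (.const ..), ?_, ?_, ?_, ?_, ?_⟩
  · refine hσ.of_eq (fun i hi => ?_) ?_
    · simp only [State.set]; rw [Function.update_of_ne (by omega), h3 i hi]
    · simp [State.set, State.tick, h4]
  · simp only [State.set]; rw [Function.update_of_ne (by omega), h2]
  · simp [State.set]
  · simp only [State.set, State.tick]; omega
  · simp only [State.set, State.tick]; omega

/-- The compiled program does what the statement does, accesses only addresses below `B`, and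
takes at most `c.unit` steps per unit of cost. -/
theorem Stm.code_correct (hB : B ≤ 2 ^ w) (hw : 8 < 2 ^ w) {c : Stm} {s t : HS} {n : ℕ}
    (h : BS (2 ^ w) B c s t n) : ∀ (u : ℕ) (_ : c.unit ≤ u) (σ : State w) (_ : Rel σ s),
      ∃ τ, Exec ω c.code σ τ ∧ Rel τ t ∧ τ.time ≤ σ.time + u * n ∧ τ.peak ≤ max σ.peak B := by
  induction h with
  | skip s => intro u hu σ hσ; exact ⟨σ, .skip _, hσ, by simp, by simp⟩
  | @asg s i e hi he =>
    intro u hu σ hσ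
    obtain ⟨τ, h1, h2, h3, h4, h5, h6⟩ := Ex.code_correct (ω := ω) hB hw s e he 64 le_rfl σ hσ
    refine ⟨_, .seq h1 (.op ..), ⟨fun j hj => ?_, fun x => ?_⟩, ?_, ?_⟩
    · simp only [State.set, HS.set_v, Function.update_apply, BinOp.eval, toNat_or_self]
      split
      · exact h2
      · rw [h3 j hj]; exact hσ.1 j hj
    · simp only [State.set, State.tick, h4, HS.set_a]; exact hσ.2 x
    · simp only [State.set, State.tick]; simp only [Stm.unit] at hu; omega
    · simp only [State.set, State.tick]; omega
  | @sto s f e₁ e₂ he₁ he₂ hf hb =>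
    intro u hu σ hσ
    refine Evals.address hB hw hf hb (Ex.code_correct (ω := ω) hB hw s e₁ he₁ 64 le_rfl σ hσ)
      (.seq (e₂.code 65) (.store 64 65)) ?_
    intro τ h1 h2 h3 h4 h5
    have hτ : Rel τ s := hσ.of_eq h2 h3
    obtain ⟨ρ, g1, g2, g3, g4, g5, g6⟩ :=
      Ex.code_correct (ω := ω) hB hw s e₂ he₂ 65 (by omega) τ hτ
    have hx : (ρ.reg 64).toNat = 8 * e₁.ev s + f := by rw [g3 64 (by omega), h1]
    refine ⟨_, .seq g1 (.store ..), ⟨fun j hj => ?_, fun x => ?_⟩, ?_, ?_⟩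
    · simp only [State.put, State.touch, State.tick, HS.put_v]
      rw [g3 j (by omega)]; exact hτ.1 j hj
    · simp only [State.put, Function.update_apply, HS.put_a, State.touch, State.tick]
      by_cases hxx : x = ρ.reg 64
      · rw [if_pos hxx, hxx, hx, if_pos (by constructor <;> omega), g2]
      · rw [if_neg hxx, if_neg, g4, hτ.2]
        rintro ⟨p, q⟩
        exact hxx (BitVec.eq_of_toNat_eq (by omega))
    · simp only [State.put, State.touch, State.tick]; simp only [Stm.unit] at hu; omega
    · simp only [State.put, State.touch, State.tick]; omega
  | @seq s₁ s₂ s t r m n h₁ h₂ ih₁ ih₂ =>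
    intro u hu σ hσ
    simp only [Stm.unit] at hu
    obtain ⟨τ, h1, h2, h3, h4⟩ := ih₁ u (by omega) σ hσ
    obtain ⟨ρ, g1, g2, g3, g4⟩ := ih₂ u (by omega) τ h2
    exact ⟨ρ, .seq h1 g1, g2, by rw [mul_add]; omega, by omega⟩
  | @ite_true e s₁ s₂ s t n he hv h ih =>
    intro u hu σ hσ
    simp only [Stm.unit] at hu
    obtain ⟨τ, h1, h2, h3, h4, h5, h6⟩ := Ex.test_code (ω := ω) hB hw he hσ
    obtain ⟨ρ, g1, g2, g3, g4⟩ := ih u (by omega) τ.tick h2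
    cases h1 with
    | seq k1 k2 =>
      refine ⟨ρ, .seq k1 (.seq k2 (.ifelse_false ?_ g1)), g2, ?_, ?_⟩
      · simp only [Test.Holds, ← BitVec.toNat_inj, h3, h4, hv, not_false_eq_true]
      · simp only [State.tick] at g3; rw [mul_add]; omega
      · simp only [State.tick] at g4; omega
  | @ite_false e s₁ s₂ s t n he hv h ih =>
    intro u hu σ hσ
    simp only [Stm.unit] at hu
    obtain ⟨τ, h1, h2, h3, h4, h5, h6⟩ := Ex.test_code (ω := ω) hB hw he hσ
    obtain ⟨ρ, g1, g2, g3, g4⟩ := ih u (by omega) τ.tick h2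
    cases h1 with
    | seq k1 k2 =>
      refine ⟨ρ, .seq k1 (.seq k2 (.ifelse_true ?_ g1)), g2, ?_, ?_⟩
      · simp only [Test.Holds, ← BitVec.toNat_inj, h3, h4, hv]
      · simp only [State.tick] at g3; rw [mul_add]; omega
      · simp only [State.tick] at g4; omega
  | @while_true e s₁ s t r m n he hv h h' ih ih' =>
    intro u hu σ hσ
    have hu' := hu
    simp only [Stm.unit] at hu
    obtain ⟨τ, h1, h2, h3, h4, h5, h6⟩ := Ex.test_code (ω := ω) hB hw he hσ
    obtain ⟨ρ, g1, g2, g3, g4⟩ := ih u (by omega) τ.tick h2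
    obtain ⟨π, k1, k2, k3, k4⟩ := ih' u hu' ρ g2
    cases k1 with
    | seq l1 l2 =>
      refine ⟨π, .seq h1 (.loop_true ?_ (.seq g1 l1) l2), k2, ?_, ?_⟩
      · simp only [Test.Holds, BitVec.lt_def, h3, h4]; omega
      · simp only [State.tick] at g3; rw [mul_add, mul_add]; omega
      · simp only [State.tick] at g4; omega
  | @while_false e s₁ s he hv =>
    intro u hu σ hσ
    simp only [Stm.unit] at hu
    obtain ⟨τ, h1, h2, h3, h4, h5, h6⟩ := Ex.test_code (ω := ω) hB hw he hσ
    refine ⟨_, .seq h1 (.loop_false ?_), h2, ?_, ?_⟩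
    · simp only [Test.Holds, BitVec.lt_def, h3, h4]; omega
    · simp only [State.tick]; omega
    · simp only [State.tick]; omega

end Compile

/-! ### Rules for reasoning about structured programs -/

/-- The statement `c` terminates from `s` with a final state and a cost that satisfy `Q`. -/
def Wp (W B : ℕ) (c : Stm) (s : HS) (Q : HS → ℕ → Prop) : Prop :=
  ∃ t n, BS W B c s t n ∧ Q t n

section Rules

variable {W B : ℕ}

lemma Wp.mono {c : Stm} {s : HS} {P Q : HS → ℕ → Prop} (h : Wp W B c s P)
    (hPQ : ∀ t n, P t n → Q t n) : Wp W B c s Q := by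
  obtain ⟨t, n, h1, h2⟩ := h; exact ⟨t, n, h1, hPQ _ _ h2⟩

lemma Wp.skip {s : HS} {Q : HS → ℕ → Prop} (h : Q s 0) : Wp W B .skip s Q := ⟨s, 0, .skip s, h⟩

lemma Wp.asg {i : ℕ} {e : Ex} {s : HS} {Q : HS → ℕ → Prop} (hi : i < 64) (he : e.ok W B s)
    (h : Q (s.set i (e.ev s)) 1) : Wp W B (.asg i e) s Q := ⟨_, 1, .asg s hi he, h⟩

lemma Wp.sto {f : ℕ} {e₁ e₂ : Ex} {s : HS} {Q : HS → ℕ → Prop} (h₁ : e₁.ok W B s)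
    (h₂ : e₂.ok W B s) (hf : f < 8) (hB : 8 * e₁.ev s + f < B)
    (h : Q (s.put f (e₁.ev s) (e₂.ev s)) 1) : Wp W B (.sto f e₁ e₂) s Q :=
  ⟨_, 1, .sto s h₁ h₂ hf hB, h⟩

lemma Wp.seq {c₁ c₂ : Stm} {s : HS} {Q : HS → ℕ → Prop}
    (h : Wp W B c₁ s fun t m => Wp W B c₂ t fun r n => Q r (m + n)) :
    Wp W B (.seq c₁ c₂) s Q := by
  obtain ⟨t, m, h1, r, n, h2, h3⟩ := h; exact ⟨r, _, .seq h1 h2, h3⟩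

lemma Wp.ite {e : Ex} {c₁ c₂ : Stm} {s : HS} {Q : HS → ℕ → Prop} (he : e.ok W B s)
    (h₁ : e.ev s ≠ 0 → Wp W B c₁ s fun t n => Q t (1 + n))
    (h₂ : e.ev s = 0 → Wp W B c₂ s fun t n => Q t (1 + n)) : Wp W B (.ite e c₁ c₂) s Q := by
  by_cases h : e.ev s = 0
  · obtain ⟨t, n, g1, g2⟩ := h₂ h; exact ⟨t, _, .ite_false he h g1, g2⟩
  · obtain ⟨t, n, g1, g2⟩ := h₁ h; exact ⟨t, _, .ite_true he h g1, g2⟩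

/-- Loop rule; the number in the invariant `I` bounds the cost that is still to come. -/
lemma Wp.loop {e : Ex} {c : Stm} (I : ℕ → HS → Prop) (P : HS → Prop)
    (he : ∀ n s, I n s → e.ok W B s) (hP : ∀ n s, I n s → e.ev s = 0 → P s)
    (hI : ∀ n s, I n s → e.ev s ≠ 0 →
      Wp W B c s fun t m => ∃ n', I n' t ∧ n' + m + 1 ≤ n) :
    ∀ n s, I n s → Wp W B (.loop e c) s fun t m => P t ∧ m ≤ n + 1 := by
  intro n
  induction n using Nat.strong_induction_on with
  | _ n ih =>
    intro s hs
    by_cases h : e.ev s = 0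
    · exact ⟨s, 1, .while_false (he n s hs) h, hP n s hs h, by omega⟩
    · obtain ⟨t, m, h1, n', h2, h3⟩ := hI n s hs h
      obtain ⟨r, k, h4, h5, h6⟩ := ih n' (by omega) t h2
      exact ⟨r, _, .while_true (he n s hs) h h1 h4, h5, by omega⟩

end Rules

/-! ### The tree of grids over a sorted array -/

/-- The width of a cell when the range of the sorted keys `κ L, …, κ (R - 1)` is divided into
`R - L` cells. -/
def gridWidth (κ : ℕ → ℕ) (L R : ℕ) : ℕ := (κ (R - 1) - κ L) / (R - L) + 1

/-- The cell of a key `q ≥ κ L` in the grid over `κ L, …, κ (R - 1)`. -/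
def cellOf (κ : ℕ → ℕ) (L R q : ℕ) : ℕ := (q - κ L) / gridWidth κ L R

/-- The first index in `[L, R)` whose key lies in a cell with number at least `j`
(`R` if there is none). -/
def cellStart (κ : ℕ → ℕ) (L R j : ℕ) : ℕ :=
  L + ((Finset.Ico L R).filter fun y => cellOf κ L R (κ y) < j).card

/-- The interval `[L, R)` of indices that forms the node at depth `d` above the index `y`: the
root is `[0, M)`, and the children of a node are the sets of the indices in its cells. -/
def node (κ : ℕ → ℕ) (M : ℕ) : ℕ → ℕ → ℕ × ℕ
  | 0, _ => (0, M)
  | d + 1, y =>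
    let L := (node κ M d y).1
    let R := (node κ M d y).2
    (cellStart κ L R (cellOf κ L R (κ y)), cellStart κ L R (cellOf κ L R (κ y) + 1))

/-- The keys `κ 0, …, κ (M - 1)` are strictly increasing. -/
def IncrOn (κ : ℕ → ℕ) (M : ℕ) : Prop := ∀ i j, i < j → j < M → κ i < κ j

section Grid

variable {κ : ℕ → ℕ} {M L R : ℕ}

lemma IncrOn.le (h : IncrOn κ M) {i j : ℕ} (hij : i ≤ j) (hj : j < M) : κ i ≤ κ j := by
  rcases hij.eq_or_lt with rfl | h'
  · exact le_rfl
  · exact (h i j h' hj).le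

lemma IncrOn.lt_of_lt (h : IncrOn κ M) {i j : ℕ} (hi : i < M) (hij : κ i < κ j) : i < j := by
  by_contra hc
  exact absurd (h.le (not_lt.1 hc) hi) (by omega)

lemma gridWidth_pos : 0 < gridWidth κ L R := Nat.succ_pos _

lemma cellOf_mono {p q : ℕ} (h : p ≤ q) : cellOf κ L R p ≤ cellOf κ L R q :=
  Nat.div_le_div_right (by omega)

lemma cellOf_lt (hLR : L < R) {q : ℕ} (hq : q ≤ κ (R - 1)) : cellOf κ L R q < R - L := by
  unfold cellOf
  rw [Nat.div_lt_iff_lt_mul gridWidth_pos]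
  have h1 := Nat.lt_div_mul_add (a := κ (R - 1) - κ L) (b := R - L) (by omega)
  unfold gridWidth
  rw [mul_add, mul_one, mul_comm]
  omega

/-- The cells cut the sorted array into consecutive pieces. -/
lemma cellStart_iff (h : IncrOn κ M) (hR : R ≤ M) {y : ℕ} (hy : L ≤ y) (hy' : y < R) (j : ℕ) :
    y < cellStart κ L R j ↔ cellOf κ L R (κ y) < j := by
  unfold cellStart
  constructor
  · intro hlt
    by_contra hc
    have : ((Finset.Ico L R).filter fun y => cellOf κ L R (κ y) < j) ⊆ Finset.Ico L y := by
      intro z hz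
      rw [Finset.mem_filter, Finset.mem_Ico] at hz
      rw [Finset.mem_Ico]
      refine ⟨hz.1.1, ?_⟩
      by_contra hyz
      have := cellOf_mono (κ := κ) (L := L) (R := R) (h.le (not_lt.1 hyz) (by omega))
      omega
    have := Finset.card_le_card this
    rw [Nat.card_Ico] at this
    omega
  · intro hlt
    have : Finset.Ico L (y + 1) ⊆ (Finset.Ico L R).filter fun y => cellOf κ L R (κ y) < j := by
      intro z hz
      rw [Finset.mem_Ico] at hz
      rw [Finset.mem_filter, Finset.mem_Ico]
      refine ⟨⟨hz.1, by omega⟩, ?_⟩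
      have := cellOf_mono (κ := κ) (L := L) (R := R)
        (h.le (show z ≤ y by omega) (by omega))
      omega
    have := Finset.card_le_card this
    rw [Nat.card_Ico] at this
    omega

lemma le_cellStart (j : ℕ) : L ≤ cellStart κ L R j := Nat.le_add_right _ _

lemma cellStart_le (hLR : L ≤ R) (j : ℕ) : cellStart κ L R j ≤ R := by
  have := Finset.card_filter_le (Finset.Ico L R) fun y => cellOf κ L R (κ y) < j
  rw [Nat.card_Ico] at this
  unfold cellStart; omega

/-- The node above `y` contains `y`. -/
lemma node_mem (h : IncrOn κ M) {y : ℕ} (hy : y < M) (d : ℕ) :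
    (node κ M d y).1 ≤ y ∧ y < (node κ M d y).2 ∧ (node κ M d y).2 ≤ M := by
  induction d with
  | zero => exact ⟨Nat.zero_le _, hy, le_rfl⟩
  | succ d ih =>
    obtain ⟨h1, h2, h3⟩ := ih
    simp only [node]
    refine ⟨?_, ?_, (cellStart_le (by omega) _).trans h3⟩
    · rw [← not_lt, cellStart_iff h h3 h1 h2]; omega
    · rw [cellStart_iff h h3 h1 h2]; omega

lemma node_succ_le (h : IncrOn κ M) {y : ℕ} (hy : y < M) (d : ℕ) :
    (node κ M d y).1 ≤ (node κ M (d + 1) y).1 ∧ (node κ M (d + 1) y).2 ≤ (node κ M d y).2 := by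
  have := node_mem h hy d
  exact ⟨le_cellStart _, cellStart_le (by omega) _⟩

/-- Every index of a node has this node above it. -/
lemma node_eq (h : IncrOn κ M) {y : ℕ} (hy : y < M) (d : ℕ) :
    ∀ z, (node κ M d y).1 ≤ z → z < (node κ M d y).2 → node κ M d z = node κ M d y := by
  induction d with
  | zero => intro z _ _; rfl
  | succ d ih =>
    intro z h1 h2
    have hm := node_mem h hy d
    have hs := node_succ_le h hy d
    have hz1 : (node κ M d y).1 ≤ z := by omega
    have hz2 : z < (node κ M d y).2 := by omega
    have e := ih z hz1 hz2
    have c1 : cellOf κ (node κ M d y).1 (node κ M d y).2 (κ z)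
        = cellOf κ (node κ M d y).1 (node κ M d y).2 (κ y) := by
      simp only [node] at h1 h2
      rw [← not_lt, cellStart_iff h hm.2.2 hz1 hz2] at h1
      rw [cellStart_iff h hm.2.2 hz1 hz2] at h2
      omega
    simp only [node, e, c1]

/-- The children of a node are the fibres of `cellOf`. -/
lemma mem_node_succ (h : IncrOn κ M) {y : ℕ} (hy : y < M) (d : ℕ) {z : ℕ}
    (h1 : (node κ M d y).1 ≤ z) (h2 : z < (node κ M d y).2) :
    ((node κ M (d + 1) y).1 ≤ z ∧ z < (node κ M (d + 1) y).2) ↔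
      cellOf κ (node κ M d y).1 (node κ M d y).2 (κ z)
        = cellOf κ (node κ M d y).1 (node κ M d y).2 (κ y) := by
  have hm := node_mem h hy d
  simp only [node]
  rw [← not_lt, cellStart_iff h hm.2.2 h1 h2, cellStart_iff h hm.2.2 h1 h2]
  omega

/-- The nodes of a fixed depth tile the array. -/
lemma node_next (h : IncrOn κ M) {p : ℕ} (hp : p < M) (d : ℕ) (hr : (node κ M d p).2 < M) :
    (node κ M d (node κ M d p).2).1 = (node κ M d p).2 := by
  set r := (node κ M d p).2 with hr'
  have hm := node_mem h hp d
  have hm' := node_mem h hr d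
  by_contra hne
  have e1 : node κ M d (r - 1) = node κ M d r := node_eq h hr d _ (by omega) (by omega)
  have e2 : node κ M d (r - 1) = node κ M d p := node_eq h hp d _ (by omega) (by omega)
  rw [e1] at e2
  rw [e2] at hm'
  omega

variable {q y : ℕ} {d : ℕ}

/-- The index `y` is the last one with a key at most `q`. -/
def IsPredIdx (κ : ℕ → ℕ) (M q y : ℕ) : Prop := y < M ∧ κ y ≤ q ∧ (y + 1 < M → q < κ (y + 1))

lemma IsPredIdx.le_iff (h : IncrOn κ M) (hy : IsPredIdx κ M q y) {x : ℕ} (hx : x < M) :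
    κ x ≤ q ↔ x ≤ y := by
  constructor
  · intro hxq
    by_contra hc
    have := hy.2.2 (by omega)
    have := h.le (show y + 1 ≤ x by omega) hx
    omega
  · intro hxy
    exact (h.le hxy hy.1).trans hy.2.1

/-- First outcome of a step at the node above `y`: if the key `q` lies beyond the grid, then the
last index of the node is the answer. -/
lemma grid_step_right (h : IncrOn κ M) (hy : IsPredIdx κ M q y)
    (hj : (node κ M d y).2 - (node κ M d y).1 ≤
      cellOf κ (node κ M d y).1 (node κ M d y).2 q) : (node κ M d y).2 - 1 = y := by
  have hm := node_mem h hy.1 d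
  by_contra hne
  have : ¬ κ ((node κ M d y).2 - 1) ≤ q := by
    rw [hy.le_iff h (by omega)]; omega
  have := cellOf_lt (κ := κ) (show (node κ M d y).1 < (node κ M d y).2 by omega)
    (show q ≤ _ by omega)
  omega

/-- Second outcome of a step: if the table entry `x` of the cell of `q` has a key at most `q`,
then it is the start of the child in which the search goes on. -/
lemma grid_step_in (h : IncrOn κ M) (hy : IsPredIdx κ M q y) {x : ℕ}
    (hx : x = cellStart κ (node κ M d y).1 (node κ M d y).2
      (cellOf κ (node κ M d y).1 (node κ M d y).2 q))
    (hxR : x < (node κ M d y).2) (hxq : κ x ≤ q) : (node κ M (d + 1) y).1 = x := by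
  have hm := node_mem h hy.1 d
  have hL : (node κ M d y).1 ≤ x := hx ▸ le_cellStart _
  rw [hy.le_iff h (by omega)] at hxq
  have h1 : cellOf κ (node κ M d y).1 (node κ M d y).2 q ≤
      cellOf κ (node κ M d y).1 (node κ M d y).2 (κ x) := by
    rw [← not_lt, ← cellStart_iff h hm.2.2 hL hxR, ← hx]; omega
  have h2 := cellOf_mono (κ := κ) (L := (node κ M d y).1) (R := (node κ M d y).2)
    (h.le hxq hy.1)
  have h3 := cellOf_mono (κ := κ) (L := (node κ M d y).1) (R := (node κ M d y).2) hy.2.1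
  simp only [node]
  rw [hx]; congr 1; omega

/-- Third outcome of a step: otherwise no key in the cell of `q` is at most `q`, and the answer
is the index before the table entry `x`. -/
lemma grid_step_out (h : IncrOn κ M) (hy : IsPredIdx κ M q y) {x : ℕ}
    (hx : x = cellStart κ (node κ M d y).1 (node κ M d y).2
      (cellOf κ (node κ M d y).1 (node κ M d y).2 q))
    (hxq : x < (node κ M d y).2 → q < κ x) : x = y + 1 := by
  have hm := node_mem h hy.1 d
  have hL : (node κ M d y).1 ≤ x := hx ▸ le_cellStart _
  have hR : x ≤ (node κ M d y).2 := hx ▸ cellStart_le (by omega) _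
  have h1 : y < x := by
    by_contra hc
    have := hxq (by omega)
    have := (hy.le_iff h (show x < M by omega)).2 (by omega)
    omega
  by_contra hne
  have h2 : cellOf κ (node κ M d y).1 (node κ M d y).2 (κ (x - 1)) <
      cellOf κ (node κ M d y).1 (node κ M d y).2 q := by
    rw [← cellStart_iff h hm.2.2 (by omega) (by omega), ← hx]; omega
  have h3 : ¬ κ (x - 1) ≤ q := by rw [hy.le_iff h (by omega)]; omega
  have := cellOf_mono (κ := κ) (L := (node κ M d y).1) (R := (node κ M d y).2)
    (show q ≤ κ (x - 1) by omega)
  omega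

end Grid

/-! ### The programs -/

instance : Add Ex := ⟨Ex.add⟩
instance : Sub Ex := ⟨Ex.sub⟩
instance : Mul Ex := ⟨Ex.mul⟩
instance : Div Ex := ⟨Ex.div⟩
instance (n : ℕ) : OfNat Ex n := ⟨Ex.lit n⟩

section Simp

variable {W B : ℕ} {s : HS} {x y : Ex} {i f : ℕ}

@[simp] lemma ev_var : (Ex.var i).ev s = s.v i := rfl
@[simp] lemma ev_zero : (0 : Ex).ev s = 0 := rfl
@[simp] lemma ev_one : (1 : Ex).ev s = 1 := rfl
@[simp] lemma ev_two : (2 : Ex).ev s = 2 := rfl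
@[simp] lemma ev_add : (x + y).ev s = x.ev s + y.ev s := rfl
@[simp] lemma ev_sub : (x - y).ev s = x.ev s - y.ev s := rfl
@[simp] lemma ev_mul : (x * y).ev s = x.ev s * y.ev s := rfl
@[simp] lemma ev_div : (x / y).ev s = x.ev s / y.ev s := rfl
@[simp] lemma ev_arr : (Ex.arr f x).ev s = s.a f (x.ev s) := rfl
@[simp] lemma ev_lt_eq_zero : (Ex.lt x y).ev s = 0 ↔ y.ev s ≤ x.ev s := by simp [Ex.ev]
@[simp] lemma ev_eq_eq_zero : (Ex.eq x y).ev s = 0 ↔ x.ev s ≠ y.ev s := by simp [Ex.ev]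
@[simp] lemma ev_and_eq_zero : (Ex.and x y).ev s = 0 ↔ x.ev s = 0 ∨ y.ev s = 0 := by
  simp only [Ex.ev, ite_eq_left_iff]; tauto

@[simp] lemma ok_var : (Ex.var i).ok W B s ↔ i < 64 := Iff.rfl
@[simp] lemma ok_zero : (0 : Ex).ok W B s ↔ 0 < W := Iff.rfl
@[simp] lemma ok_one : (1 : Ex).ok W B s ↔ 1 < W := Iff.rfl
@[simp] lemma ok_two : (2 : Ex).ok W B s ↔ 2 < W := Iff.rfl
@[simp] lemma ok_add : (x + y).ok W B s ↔ x.ok W B s ∧ y.ok W B s ∧ x.ev s + y.ev s < W := Iff.rfl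
@[simp] lemma ok_sub : (x - y).ok W B s ↔ x.ok W B s ∧ y.ok W B s ∧ y.ev s ≤ x.ev s := Iff.rfl
@[simp] lemma ok_mul : (x * y).ok W B s ↔ x.ok W B s ∧ y.ok W B s ∧ x.ev s * y.ev s < W := Iff.rfl
@[simp] lemma ok_div : (x / y).ok W B s ↔ x.ok W B s ∧ y.ok W B s := Iff.rfl
@[simp] lemma ok_arr : (Ex.arr f x).ok W B s ↔ x.ok W B s ∧ f < 8 ∧ 8 * x.ev s + f < B := Iff.rfl
@[simp] lemma ok_lt : (Ex.lt x y).ok W B s ↔ x.ok W B s ∧ y.ok W B s := Iff.rfl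
@[simp] lemma ok_eq : (Ex.eq x y).ok W B s ↔ x.ok W B s ∧ y.ok W B s := Iff.rfl
@[simp] lemma ok_and : (Ex.and x y).ok W B s ↔ x.ok W B s ∧ (x.ev s ≠ 0 → y.ok W B s) := Iff.rfl

end Simp

infixr:50 " ;; " => Stm.seq
infix:55 " ≔ " => Stm.asg

-- Global registers: number of stored elements, of static nodes, and of all nodes; updates left
-- in the current epoch; sampling distance and number of samples; capacity.
notation "Rcount" => 34
notation "Rstat" => 35
notation "Rused" => 36
notation "Rleft" => 37
notation "Rgap" => 38
notation "Rsamp" => 39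
notation "Rcap" => 40
-- The key that is searched for, and auxiliary registers.
notation "Rk" => 41
notation "Rl" => 42
notation "Rr" => 43
notation "Rb" => 44
notation "Rnode" => 45
notation "Rend" => 46
notation "Rlo" => 47
notation "Rwd" => 48
notation "Rj" => 49
notation "Rx" => 50
notation "Rmid" => 51
notation "Rs" => 52
notation "Rp" => 53
notation "Ry" => 54
notation "Rt" => 55

/-- The value of a register. -/
abbrev V (i : ℕ) : Ex := .var i

-- The arrays: key, multiplicity and predecessor of a node; tables of the grids; ends of the grid
-- nodes; scratch space for keys and multiplicities.
abbrev keyA (e : Ex) : Ex := .arr 0 e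
abbrev cntA (e : Ex) : Ex := .arr 1 e
abbrev prvA (e : Ex) : Ex := .arr 2 e
abbrev tabA (e : Ex) : Ex := .arr 3 e
abbrev segA (e : Ex) : Ex := .arr 4 e
/-- The key of a sample. -/
abbrev smpA (e : Ex) : Ex := .arr 0 (1 + e * V Rgap)

/-- One step down in the tree of grids: from the current node to the child that holds the
predecessor of the key, the search interval shrinking accordingly. -/
def gridStep : Stm :=
  Rend ≔ segA (V Rb + V Rnode) ;;
  Rlo ≔ smpA (V Rnode) ;;
  Rwd ≔ (smpA (V Rend - 1) - V Rlo) / (V Rend - V Rnode) + 1 ;;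
  Rj ≔ (V Rk - V Rlo) / V Rwd ;;
  .ite (.lt (V Rj) (V Rend - V Rnode))
    (Rx ≔ tabA (V Rb + (V Rnode + V Rj)) ;;
      .ite (.and (.lt (V Rx) (V Rend)) (.eq (.lt (V Rk) (smpA (V Rx))) 0))
        (Rnode ≔ V Rx ;; .ite (.lt (V Rl) (V Rx)) (Rl ≔ V Rx) .skip ;;
          Rt ≔ segA (V Rb + V Rsamp + V Rx) ;;
          .ite (.lt (V Rt) (V Rr)) (Rr ≔ V Rt) .skip)
        (Rl ≔ V Rx - 1 ;; Rr ≔ V Rx))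
    (Rl ≔ V Rend - 1 ;; Rr ≔ V Rend) ;;
  Rb ≔ V Rb + V Rsamp

/-- Search for the predecessor among the samples. -/
def gridSearch : Stm :=
  Rl ≔ 0 ;; Rr ≔ V Rsamp ;; Rb ≔ 0 ;; Rnode ≔ 0 ;;
  .loop (.lt (V Rl + 1) (V Rr))
    (Rmid ≔ (V Rl + V Rr) / 2 ;;
      .ite (.lt (V Rk) (smpA (V Rmid))) (Rr ≔ V Rmid) (Rl ≔ V Rmid) ;;
      gridStep)

/-- Search for the predecessor among the nodes from a sample up to the next sample. -/
def binarySearch : Stm :=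
  Rr ≔ 1 + (V Rl + 1) * V Rgap ;;
  .ite (.lt (V Rstat + 1) (V Rr)) (Rr ≔ V Rstat + 1) .skip ;;
  Rl ≔ 1 + V Rl * V Rgap ;;
  .loop (.lt (V Rl + 1) (V Rr))
    (Rmid ≔ (V Rl + V Rr) / 2 ;;
      .ite (.lt (V Rk) (keyA (V Rmid))) (Rr ≔ V Rmid) (Rl ≔ V Rmid))

/-- Search for the predecessor among the static nodes. -/
def locate : Stm :=
  .ite (.and (.lt 0 (V Rstat)) (.eq (.lt (V Rk) (keyA 1)) 0))
    (gridSearch ;; binarySearch) (Rl ≔ 0)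

/-! ### The search in the static part -/

/-- The static part of the data structure: `m` nodes with the increasing keys `D 0, …, D (m - 1)`,
and the tables for the samples, which are every `g`-th of them. -/
structure Static (W : ℕ) (a : ℕ → ℕ → ℕ) (m g M : ℕ) (D : ℕ → ℕ) : Prop where
  incr : IncrOn D m
  pos : ∀ i < m, 0 < D i
  lt : ∀ i < m, D i < W
  key : ∀ i < m, a 0 (i + 1) = D i
  g_pos : 0 < m → 1 ≤ g
  g_le : g ≤ Nat.log 2 m + 2
  m_lt : 0 < m → m < 2 ^ (g - 1)
  M_eq : 0 < m → M = (m + g - 1) / g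
  size : 0 < m → (g + 1) * M ≤ 4 * m
  tab : 0 < m → ∀ d < g, ∀ y < M, ∀ j,
    j < (node (fun y => D (y * g)) M d y).2 - (node (fun y => D (y * g)) M d y).1 →
    a 3 (d * M + ((node (fun y => D (y * g)) M d y).1 + j)) =
      cellStart (fun y => D (y * g)) (node (fun y => D (y * g)) M d y).1
        (node (fun y => D (y * g)) M d y).2 j
  seg : 0 < m → ∀ d ≤ g, ∀ y < M,
    a 4 (d * M + (node (fun y => D (y * g)) M d y).1) = (node (fun y => D (y * g)) M d y).2

/-- `t` iterations suffice for every search among the samples: from some depth `d ≤ t` on, the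
node has at most `2 ^ (t - d)` elements, so that `t - d` halvings finish the search. -/
def SearchBound (κ : ℕ → ℕ) (M t : ℕ) : Prop :=
  ∀ y < M, ∃ d ≤ t, (node κ M d y).2 - (node κ M d y).1 ≤ 2 ^ (t - d)

lemma le_two_pow_half {x e : ℕ} (h : x ≤ 2 ^ e) (h2 : 2 ≤ x) :
    1 ≤ e ∧ (x + 1) / 2 ≤ 2 ^ (e - 1) := by
  rcases e with _ | e
  · simp at h; omega
  · rw [pow_succ] at h; simp; omega

section Search

variable {W B C : ℕ} {m g M : ℕ} {D : ℕ → ℕ}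

lemma sample_lt (hg : 1 ≤ g) (hM : M = (m + g - 1) / g) {y : ℕ} (hy : y < M) : y * g < m := by
  rw [hM, Nat.lt_iff_add_one_le, Nat.le_div_iff_mul_le hg, add_mul] at hy
  omega

lemma lt_sample (hg : 1 ≤ g) (hM : M = (m + g - 1) / g) {y : ℕ} (hy : M ≤ y) : m ≤ y * g := by
  rw [hM] at hy
  have := (Nat.div_lt_iff_lt_mul hg).1 (show (m + g - 1) / g < y + 1 by omega)
  rw [add_mul] at this
  omega

lemma Static.samples_incr {a : ℕ → ℕ → ℕ} (h : Static W a m g M D) (hm : 0 < m) :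
    IncrOn (fun y => D (y * g)) M := fun _ _ hab hb =>
  h.incr _ _ (Nat.mul_lt_mul_of_pos_right hab (h.g_pos hm))
    (sample_lt (h.g_pos hm) (h.M_eq hm) hb)

/-- The entry `x` of the level `d` of the tables lies within the tables. -/
lemma level_lt {d x : ℕ} (hd : d ≤ g) (hx : x < M) : d * M + x < (g + 1) * M := by
  have := Nat.mul_le_mul_right M hd
  rw [add_mul]; omega

/-- A step of the search at depth `i`: the interval `[Rl, Rr)` keeps the predecessor `y`, and is
either finished or cut down to the node at depth `i + 1`. -/
theorem gridStep_spec (hBW : B ≤ W) (hB : 8 * C ≤ B) {st : HS} (h : Static W st.a m g M D)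
    (hm : 0 < m) (hC : 4 * m + 4 ≤ C) {i y : ℕ} (hi : i < g)
    (hy : IsPredIdx (fun y => D (y * g)) M (st.v Rk) y)
    (vg : st.v Rgap = g) (vM : st.v Rsamp = M) (vb : st.v Rb = i * M)
    (hl : st.v Rl ≤ y) (hr : y < st.v Rr) (hrM : st.v Rr ≤ M)
    (hnode : st.v Rnode = (node (fun y => D (y * g)) M i y).1) :
    Wp W B gridStep st fun t c => c ≤ 20 ∧ t.a = st.a ∧ (∀ x < 42, t.v x = st.v x) ∧
      t.v Rb = (i + 1) * M ∧ t.v Rl ≤ y ∧ y < t.v Rr ∧ t.v Rr - t.v Rl ≤ st.v Rr - st.v Rl ∧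
      t.v Rr ≤ M ∧
      (t.v Rl + 1 < t.v Rr → t.v Rnode = (node (fun y => D (y * g)) M (i + 1) y).1 ∧
        t.v Rr - t.v Rl ≤ (node (fun y => D (y * g)) M (i + 1) y).2 -
          (node (fun y => D (y * g)) M (i + 1) y).1) := by
  set κ := fun y => D (y * g) with hκ
  have hg := h.g_pos hm
  have hM := h.M_eq hm
  have hs := h.size hm
  have hinc : IncrOn κ M := h.samples_incr hm
  have hmem := node_mem hinc hy.1 i
  have hmem' := node_mem hinc hy.1 (i + 1)
  set L := (node κ M i y).1 with hL
  set R := (node κ M i y).2 with hR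
  have hsmp : ∀ x < M, st.a 0 (1 + x * g) = κ x ∧ 1 + x * g < C := fun x hx => by
    have := sample_lt hg hM hx
    exact ⟨by rw [add_comm, h.key _ this], by omega⟩
  have hκW : ∀ x < M, κ x < W ∧ 0 < κ x := fun x hx =>
    ⟨h.lt _ (sample_lt hg hM hx), h.pos _ (sample_lt hg hM hx)⟩
  have hseg : ∀ d ≤ g, ∀ z < M, st.a 4 (d * M + (node κ M d z).1) = (node κ M d z).2 :=
    h.seg hm
  have htab := h.tab hm i hi y hy.1
  have hsegR : st.a 4 (i * M + L) = R := hseg i hi.le y hy.1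
  have lv : ∀ {d x : ℕ}, d ≤ g → x < M → d * M + x < C := fun hd hx => by
    have := level_lt (M := M) hd hx; omega
  have b1 := lv hi.le (show L < M by omega)
  have gMC : M ≤ C := by nlinarith
  obtain ⟨s1, s1'⟩ := hsmp L (by omega)
  obtain ⟨s2, s2'⟩ := hsmp (R - 1) (by omega)
  have hLq : κ L ≤ st.v Rk := (hy.le_iff hinc (by omega)).2 hmem.1
  have hLR : κ L ≤ κ (R - 1) := hinc.le (by omega) (by omega)
  have k1 := hκW L (by omega)
  have k2 := hκW (R - 1) (by omega)
  have m1 : ∀ x < M, x * g < W := fun x hx => by have := (hsmp x hx).2; omega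
  have m2 := m1 L (by omega)
  have m3 := m1 (R - 1) (by omega)
  have hwd : (κ (R - 1) - κ L) / (R - L) + 1 = gridWidth κ L R := rfl
  have hwdW : (κ (R - 1) - κ L) / (R - L) + 1 < W := by
    have := Nat.div_le_self (κ (R - 1) - κ L) (R - L); omega
  unfold gridStep
  refine Wp.seq (Wp.asg (by norm_num) (by simp [vb, hnode]; omega) ?_)
  simp only [ev_arr, ev_add, ev_var, vb, hnode, hsegR]
  refine Wp.seq (Wp.asg (by norm_num) (by simp [vg, hnode]; omega) ?_)
  simp only [ev_arr, ev_add, ev_var, ev_mul, ev_one, HS.set_v, HS.set_a]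
  norm_num only [vg, hnode, ← hL, if_true, if_false, s1]
  refine Wp.seq (Wp.asg (by norm_num) (by
    simp [vg, hnode, s2]; omega) ?_)
  simp only [ev_arr, ev_add, ev_sub, ev_div, ev_var, ev_mul, ev_one, HS.set_v, HS.set_a]
  norm_num only [vg, hnode, ← hL, if_true, if_false, s2, hwd]
  refine Wp.seq (Wp.asg (by norm_num) (by
    simp; omega) ?_)
  simp only [ev_sub, ev_div, ev_var, HS.set_v]
  norm_num only [if_true, if_false]
  rw [show (st.v Rk - κ L) / gridWidth κ L R = cellOf κ L R (st.v Rk) from rfl]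
  set j := cellOf κ L R (st.v Rk) with hj
  have hbM : i * M + M = (i + 1) * M := by rw [add_mul, one_mul]
  have hbW : i * M + M < W := by
    have : (i + 1) * M ≤ (g + 1) * M := Nat.mul_le_mul_right _ (by omega)
    omega
  refine Wp.seq (Wp.ite (by simp [hnode]; omega) ?_ ?_)
  · intro hc
    have hjR : j < R - L := by
      by_contra hcc
      exact hc (by simp [hnode]; omega)
    have hx : st.a 3 (i * M + (L + j)) = cellStart κ L R j := htab j hjR
    set x := cellStart κ L R j with hxd
    have hxR : x ≤ R := cellStart_le (by omega) _
    have hxL : L ≤ x := le_cellStart _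
    have b2 := lv hi.le (show L + j < M by omega)
    refine Wp.seq (Wp.asg (by norm_num) (by simp [vb, hnode]; omega) ?_)
    simp only [ev_arr, ev_add, ev_var, HS.set_v, HS.set_a]
    norm_num only [vb, hnode, ← hL, if_true, if_false, hx]
    refine Wp.ite ?_ ?_ ?_
    · simp [vg]
      intro hxR'
      have := hsmp x (by omega)
      have := m1 x (by omega)
      omega
    · intro hc2
      have hc3 : x < R ∧ κ x ≤ st.v Rk := by
        by_cases hxR' : x < R
        · have := (hsmp x (by omega)).1
          simp [vg, this, hxR'] at hc2
          exact ⟨hxR', hc2⟩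
        · simp [hxR'] at hc2
      have hstep := grid_step_in hinc hy hxd hc3.1 hc3.2
      have b3 := lv (show i + 1 ≤ g by omega) (show x < M by omega)
      have hseg' := hseg (i + 1) (by omega) y hy.1
      rw [hstep] at hseg' hmem'
      rw [add_mul, one_mul] at b3
      refine Wp.seq (Wp.asg (by norm_num) (by simp) ?_)
      refine Wp.seq (Wp.ite (by simp) ?_ ?_)
      · intro hc4
        refine Wp.asg (by norm_num) (by simp) ?_
        refine Wp.seq (Wp.asg (by norm_num) (by simp [vb, vM]; omega) ?_)
        refine Wp.ite (by simp) ?_ ?_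
        · intro hc5
          refine Wp.asg (by norm_num) (by simp) ?_
          refine Wp.asg (by norm_num) (by simp [vb, vM]; omega) ?_
          simp [vb, vM, hbM, hseg', hstep] at hc4 hc5 ⊢
          refine ⟨fun z hz => ?_, by omega, by omega, by omega, by omega⟩
          rw [if_neg, if_neg, if_neg, if_neg, if_neg, if_neg, if_neg, if_neg, if_neg, if_neg]
            <;> omega
        · intro hc5
          refine Wp.skip ?_
          refine Wp.asg (by norm_num) (by simp [vb, vM]; omega) ?_
          simp [vb, vM, hbM, hseg', hstep] at hc4 hc5 ⊢
          refine ⟨fun z hz => ?_, by omega, by omega, by omega, by omega⟩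
          rw [if_neg, if_neg, if_neg, if_neg, if_neg, if_neg, if_neg, if_neg, if_neg] <;> omega
      · intro hc4
        refine Wp.skip ?_
        refine Wp.seq (Wp.asg (by norm_num) (by simp [vb, vM]; omega) ?_)
        refine Wp.ite (by simp) ?_ ?_
        · intro hc5
          refine Wp.asg (by norm_num) (by simp) ?_
          refine Wp.asg (by norm_num) (by simp [vb, vM]; omega) ?_
          simp [vb, vM, hbM, hseg', hstep] at hc4 hc5 ⊢
          refine ⟨fun z hz => ?_, by omega, by omega, by omega, by omega⟩
          rw [if_neg, if_neg, if_neg, if_neg, if_neg, if_neg, if_neg, if_neg, if_neg] <;> omega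
        · intro hc5
          refine Wp.skip ?_
          refine Wp.asg (by norm_num) (by simp [vb, vM]; omega) ?_
          simp [vb, vM, hbM, hseg', hstep] at hc4 hc5 ⊢
          refine ⟨fun z hz => ?_, by omega, by omega, by omega⟩
          rw [if_neg, if_neg, if_neg, if_neg, if_neg, if_neg, if_neg, if_neg] <;> omega
    · intro hc2
      have hstep := grid_step_out hinc hy hxd fun hxR' => by
        have := (hsmp x (by omega)).1
        by_contra hcc
        simp [vg, this] at hc2
        omega
      refine Wp.seq (Wp.asg (by norm_num) (by simp; omega) ?_)
      refine Wp.asg (by norm_num) (by simp) ?_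
      refine Wp.asg (by norm_num) (by simp [vb, vM]; omega) ?_
      simp [vb, vM, hbM]
      refine ⟨fun z hz => ?_, by omega, by omega, by omega, by omega, by omega⟩
      rw [if_neg, if_neg, if_neg, if_neg, if_neg, if_neg, if_neg, if_neg] <;> omega
  · intro hc
    have hjR : R - L ≤ j := by
      by_contra hcc
      simp [hnode] at hc; omega
    have hstep := grid_step_right hinc hy hjR
    rw [← hR] at hstep
    refine Wp.seq (Wp.asg (by norm_num) (by simp; omega) ?_)
    refine Wp.asg (by norm_num) (by simp) ?_
    refine Wp.asg (by norm_num) (by simp [vb, vM]; omega) ?_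
    simp [vb, vM, hbM]
    refine ⟨fun z hz => ?_, by omega, by omega, by omega, by omega, by omega⟩
    rw [if_neg, if_neg, if_neg, if_neg, if_neg, if_neg, if_neg] <;> omega

lemma exists_isPredIdx {κ : ℕ → ℕ} {M q : ℕ} (hM : 0 < M) (h0 : κ 0 ≤ q) :
    ∃ y, IsPredIdx κ M q y := by
  classical
  refine ⟨Nat.findGreatest (fun y => κ y ≤ q) (M - 1), ?_, ?_, fun h => ?_⟩
  · have := Nat.findGreatest_le (P := fun y => κ y ≤ q) (M - 1); omega
  · exact Nat.findGreatest_spec (P := fun y => κ y ≤ q) (Nat.zero_le _) h0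
  · exact not_le.1 (Nat.findGreatest_is_greatest (P := fun y => κ y ≤ q) (Nat.lt_succ_self _)
      (by omega))

/-- The search among the samples takes `O(t)` steps: every iteration halves the interval `[Rl,
Rr)` and cuts it down to the current node of the tree of grids, so that the fast decrease of the
nodes and the halving are both available. -/
theorem gridSearch_spec (hBW : B ≤ W) (hB : 8 * C ≤ B) {st : HS} (h : Static W st.a m g M D)
    (hm : 0 < m) (hC : 4 * m + 4 ≤ C) {t : ℕ}
    (ht : SearchBound (fun y => D (y * g)) M t)
    (vg : st.v Rgap = g) (vM : st.v Rsamp = M)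
    (hk0 : D 0 ≤ st.v Rk) (hkW : st.v Rk < W) :
    Wp W B gridSearch st fun τ c => c ≤ 25 * t + 5 ∧ τ.a = st.a ∧ (∀ x < 42, τ.v x = st.v x) ∧
      IsPredIdx (fun y => D (y * g)) M (st.v Rk) (τ.v Rl) := by
  set κ := fun y => D (y * g) with hκ
  have hg := h.g_pos hm
  have hM := h.M_eq hm
  have hM0 : 0 < M := by rw [hM]; exact Nat.div_pos (by omega) hg
  have hinc : IncrOn κ M := h.samples_incr hm
  have hs := h.size hm
  have hMm : M < 2 ^ (g - 1) := by
    have := sample_lt hg hM (show M - 1 < M by omega)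
    have := h.m_lt hm
    nlinarith [Nat.sub_add_cancel hM0]
  have hMC : M ≤ 4 * m := by nlinarith
  obtain ⟨y, hy⟩ := exists_isPredIdx (κ := κ) hM0 (by simpa [hκ] using hk0)
  obtain ⟨d, hdt, hd⟩ := ht y hy.1
  let I : ℕ → HS → Prop := fun n τ => ∃ i, n = 25 * (t - i) ∧ τ.a = st.a ∧
    (∀ x < 42, τ.v x = st.v x) ∧ τ.v Rb = i * M ∧ τ.v Rl ≤ y ∧ y < τ.v Rr ∧ τ.v Rr ≤ M ∧
    (τ.v Rl + 1 < τ.v Rr → τ.v Rnode = (node κ M i y).1 ∧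
      τ.v Rr - τ.v Rl ≤ (node κ M i y).2 - (node κ M i y).1) ∧
    (d ≤ i → τ.v Rr - τ.v Rl ≤ 2 ^ (t - i)) ∧ τ.v Rr - τ.v Rl ≤ 2 ^ (g - 1 - i)
  have hloop := Wp.loop (W := W) (B := B) (e := .lt (V Rl + 1) (V Rr))
    (c := Rmid ≔ (V Rl + V Rr) / 2 ;;
      .ite (.lt (V Rk) (smpA (V Rmid))) (Rr ≔ V Rmid) (Rl ≔ V Rmid) ;; gridStep) I
    (fun τ => τ.a = st.a ∧ (∀ x < 42, τ.v x = st.v x) ∧ τ.v Rl = y)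
    (by
      rintro n τ ⟨i, hn, ha, hv, hb, h1, h2, h3, -⟩
      simp; omega)
    (by
      rintro n τ ⟨i, hn, ha, hv, hb, h1, h2, h3, -⟩ h0
      simp at h0
      exact ⟨ha, hv, by omega⟩)
    (by
      rintro n τ ⟨i, hn, ha, hv, hb, h1, h2, h3, h4, h5, h6⟩ h0
      simp at h0
      obtain ⟨h4, h4'⟩ := h4 h0
      have hit : i < t := by
        by_contra hc
        have := h5 (by omega)
        rw [show t - i = 0 by omega] at this
        omega
      -- Because of the halving the search is over before it leaves the `g` levels of the tables.
      have hig : i < g - 1 := by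
        by_contra hc
        rw [show g - 1 - i = 0 by omega] at h6
        omega
      have hmid := sample_lt hg hM (show (τ.v Rl + τ.v Rr) / 2 < M by omega)
      have hkey : st.a 0 (1 + (τ.v Rl + τ.v Rr) / 2 * g) = κ ((τ.v Rl + τ.v Rr) / 2) := by
        rw [add_comm, h.key _ hmid]
      have hgr := hv Rgap (by norm_num)
      have hMr := hv Rsamp (by norm_num)
      have hkr := hv Rk (by norm_num)
      have hpred := hy.le_iff hinc (show (τ.v Rl + τ.v Rr) / 2 < M by omega)
      refine Wp.seq (Wp.asg (by norm_num) (by simp; omega) ?_)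
      have common : ∀ τ' : HS, τ'.a = st.a → (∀ x < 42, τ'.v x = st.v x) → τ'.v Rb = i * M →
          τ'.v Rl ≤ y → y < τ'.v Rr → τ'.v Rr ≤ τ.v Rr → τ.v Rl ≤ τ'.v Rl →
          τ'.v Rr - τ'.v Rl ≤ (τ.v Rr - τ.v Rl + 1) / 2 → τ'.v Rnode = τ.v Rnode →
          Wp W B gridStep τ' fun t₁ n₁ => ∃ n', I n' t₁ ∧ n' + (1 + (1 + 1 + n₁)) + 1 ≤ n := by
        intro τ' ha' hv' hb' g1 g2 g3 g4 g5 g6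
        refine Wp.mono (gridStep_spec (W := W) (C := C) (i := i) (y := y) hBW hB (st := τ')
          (by rw [ha']; exact h) hm hC (by omega)
          (by rw [hv' Rk (by norm_num)]; exact hy)
          (by rw [hv' Rgap (by norm_num)]; exact vg) (by rw [hv' Rsamp (by norm_num)]; exact vM)
          hb' g1 g2 (by omega) (g6.trans h4)) ?_
        rintro τ₁ n₁ ⟨k1, k2, k3, k4, k5, k6, k7, k8, k9⟩
        refine ⟨25 * (t - (i + 1)), ⟨i + 1, rfl, by rw [k2, ha'], fun x hx => by
          rw [k3 x hx, hv' x hx], k4, k5, k6, k8, k9, ?_, ?_⟩, by omega⟩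
        · intro hdi
          by_cases hdi' : d ≤ i
          · have := le_two_pow_half (h5 hdi') (by omega)
            rw [show t - (i + 1) = t - i - 1 by omega]; omega
          · have hdi'' : d = i + 1 := by omega
            by_cases hlt : τ₁.v Rl + 1 < τ₁.v Rr
            · have : τ₁.v Rr - τ₁.v Rl ≤ (node κ M (i + 1) y).2 - (node κ M (i + 1) y).1 :=
                (k9 hlt).2
              subst hdi''; omega
            · have := Nat.one_le_two_pow (n := t - (i + 1)); omega
        · have := le_two_pow_half h6 (by omega)
          rw [show g - 1 - (i + 1) = g - 1 - i - 1 by omega]; omega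
      refine Wp.seq (Wp.ite ?_ ?_ ?_)
      · simp [hgr, vg]; omega
      · intro hc
        simp [ha, hgr, vg, hkey, hkr] at hc
        refine Wp.asg (by norm_num) (by simp) ?_
        apply common <;> simp [ha, hb]
        · intro x hx; rw [if_neg, if_neg] <;> first | exact hv x hx | omega
        · omega
        · omega
        · omega
        · omega
      · intro hc
        simp [ha, hgr, vg, hkey, hkr] at hc
        refine Wp.asg (by norm_num) (by simp) ?_
        apply common <;> simp [ha, hb]
        · intro x hx; rw [if_neg, if_neg] <;> first | exact hv x hx | omega
        · omega
        · omega
        · omega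
        · omega)
  unfold gridSearch
  refine Wp.seq (Wp.asg (by norm_num) (by simp; omega) ?_)
  refine Wp.seq (Wp.asg (by norm_num) (by simp) ?_)
  refine Wp.seq (Wp.asg (by norm_num) (by simp; omega) ?_)
  refine Wp.seq (Wp.asg (by norm_num) (by simp; omega) ?_)
  refine Wp.mono (hloop (25 * t) _ ⟨0, by simp, by simp, ?_, ?_⟩) ?_
  · intro x hx
    simp; rw [if_neg, if_neg, if_neg, if_neg] <;> omega
  · simp [vM, node]
    refine ⟨hy.1, ?_, by omega⟩
    intro hd0; subst hd0; simpa [node] using hd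
  · rintro τ n ⟨⟨h1, h2, h3⟩, hn⟩
    exact ⟨by omega, h1, h2, by rw [h3]; exact hy⟩

/-- The search between two samples is over a range of at most `g` static nodes. -/
theorem binarySearch_spec (hBW : B ≤ W) (hB : 8 * C ≤ B) {st : HS} (h : Static W st.a m g M D)
    (hm : 0 < m) (hC : 4 * m + 4 ≤ C) (vg : st.v Rgap = g) (vm : st.v Rstat = m)
    (hy : IsPredIdx (fun y => D (y * g)) M (st.v Rk) (st.v Rl)) :
    Wp W B binarySearch st fun τ c => c ≤ 8 * Nat.log 2 g + 15 ∧ τ.a = st.a ∧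
      (∀ x < 42, τ.v x = st.v x) ∧ 1 ≤ τ.v Rl ∧ τ.v Rl ≤ m ∧ D (τ.v Rl - 1) ≤ st.v Rk ∧
      (τ.v Rl < m → st.v Rk < D (τ.v Rl)) := by
  have hg := h.g_pos hm
  have hM := h.M_eq hm
  have hs := h.size hm
  have hinc := h.samples_incr hm
  obtain ⟨y, hyl⟩ : ∃ y, st.v Rl = y := ⟨_, rfl⟩
  rw [hyl] at hy
  have hyg := sample_lt hg hM hy.1
  have hyM : (y + 1) * g ≤ m + g - 1 := by
    have := hy.1
    rw [hM, Nat.lt_iff_add_one_le, Nat.le_div_iff_mul_le hg] at this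
    exact this
  have hgm : m + g ≤ 4 * m + 4 := by
    have := h.g_le
    have := Nat.log_lt_self 2 hm.ne'
    omega
  have hnext : (y + 1) * g < m → st.v Rk < D ((y + 1) * g) := fun hlt => by
    refine hy.2.2 ?_
    by_contra hc
    have := lt_sample hg hM (not_lt.1 hc)
    omega
  have hloop := Wp.loop (W := W) (B := B) (e := .lt (V Rl + 1) (V Rr))
    (c := Rmid ≔ (V Rl + V Rr) / 2 ;;
      .ite (.lt (V Rk) (keyA (V Rmid))) (Rr ≔ V Rmid) (Rl ≔ V Rmid))
    (fun n τ => ∃ e, n = 8 * e ∧ τ.a = st.a ∧ (∀ x < 42, τ.v x = st.v x) ∧ 1 ≤ τ.v Rl ∧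
      τ.v Rl < τ.v Rr ∧ τ.v Rr ≤ m + 1 ∧ D (τ.v Rl - 1) ≤ st.v Rk ∧
      (τ.v Rr ≤ m → st.v Rk < D (τ.v Rr - 1)) ∧ τ.v Rr - τ.v Rl ≤ 2 ^ e)
    (fun τ => τ.a = st.a ∧ (∀ x < 42, τ.v x = st.v x) ∧ 1 ≤ τ.v Rl ∧ τ.v Rl ≤ m ∧
      D (τ.v Rl - 1) ≤ st.v Rk ∧ (τ.v Rl < m → st.v Rk < D (τ.v Rl)))
    (by
      rintro n τ ⟨e, hn, ha, hv, h1, h2, h3, -⟩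
      simp; omega)
    (by
      rintro n τ ⟨e, hn, ha, hv, h1, h2, h3, h4, h5, h6⟩ h0
      simp at h0
      refine ⟨ha, hv, h1, by omega, h4, fun hlt => ?_⟩
      have := h5 (by omega)
      rwa [show τ.v Rr - 1 = τ.v Rl by omega] at this)
    (by
      rintro n τ ⟨e, hn, ha, hv, h1, h2, h3, h4, h5, h6⟩ h0
      simp at h0
      have hh := le_two_pow_half h6 (by omega)
      have hkr := hv Rk (by norm_num)
      have hkey : st.a 0 ((τ.v Rl + τ.v Rr) / 2) = D ((τ.v Rl + τ.v Rr) / 2 - 1) := by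
        rw [← h.key _ (by omega), Nat.sub_add_cancel (by omega)]
      refine Wp.seq (Wp.asg (by norm_num) (by simp; omega) (Wp.ite (by simp; omega) ?_ ?_))
      · intro hc
        simp [ha, hkey, hkr] at hc
        refine Wp.asg (by norm_num) (by simp) ⟨8 * (e - 1), ⟨e - 1, rfl, ?_⟩, by omega⟩
        simp
        refine ⟨ha, fun x hx => ?_, h1, by omega, by omega, h4, fun _ => hc, by omega⟩
        rw [if_neg, if_neg] <;> first | exact hv x hx | omega
      · intro hc
        simp [ha, hkey, hkr] at hc
        refine Wp.asg (by norm_num) (by simp) ⟨8 * (e - 1), ⟨e - 1, rfl, ?_⟩, by omega⟩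
        simp
        refine ⟨ha, fun x hx => ?_, by omega, by omega, by omega, hc, h5, by omega⟩
        rw [if_neg, if_neg] <;> first | exact hv x hx | omega)
  have hlog := Nat.lt_pow_succ_log_self (b := 2) (by norm_num) g
  have hyy : (y + 1) * g = y * g + g := by rw [add_mul, one_mul]
  unfold binarySearch
  have hMm : y + 1 ≤ m + g := by nlinarith
  refine Wp.seq (Wp.asg (by norm_num) (by simp [vg, hyl]; omega) (Wp.seq (Wp.ite (by
    simp [vg, hyl, vm]; omega) ?_ ?_)))
  · intro hc
    simp [vg, hyl, vm] at hc
    refine Wp.asg (by norm_num) (by simp [vm]; omega) (Wp.seq (Wp.asg (by norm_num) (by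
      simp [vg, hyl]; omega) (Wp.mono (hloop (8 * (Nat.log 2 g + 1)) _ ⟨_, rfl, by simp, ?_, ?_⟩)
        ?_)))
    · intro x hx
      simp; rw [if_neg, if_neg, if_neg] <;> omega
    · simp [vg, hyl, vm]
      exact ⟨by omega, hy.2.1, by omega⟩
    · rintro τ n ⟨h1, h2⟩
      exact ⟨by omega, h1⟩
  · intro hc
    simp [vg, hyl, vm] at hc
    refine Wp.skip (Wp.seq (Wp.asg (by norm_num) (by
      simp [vg, hyl]; omega) (Wp.mono (hloop (8 * (Nat.log 2 g + 1)) _ ⟨_, rfl, by simp, ?_, ?_⟩)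
        ?_)))
    · intro x hx
      simp; rw [if_neg, if_neg] <;> omega
    · simp [vg, hyl]
      exact ⟨by omega, by omega, hy.2.1, fun h' => hnext (by omega), by omega⟩
    · rintro τ n ⟨h1, h2⟩
      exact ⟨by omega, h1⟩

/-- The search among the static nodes; register `Rl` becomes the number of static keys that are
at most the given one. -/
theorem locate_spec (hBW : B ≤ W) (hB : 8 * C ≤ B) {st : HS} (h : Static W st.a m g M D)
    (hC : 4 * m + 4 ≤ C) {t : ℕ} (ht : 0 < m → SearchBound (fun y => D (y * g)) M t)
    (vg : st.v Rgap = g) (vM : st.v Rsamp = M) (vm : st.v Rstat = m) (hkW : st.v Rk < W) :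
    Wp W B locate st fun τ c => c ≤ 25 * t + 8 * Nat.log 2 g + 21 ∧ τ.a = st.a ∧
      (∀ x < 42, τ.v x = st.v x) ∧ τ.v Rl ≤ m ∧ (τ.v Rl ≠ 0 → D (τ.v Rl - 1) ≤ st.v Rk) ∧
      (τ.v Rl < m → st.v Rk < D (τ.v Rl)) := by
  unfold locate
  refine Wp.ite ?_ ?_ ?_
  · simp [vm]; omega
  · intro hc
    have hm : 0 < m := by
      by_contra h0; simp [vm, show m = 0 by omega] at hc
    have hk0 := h.key 0 hm
    have hc1 : D 0 ≤ st.v Rk := by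
      by_contra h0; simp [vm, hk0, not_le.1 h0] at hc
    refine Wp.seq (Wp.mono (gridSearch_spec hBW hB h hm hC (ht hm) vg vM hc1 hkW) ?_)
    rintro τ n ⟨h1, h2, h3, h4⟩
    have hk := h3 Rk (by norm_num)
    refine Wp.mono (binarySearch_spec (M := M) (C := C) (g := g) (D := D) hBW hB
      (by rw [h2]; exact h) hm hC
      (by rw [h3 _ (by norm_num)]; exact vg) (by rw [h3 _ (by norm_num)]; exact vm)
      (by rw [hk]; exact h4)) ?_
    rintro τ' n' ⟨g1, g2, g3, g4, g5, g6, g7⟩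
    rw [hk] at g6 g7
    exact ⟨by omega, by rw [g2, h2], fun x hx => by rw [g3 x hx, h3 x hx], g5, fun _ => g6, g7⟩
  · intro hc
    refine Wp.asg (by norm_num) (by simp; omega) ?_
    simp
    refine ⟨fun x hx h42 => by omega, fun hm => ?_⟩
    have hk0 := h.key 0 hm
    simp [vm, hm.ne', hk0] at hc
    exact hc

end Search

/-! ### The list of all nodes -/

/-- Search for the last node with a key at most `k` (register `Rp`) and its successor in the
list (register `Rs`; the sentinel `0` if there is none). -/
def find : Stm :=
  locate ;;
  .ite (.lt (V Rl) (V Rstat)) (Rs ≔ V Rl + 1) (Rs ≔ 0) ;;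
  Rp ≔ prvA (V Rs) ;;
  .loop (.lt (V Rk) (keyA (V Rp))) (Rs ≔ V Rp ;; Rp ≔ prvA (V Rp))

/-- Store one more copy of the key `k`. -/
def store : Stm :=
  .ite (.eq (keyA (V Rp)) (V Rk)) (.sto 1 (V Rp) (cntA (V Rp) + 1))
    (Rused ≔ V Rused + 1 ;; .sto 0 (V Rused) (V Rk) ;; .sto 1 (V Rused) 1 ;;
      .sto 2 (V Rused) (V Rp) ;; .sto 2 (V Rs) (V Rused)) ;;
  Rcount ≔ V Rcount + 1

/-- Remove one copy of the key `k`, if there is one. -/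
def remove : Stm :=
  .ite (.and (.eq (keyA (V Rp)) (V Rk)) (.lt 0 (cntA (V Rp))))
    (.sto 1 (V Rp) (cntA (V Rp) - 1) ;; Rcount ≔ V Rcount - 1) .skip

/-- Walk down the list to a node that holds an element, and report it. -/
def report : Stm :=
  .loop (.and (.eq (cntA (V Rp)) 0) (.lt 0 (V Rp))) (Rp ≔ prvA (V Rp)) ;;
  .ite (.lt 0 (cntA (V Rp))) (1 ≔ keyA (V Rp) ;; 0 ≔ 1) (0 ≔ 0)

/-- The query program. -/
def predStm : Stm :=
  .ite (.eq (V 0) 0) .skip (Rk ≔ V 0 - 1 ;; find ;; report)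

/-- The nodes `0, …, u` form a list, sorted by their distinct keys. The predecessor of the
sentinel `0`, whose key is `0`, is the node with the largest key. -/
structure Nodes (a : ℕ → ℕ → ℕ) (u : ℕ) : Prop where
  zero : a 0 0 = 0
  inj : ∀ i ≤ u, ∀ j ≤ u, a 0 i = a 0 j → i = j
  prv_le : ∀ i ≤ u, a 2 i ≤ u
  prv_zero : ∀ j ≤ u, a 0 j ≤ a 0 (a 2 0)
  prv_lt : ∀ i ≤ u, i ≠ 0 → a 0 (a 2 i) < a 0 i
  prv_gap : ∀ i ≤ u, i ≠ 0 → ∀ j ≤ u, a 0 j < a 0 i → a 0 j ≤ a 0 (a 2 i)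

/-- The nodes hold the multiset `S` of keys. -/
structure Holds (W : ℕ) (a : ℕ → ℕ → ℕ) (u : ℕ) (S : Multiset ℕ) : Prop extends Nodes a u where
  lt : ∀ i ≤ u, a 0 i < W
  cnt : ∀ i ≤ u, a 1 i = S.count (a 0 i)
  cover : ∀ x ∈ S, ∃ i ≤ u, a 0 i = x

/-- The keys of the nodes `0, …, u`. -/
def nodeKeys (a : ℕ → ℕ → ℕ) (u : ℕ) : Finset ℕ := (Finset.range (u + 1)).image (a 0)

/-- The keys in `P` that lie above `k` and below all keys of `E` above `k`. -/
def above (P E : Finset ℕ) (k : ℕ) : Finset ℕ := P.filter fun x => k < x ∧ ∀ y ∈ E, k < y → x < y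

/-- The keys in `P` that lie below `k` (or at `k`) and above all keys of `E` that do so. -/
def below (P E : Finset ℕ) (k : ℕ) : Finset ℕ := P.filter fun x => x ≤ k ∧ ∀ y ∈ E, y ≤ k → y < x

section Dynamic

variable {W B C : ℕ} {m g M u : ℕ} {D : ℕ → ℕ} {S : Multiset ℕ}

lemma mem_nodeKeys {a : ℕ → ℕ → ℕ} {i : ℕ} (hi : i ≤ u) : a 0 i ∈ nodeKeys a u :=
  Finset.mem_image_of_mem _ (Finset.mem_range.2 (by omega))

/-- The search among all nodes. After the search among the static nodes it walks down the list,
past keys that lie above `k` and below all keys of `E` above `k`, where the keys in `E` are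
static. -/
theorem find_spec (hBW : B ≤ W) (hB : 8 * C ≤ B) {st : HS} (h : Static W st.a m g M D)
    (hC : 4 * m + 4 ≤ C) {t : ℕ} (ht : 0 < m → SearchBound (fun y => D (y * g)) M t)
    (vg : st.v Rgap = g) (vM : st.v Rsamp = M) (vm : st.v Rstat = m) (hkW : st.v Rk < W)
    (hN : Nodes st.a u) (huC : u + 1 < C) (hmu : m ≤ u)
    {E : Finset ℕ} (hE : ∀ y ∈ E, 0 < y → ∃ i < m, D i = y) :
    Wp W B find st fun τ c => c ≤ 25 * t + 8 * Nat.log 2 g + 25 +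
        3 * (above (nodeKeys st.a u) E (st.v Rk)).card ∧ τ.a = st.a ∧
      (∀ x < 42, τ.v x = st.v x) ∧ τ.v Rp ≤ u ∧ τ.v Rs ≤ u ∧ st.a 2 (τ.v Rs) = τ.v Rp ∧
      st.a 0 (τ.v Rp) ≤ st.v Rk ∧ (τ.v Rs = 0 ∨ st.v Rk < st.a 0 (τ.v Rs)) := by
  let F : ℕ → Finset ℕ := fun p =>
    (nodeKeys st.a u).filter fun x => st.v Rk < x ∧ x ≤ st.a 0 p
  have hloop := Wp.loop (W := W) (B := B) (e := .lt (V Rk) (keyA (V Rp)))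
    (c := Rs ≔ V Rp ;; Rp ≔ prvA (V Rp))
    (fun n τ => n = 3 * (F (τ.v Rp)).card ∧ τ.a = st.a ∧ (∀ x < 42, τ.v x = st.v x) ∧
      τ.v Rp ≤ u ∧ τ.v Rs ≤ u ∧ st.a 2 (τ.v Rs) = τ.v Rp ∧
      (τ.v Rs = 0 ∨ st.v Rk < st.a 0 (τ.v Rs)))
    (fun τ => τ.a = st.a ∧ (∀ x < 42, τ.v x = st.v x) ∧
      τ.v Rp ≤ u ∧ τ.v Rs ≤ u ∧ st.a 2 (τ.v Rs) = τ.v Rp ∧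
      st.a 0 (τ.v Rp) ≤ st.v Rk ∧ (τ.v Rs = 0 ∨ st.v Rk < st.a 0 (τ.v Rs)))
    (by
      rintro n τ ⟨hn, ha, hv, h1, h2, h3, h4⟩
      simp; omega)
    (by
      rintro n τ ⟨hn, ha, hv, h1, h2, h3, h4⟩ h0
      have hk := hv Rk (by norm_num)
      simp [ha, hk] at h0
      exact ⟨ha, hv, h1, h2, h3, h0, h4⟩)
    (by
      rintro n τ ⟨hn, ha, hv, h1, h2, h3, h4⟩ h0
      have hk := hv Rk (by norm_num)
      simp [ha, hk] at h0
      have hp0 : τ.v Rp ≠ 0 := by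
        intro hc; rw [hc, hN.zero] at h0; omega
      have hlt : F (st.a 2 (τ.v Rp)) ⊂ F (τ.v Rp) := by
        have := hN.prv_lt _ h1 hp0
        refine Finset.ssubset_iff_subset_ne.2 ⟨fun x hx => ?_, fun hc => ?_⟩
        · simp only [F, Finset.mem_filter] at hx ⊢
          exact ⟨hx.1, hx.2.1, by omega⟩
        · have hmem : st.a 0 (τ.v Rp) ∈ F (τ.v Rp) :=
            Finset.mem_filter.2 ⟨mem_nodeKeys h1, h0, le_rfl⟩
          rw [← hc] at hmem
          have := (Finset.mem_filter.1 hmem).2.2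
          omega
      have hlt := Finset.card_lt_card hlt
      refine Wp.seq (Wp.asg (by norm_num) (by simp) (Wp.asg (by norm_num) (by simp; omega)
        ⟨_, ⟨rfl, ?_⟩, ?_⟩))
      · simp [ha]
        refine ⟨fun x hx => ?_, hN.prv_le _ h1, h1, Or.inr h0⟩
        rw [if_neg, if_neg] <;> first | exact hv x hx | omega
      · simp [ha]; omega)
  unfold find
  refine Wp.seq (Wp.mono (locate_spec (W := W) hBW hB h hC ht vg vM vm hkW) ?_)
  rintro τ n ⟨h1, h2, h3, h4, h5, h6⟩
  have hm' := h3 Rstat (by norm_num)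
  have fin : ∀ s : ℕ, s ≤ u → (s = 0 ∧ τ.v Rl = m ∨ s = τ.v Rl + 1 ∧ τ.v Rl < m) →
      ∀ (τ' : HS) (n' : ℕ), n' ≤ 2 → τ'.a = τ.a → (∀ x < 42, τ'.v x = τ.v x) → τ'.v Rs = s →
      Wp W B (Rp ≔ prvA (V Rs) ;; .loop (.lt (V Rk) (keyA (V Rp))) (Rs ≔ V Rp ;; Rp ≔ prvA (V Rp)))
        τ' fun τ c => n + (n' + c) ≤ 25 * t + 8 * Nat.log 2 g + 25 +
        3 * (above (nodeKeys st.a u) E (st.v Rk)).card ∧ τ.a = st.a ∧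
      (∀ x < 42, τ.v x = st.v x) ∧ τ.v Rp ≤ u ∧ τ.v Rs ≤ u ∧ st.a 2 (τ.v Rs) = τ.v Rp ∧
      st.a 0 (τ.v Rp) ≤ st.v Rk ∧ (τ.v Rs = 0 ∨ st.v Rk < st.a 0 (τ.v Rs)) := by
    intro s hsu hs τ' n' hn' ha hv hvs
    refine Wp.seq (Wp.asg (by norm_num) (by simp; omega) (Wp.mono (hloop _ _ ⟨rfl, ?_⟩) ?_))
    · simp [ha, hvs, h2]
      refine ⟨fun x hx => ?_, hN.prv_le _ hsu, hsu, ?_⟩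
      · rw [if_neg, hv x hx, h3 x hx]; omega
      · rcases hs with ⟨hs, -⟩ | ⟨hs, hs'⟩
        · exact Or.inl hs
        · right; rw [hs, h.key _ hs']; exact h6 hs'
    · rintro τ₁ c₁ ⟨h7, hc⟩
      refine ⟨?_, h7⟩
      have hsub : F (st.a 2 s) ⊆ above (nodeKeys st.a u) E (st.v Rk) := by
        intro x hx
        simp only [F, above, Finset.mem_filter] at hx ⊢
        refine ⟨hx.1, hx.2.1, fun y hy hky => ?_⟩
        obtain ⟨i, him, hi⟩ := hE y hy (by omega)
        have hil : τ.v Rl ≤ i := by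
          by_contra hc
          have := h5 (by omega)
          have := h.incr.le (show i ≤ τ.v Rl - 1 by omega) (by omega)
          omega
        rcases hs with ⟨hs, hs'⟩ | ⟨hs, hs'⟩
        · omega
        · have e1 := hN.prv_lt s hsu (by omega)
          have e2 := h.key _ hs'
          rw [← hs] at e2
          have e3 := h.incr.le hil him
          omega
      have := Finset.card_le_card hsub
      simp [hvs, ha, h2] at hc
      omega
  refine Wp.seq (Wp.ite (by simp) ?_ ?_)
  · intro hc
    simp [hm', vm] at hc
    refine Wp.asg (by norm_num) (by simp; omega) (fin (τ.v Rl + 1) (by omega) (Or.inr ⟨rfl, hc⟩) _ _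
      (by omega) (by simp) (fun x hx => ?_) (by simp))
    simp; intro hx'; omega
  · intro hc
    simp [hm', vm] at hc
    refine Wp.asg (by norm_num) (by simp; omega) (fin 0 (by omega) (Or.inl ⟨rfl, by omega⟩) _ _
      (by omega) (by simp) (fun x hx => ?_) (by simp))
    simp; intro hx'; omega

/-- A node `p` with key at most `k` whose successor has a key above `k` is the last such node. -/
lemma Nodes.le_of_le {a : ℕ → ℕ → ℕ} (hN : Nodes a u) {k p s : ℕ} (hs : s ≤ u) (hps : a 2 s = p)
    (hsk : s = 0 ∨ k < a 0 s) {i : ℕ} (hi : i ≤ u) (hik : a 0 i ≤ k) : a 0 i ≤ a 0 p := by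
  rw [← hps]
  rcases eq_or_ne s 0 with rfl | h0
  · exact hN.prv_zero i hi
  · have := hsk.resolve_left h0
    exact hN.prv_gap s hs h0 i hi (by omega)

/-- Recounting the copies of the keys leaves the list as it is. -/
lemma Holds.recount {a a' : ℕ → ℕ → ℕ} (hH : Holds W a u S) {S' : Multiset ℕ} (h0 : a' 0 = a 0)
    (h2 : a' 2 = a 2) (hcnt : ∀ i ≤ u, a' 1 i = S'.count (a 0 i))
    (hcover : ∀ x ∈ S', ∃ i ≤ u, a 0 i = x) : Holds W a' u S' := by
  refine ⟨⟨?_, ?_, ?_, ?_, ?_, ?_⟩, ?_, ?_, ?_⟩ <;> simp only [h0, h2]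
  exacts [hH.zero, hH.inj, hH.prv_le, hH.prv_zero, hH.prv_lt, hH.prv_gap, hH.lt, hcnt, hcover]

/-- Insertion of a new node with the key `k` between the node `p` and its successor `s`. -/
lemma Holds.insert_node {a a' : ℕ → ℕ → ℕ} (hH : Holds W a u S) {k p s : ℕ} (hkW : k < W)
    (hp : p ≤ u) (hs : s ≤ u) (hps : a 2 s = p) (hpk' : a 0 p < k) (hsk : s = 0 ∨ k < a 0 s)
    (h0' : ∀ i, a' 0 i = if i = u + 1 then k else a 0 i)
    (h1' : ∀ i, a' 1 i = if i = u + 1 then 1 else a 1 i)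
    (h2' : ∀ i, a' 2 i = if i = s then u + 1 else if i = u + 1 then p else a 2 i) :
    Holds W a' (u + 1) (k ::ₘ S) := by
  have hle : ∀ i ≤ u, a 0 i ≤ k → a 0 i ≤ a 0 p := fun i hi => hH.le_of_le hs hps hsk hi
  have hkn : ∀ i ≤ u, a 0 i ≠ k := fun i hi hik => by
    have := hle i hi (by omega); omega
  have s1 : s ≠ u + 1 := by omega
  refine ⟨⟨?_, ?_, ?_, ?_, ?_, ?_⟩, ?_, ?_, ?_⟩ <;> simp only [h0', h1', h2']
  · rw [if_neg (by omega)]; exact hH.zero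
  · intro i hi j hj
    split_ifs with h1 h2 h2
    · omega
    · intro h3; exact absurd h3.symm (hkn j (by omega))
    · intro h3; exact absurd h3 (hkn i (by omega))
    · exact hH.inj i (by omega) j (by omega)
  · intro i hi
    split_ifs with h1 h2
    · omega
    · omega
    · have := hH.prv_le i (by omega); omega
  · intro j hj
    by_cases hs0 : (0 : ℕ) = s
    · simp only [if_pos hs0, if_true]
      split_ifs with h1
      · exact le_rfl
      · have := hH.prv_zero j (by omega)
        rw [← hs0] at hps; rw [hps] at this; omega
    · rw [if_neg hs0, if_neg (show (0 : ℕ) ≠ u + 1 by omega)]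
      have hz := hH.prv_le 0 (by omega)
      rw [if_neg (show a 2 0 ≠ u + 1 by omega)]
      split_ifs with h1
      · have := hsk.resolve_left (fun h => hs0 h.symm)
        have := hH.prv_zero s hs; omega
      · exact hH.prv_zero j (by omega)
  · intro i hi hi0
    by_cases his : i = s
    · rw [if_pos his, if_pos rfl, if_neg (by omega)]
      subst his; exact hsk.resolve_left hi0
    · rw [if_neg his]
      by_cases hiu : i = u + 1
      · rw [if_pos hiu, if_pos hiu, if_neg (by omega)]; exact hpk'
      · rw [if_neg hiu, if_neg hiu, if_neg]
        · exact hH.prv_lt i (by omega) hi0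
        · have := hH.prv_le i (by omega); omega
  · intro i hi hi0 j hj
    by_cases his : i = s
    · rw [if_pos his, if_pos rfl, if_neg (show i ≠ u + 1 by omega)]
      intro hji
      split_ifs with h1
      · exact le_rfl
      · rw [if_neg h1] at hji
        have := hH.prv_gap i (by omega) hi0 j (by omega) hji
        rw [his, hps] at this; omega
    · rw [if_neg his]
      by_cases hiu : i = u + 1
      · rw [if_pos hiu, if_pos hiu, if_neg (show p ≠ u + 1 by omega)]
        intro hji
        split_ifs with h1
        · rw [if_pos h1] at hji; omega
        · rw [if_neg h1] at hji
          exact hle j (by omega) (by omega)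
      · have := hH.prv_le i (by omega)
        rw [if_neg hiu, if_neg hiu, if_neg (show a 2 i ≠ u + 1 by omega)]
        intro hji
        split_ifs with h1
        · -- the key `k` lies below node `i`, so node `i` is above `s`, the successor of `p`
          rw [if_pos h1] at hji
          by_contra hcc
          have e1 := hle _ this (by omega)
          have e2 := hH.prv_gap i (by omega) hi0 p hp (by omega)
          have e3 : a 2 i = p := hH.inj _ this _ hp (by omega)
          rcases hsk with hs0 | hs0
          · have := hH.prv_zero i (by omega)
            rw [hs0] at hps; rw [hps] at this; omega
          · have hs0' : s ≠ 0 := fun h0 => by rw [h0, hH.zero] at hs0; omega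
            rcases lt_trichotomy (a 0 i) (a 0 s) with h5 | h5 | h5
            · have := hH.prv_gap s hs hs0' i (by omega) h5
              rw [hps] at this; omega
            · exact his (hH.inj i (by omega) s hs h5)
            · have := hH.prv_gap i (by omega) hi0 s hs h5
              rw [e3] at this; omega
        · rw [if_neg h1] at hji
          exact hH.prv_gap i (by omega) hi0 j (by omega) hji
  · intro i hi
    split_ifs with h1
    · exact hkW
    · exact hH.lt i (by omega)
  · intro i hi
    rw [Multiset.count_cons]
    split_ifs with h1 h2 h2
    · rw [Multiset.count_eq_zero_of_notMem]
      intro hmem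
      obtain ⟨j, hj, hjk⟩ := hH.cover k hmem
      exact hkn j hj hjk
    · exact absurd rfl h2
    · exact absurd h2 (hkn i (by omega))
    · exact hH.cnt i (by omega)
  · intro x hx
    rcases Multiset.mem_cons.1 hx with rfl | hx
    · exact ⟨u + 1, le_rfl, by simp⟩
    obtain ⟨j, hj, hjk⟩ := hH.cover x hx
    exact ⟨j, by omega, by rw [if_neg (by omega)]; exact hjk⟩

/-- An insertion at the place found by `find`. -/
theorem store_spec (hBW : B ≤ W) (hB : 8 * C ≤ B) {st : HS} (hH : Holds W st.a u S)
    (vu : st.v Rused = u) (vn : st.v Rcount = S.card) (hS : S.card + 1 < W)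
    (huC : u + 1 < C) (hkW : st.v Rk < W) (hp : st.v Rp ≤ u) (hs : st.v Rs ≤ u)
    (hps : st.a 2 (st.v Rs) = st.v Rp) (hpk : st.a 0 (st.v Rp) ≤ st.v Rk)
    (hsk : st.v Rs = 0 ∨ st.v Rk < st.a 0 (st.v Rs)) :
    Wp W B store st fun τ c => c ≤ 7 ∧ (∀ x < 42, x ≠ Rused → x ≠ Rcount → τ.v x = st.v x) ∧
      τ.v Rcount = S.card + 1 ∧ u ≤ τ.v Rused ∧ τ.v Rused ≤ u + 1 ∧
      Holds W τ.a (τ.v Rused) (st.v Rk ::ₘ S) ∧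
      nodeKeys τ.a (τ.v Rused) ⊆ insert (st.v Rk) (nodeKeys st.a u) ∧
      (∀ i ≤ u, τ.a 0 i = st.a 0 i) ∧ τ.a 3 = st.a 3 ∧ τ.a 4 = st.a 4 ∧
      (∀ f, ∀ i ≥ C, τ.a f i = st.a f i) := by
  have hle : ∀ i ≤ u, st.a 0 i ≤ st.v Rk → st.a 0 i ≤ st.a 0 (st.v Rp) := fun i hi =>
    hH.le_of_le hs hps hsk hi
  have hcnt := hH.cnt _ hp
  have hcle := Multiset.count_le_card (st.a 0 (st.v Rp)) S
  unfold store
  refine Wp.seq (Wp.ite (by simp; omega) ?_ ?_)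
  · intro hc
    simp at hc
    refine Wp.sto (by simp) (by simp; omega) (by norm_num) (by simp; omega) ?_
    refine Wp.asg (by norm_num) (by simp; omega) ?_
    have hv : ((st.put 1 (st.v Rp) (st.a 1 (st.v Rp) + 1)).set Rcount (S.card + 1)).v Rused = u
        := by
      simp [vu]
    simp only [ev_var, ev_add, ev_arr, ev_one, HS.put_v, vn, hv]
    refine ⟨by omega, fun x hx h1 h2 => by simp [h2], by simp, le_rfl, by omega, ?_, ?_, ?_,
      ?_, ?_, ?_⟩
    · refine hH.recount (by funext i; simp) (by funext i; simp) ?_ ?_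
      · intro i hi
        simp only [HS.set_a, HS.put_a, true_and]
        rw [Multiset.count_cons]
        by_cases hip : i = st.v Rp
        · rw [if_pos hip, hip, if_pos hc, hcnt]
        · rw [if_neg hip, if_neg (fun hcc => hip (hH.inj i hi _ hp (by rw [hcc, hc]))),
            hH.cnt i hi, add_zero]
      · intro x hx
        rcases Multiset.mem_cons.1 hx with rfl | hx
        · exact ⟨_, hp, hc⟩
        · exact hH.cover x hx
    · have : ((st.put 1 (st.v Rp) (st.a 1 (st.v Rp) + 1)).set Rcount (S.card + 1)).a 0 = st.a 0 :=
        by funext i; simp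
      rw [nodeKeys, this]
      exact Finset.subset_insert _ _
    · intro i hi; simp
    · funext i; simp
    · funext i; simp
    · intro f i hi; simp only [HS.set_a, HS.put_a]; rw [if_neg]; omega
  · intro hc
    simp at hc
    have hpk' : st.a 0 (st.v Rp) < st.v Rk := by omega
    refine Wp.seq (Wp.asg (by norm_num) (by simp; omega) ?_)
    refine Wp.seq (Wp.sto (by simp) (by simp) (by norm_num) (by simp; omega) ?_)
    refine Wp.seq (Wp.sto (by simp) (by simp; omega) (by norm_num) (by simp; omega) ?_)
    refine Wp.seq (Wp.sto (by simp) (by simp) (by norm_num) (by simp; omega) ?_)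
    refine Wp.sto (by simp) (by simp) (by norm_num) (by simp; omega) ?_
    refine Wp.asg (by norm_num) (by simp; omega) ?_
    set τ := HS.set _ Rcount _ with hτ
    have hv : τ.v Rused = u + 1 := by simp [hτ, vu]
    have hn : τ.v Rcount = S.card + 1 := by simp [hτ, vn]
    have hvv : ∀ x < 42, x ≠ Rused → x ≠ Rcount → τ.v x = st.v x := fun x hx h1 h2 => by
      simp [hτ, h1, h2]
    have a0 : ∀ i, τ.a 0 i = if i = u + 1 then st.v Rk else st.a 0 i := fun i => by
      simp [hτ, vu]
    have a1 : ∀ i, τ.a 1 i = if i = u + 1 then 1 else st.a 1 i := fun i => by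
      simp [hτ, vu]
    have a2 : ∀ i, τ.a 2 i = if i = st.v Rs then u + 1 else if i = u + 1 then st.v Rp else
        st.a 2 i := fun i => by
      simp [hτ, vu]
    have a3 : τ.a 3 = st.a 3 := by funext i; simp [hτ]
    have a4 : τ.a 4 = st.a 4 := by funext i; simp [hτ]
    have aC : ∀ f, ∀ i ≥ C, τ.a f i = st.a f i := by
      intro f i hi
      have e1 : i ≠ u + 1 := by omega
      have e2 : i ≠ st.v Rs := by omega
      simp [hτ, vu, e1, e2]
    rw [hv]
    refine ⟨by omega, hvv, hn, by omega, le_rfl,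
      hH.insert_node hkW hp hs hps hpk' hsk a0 a1 a2, ?_, ?_, a3, a4, aC⟩
    · intro x hx
      simp only [nodeKeys, Finset.mem_image, a0, Finset.mem_range] at hx
      obtain ⟨i, hi, rfl⟩ := hx
      split_ifs with h1
      · exact Finset.mem_insert_self _ _
      · exact Finset.mem_insert_of_mem (mem_nodeKeys (by omega))
    · intro i hi; rw [a0, if_neg (by omega)]

/-- A deletion at the place found by `find`. The node stays in the list. -/
theorem remove_spec (hB : 8 * C ≤ B) {st : HS} (hH : Holds W st.a u S)
    (vn : st.v Rcount = S.card) (h1W : 1 < W)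
    (huC : u + 1 < C) (hp : st.v Rp ≤ u) (hs : st.v Rs ≤ u)
    (hps : st.a 2 (st.v Rs) = st.v Rp) (hpk : st.a 0 (st.v Rp) ≤ st.v Rk)
    (hsk : st.v Rs = 0 ∨ st.v Rk < st.a 0 (st.v Rs)) :
    Wp W B remove st fun τ c => c ≤ 3 ∧ (∀ x < 42, x ≠ Rcount → τ.v x = st.v x) ∧
      τ.v Rcount = (S.erase (st.v Rk)).card ∧ Holds W τ.a u (S.erase (st.v Rk)) ∧
      (∀ f ≠ 1, τ.a f = st.a f) ∧ (∀ f, ∀ i ≥ C, τ.a f i = st.a f i) := by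
  have hle : ∀ i ≤ u, st.a 0 i ≤ st.v Rk → st.a 0 i ≤ st.a 0 (st.v Rp) := fun i hi =>
    hH.le_of_le hs hps hsk hi
  have hcnt := hH.cnt _ hp
  unfold remove
  refine Wp.ite (by simp; omega) ?_ ?_
  · intro hc
    simp at hc
    obtain ⟨hc1, hc2⟩ := hc
    have hmem : st.v Rk ∈ S := by
      rw [← Multiset.count_pos, ← hc1]; omega
    have hcard : 0 < S.card := Multiset.card_pos_iff_exists_mem.2 ⟨_, hmem⟩
    refine Wp.seq (Wp.sto (by simp) (by simp; omega) (by norm_num) (by simp; omega) ?_)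
    refine Wp.asg (by norm_num) (by simp; omega) ?_
    simp only [ev_var, ev_sub, ev_arr, ev_one, HS.put_v, vn]
    refine ⟨by omega, fun x hx h1 => by simp [h1], ?_, ?_, ?_, ?_⟩
    · simp [Multiset.card_erase_of_mem hmem]
    · refine hH.recount (by funext i; simp) (by funext i; simp) ?_ ?_
      · intro i hi
        simp only [HS.set_a, HS.put_a, true_and]
        split_ifs with h1
        · rw [h1, hc1, Multiset.count_erase_self, ← hc1, hcnt]
        · rw [Multiset.count_erase_of_ne, hH.cnt i hi]
          intro h2
          exact h1 (hH.inj i hi _ hp (by rw [h2, hc1]))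
      · exact fun x hx => hH.cover x (Multiset.mem_of_mem_erase hx)
    · intro f hf; funext i; simp [hf]
    · intro f i hi; simp only [HS.set_a, HS.put_a]; rw [if_neg]; omega
  · intro hc
    have hno : st.v Rk ∉ S := by
      intro hmem
      obtain ⟨j, hj, hjk⟩ := hH.cover _ hmem
      have h1 := hle j hj (by omega)
      have h2 : j = st.v Rp := hH.inj j hj _ hp (by omega)
      have h3 := Multiset.count_pos.2 hmem
      rw [← hjk, ← hH.cnt j hj, h2] at h3
      rw [h2] at hjk
      simp [hjk] at hc
      omega
    rw [Multiset.erase_of_notMem hno]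
    exact Wp.skip ⟨by omega, fun _ _ _ => rfl, vn, hH, fun _ _ => rfl, fun _ _ _ => rfl⟩

/-- The query walks down the list past nodes without elements, whose keys are at most `k` and
above all keys of `E` that are at most `k`. -/
theorem report_spec (hB : 8 * C ≤ B) {st : HS} (hH : Holds W st.a u S)
    (h1W : 1 < W) (huC : u + 1 < C) (hp : st.v Rp ≤ u) (hs : st.v Rs ≤ u)
    (hps : st.a 2 (st.v Rs) = st.v Rp) (hpk : st.a 0 (st.v Rp) ≤ st.v Rk)
    (hsk : st.v Rs = 0 ∨ st.v Rk < st.a 0 (st.v Rs)) {E : Finset ℕ} (hE : ∀ y ∈ E, y ∈ S) :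
    Wp W B report st fun τ c => c ≤ 4 + 3 * (below (nodeKeys st.a u) E (st.v Rk)).card ∧
      τ.a = st.a ∧ (∀ x < 42, 2 ≤ x → τ.v x = st.v x) ∧
      ((τ.v 0 = 0 ∧ ∀ x ∈ S, ¬ x ≤ st.v Rk) ∨ (τ.v 0 ≠ 0 ∧ τ.v 1 ∈ S ∧ τ.v 1 ≤ st.v Rk ∧
        ∀ x ∈ S, x ≤ st.v Rk → x ≤ τ.v 1)) := by
  let F : ℕ → Finset ℕ := fun p => (below (nodeKeys st.a u) E (st.v Rk)).filter (· ≤ st.a 0 p)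
  have hloop := Wp.loop (W := W) (B := B) (e := .and (.eq (cntA (V Rp)) 0) (.lt 0 (V Rp)))
    (c := Rp ≔ prvA (V Rp))
    (fun n τ => n = 3 * (F (τ.v Rp)).card ∧ τ.a = st.a ∧ (∀ x < 42, τ.v x = st.v x) ∧
      τ.v Rp ≤ u ∧ st.a 0 (τ.v Rp) ≤ st.v Rk ∧ ∀ x ∈ S, x ≤ st.v Rk → x ≤ st.a 0 (τ.v Rp))
    (fun τ => τ.a = st.a ∧ (∀ x < 42, τ.v x = st.v x) ∧
      τ.v Rp ≤ u ∧ st.a 0 (τ.v Rp) ≤ st.v Rk ∧ (∀ x ∈ S, x ≤ st.v Rk → x ≤ st.a 0 (τ.v Rp)) ∧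
      (st.a 1 (τ.v Rp) ≠ 0 ∨ τ.v Rp = 0))
    (by
      rintro n τ ⟨hn, ha, hv, h1, h2, h3⟩
      simp; omega)
    (by
      rintro n τ ⟨hn, ha, hv, h1, h2, h3⟩ h0
      simp [ha] at h0
      exact ⟨ha, hv, h1, h2, h3, h0⟩)
    (by
      rintro n τ ⟨hn, ha, hv, h1, h2, h3⟩ h0
      simp [ha] at h0
      obtain ⟨h0, h0'⟩ := h0
      have hnot : ∀ x ∈ S, x ≠ st.a 0 (τ.v Rp) := fun x hx hc => by
        have := Multiset.count_pos.2 hx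
        rw [hc, ← hH.cnt _ h1] at this; omega
      have hprv := hH.prv_lt _ h1 h0'
      have hlt : F (st.a 2 (τ.v Rp)) ⊂ F (τ.v Rp) := by
        refine Finset.ssubset_iff_subset_ne.2 ⟨fun x hx => ?_, fun hc => ?_⟩
        · simp only [F, Finset.mem_filter] at hx ⊢
          exact ⟨hx.1, by omega⟩
        · have hmem : st.a 0 (τ.v Rp) ∈ F (τ.v Rp) := by
            refine Finset.mem_filter.2 ⟨Finset.mem_filter.2 ⟨mem_nodeKeys h1, h2, ?_⟩, le_rfl⟩
            intro y hy hyk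
            have := h3 y (hE y hy) hyk
            have := hnot y (hE y hy)
            omega
          rw [← hc] at hmem
          have := (Finset.mem_filter.1 hmem).2
          omega
      have hlt := Finset.card_lt_card hlt
      refine Wp.asg (by norm_num) (by simp; omega) ⟨_, ⟨rfl, ?_⟩, ?_⟩
      · simp [ha]
        refine ⟨fun x hx => ?_, hH.prv_le _ h1, by omega, fun x hx hxk => ?_⟩
        · rw [if_neg] <;> first | exact hv x hx | omega
        · obtain ⟨j, hj, rfl⟩ := hH.cover x hx
          have e1 := h3 _ hx hxk
          have e2 := hnot _ hx
          exact hH.prv_gap _ h1 h0' j hj (by omega)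
      · simp [ha]; omega)
  unfold report
  refine Wp.seq (Wp.mono (hloop _ st ⟨rfl, rfl, fun _ _ => rfl, hp, hpk, fun x hx hxk => ?_⟩) ?_)
  · obtain ⟨j, hj, rfl⟩ := hH.cover x hx
    exact hH.le_of_le hs hps hsk hj hxk
  rintro τ n ⟨⟨ha, hv, h1, h2, h3, h4⟩, hn⟩
  have hF : (F (st.v Rp)).card ≤ (below (nodeKeys st.a u) E (st.v Rk)).card :=
    Finset.card_le_card (Finset.filter_subset _ _)
  have hcnt := hH.cnt _ h1
  refine Wp.ite (by simp; omega) ?_ ?_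
  · intro hc
    simp [ha] at hc
    refine Wp.seq (Wp.asg (by norm_num) (by simp; omega) (Wp.asg (by norm_num) (by simp; omega) ?_))
    simp [ha]
    refine ⟨by omega, fun x hx hx2 => ?_, ?_, h2, h3⟩
    · rw [if_neg, if_neg] <;> first | exact hv x hx | omega
    · rw [← Multiset.count_pos]; omega
  · intro hc
    simp [ha] at hc
    refine Wp.asg (by norm_num) (by simp; omega) ?_
    simp [ha]
    refine ⟨by omega, fun x hx hx2 => ?_, fun x hx => ?_⟩
    · rw [if_neg] <;> first | exact hv x hx | omega
    · by_contra hxk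
      have e1 := h3 x hx (by omega)
      have e2 : τ.v Rp = 0 := h4.resolve_left (by omega)
      rw [e2] at e1 hcnt hc
      rw [hH.zero] at e1 hcnt
      have e3 : x = 0 := by omega
      subst e3
      have := Multiset.count_pos.2 hx
      omega

end Dynamic

/-! ### Collecting the keys and choosing the samples -/

/-- Copy the keys of the contained elements, in decreasing order, to scratch space, together
with their multiplicities. -/
def collect : Stm :=
  Rp ≔ prvA 0 ;; Rj ≔ 0 ;;
  .loop (.lt 0 (V Rp))
    (.ite (.lt 0 (cntA (V Rp)))
      (.sto 5 (V Rj) (keyA (V Rp)) ;; .sto 6 (V Rj) (cntA (V Rp)) ;; Rj ≔ V Rj + 1) .skip ;;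
      Rp ≔ prvA (V Rp)) ;;
  Rstat ≔ V Rj

/-- Make the collected keys the static nodes, in increasing order. -/
def layout : Stm :=
  Rj ≔ 0 ;;
  .loop (.lt (V Rj) (V Rstat))
    (.sto 0 (V Rj + 1) (.arr 5 (V Rstat - (V Rj + 1))) ;;
      .sto 1 (V Rj + 1) (.arr 6 (V Rstat - (V Rj + 1))) ;;
      .sto 2 (V Rj + 1) (V Rj) ;; Rj ≔ V Rj + 1) ;;
  .sto 2 0 (V Rstat) ;; Rused ≔ V Rstat

/-- Compute the distance and the number of the samples. -/
def chooseGap : Stm :=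
  Rgap ≔ 1 ;; Rt ≔ 1 ;;
  .loop (.lt (V Rt) (V Rstat + 1)) (Rt ≔ V Rt + V Rt ;; Rgap ≔ V Rgap + 1) ;;
  Rsamp ≔ (V Rstat + V Rgap - 1) / V Rgap

section Rebuild

variable {W B C : ℕ} {m g M u : ℕ} {D : ℕ → ℕ} {S : Multiset ℕ}

/-- The arrays 5 and 6 list, in decreasing order, the keys of `S` above `b` with their
multiplicities. -/
structure Listed (a : ℕ → ℕ → ℕ) (S : Multiset ℕ) (b c : ℕ) : Prop where
  mem : ∀ x, (x ∈ S ∧ b < x) ↔ ∃ i < c, a 5 i = x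
  decr : ∀ i j, i < j → j < c → a 5 j < a 5 i
  cnt : ∀ i < c, a 6 i = S.count (a 5 i)

/-- Passing a key without elements. -/
lemma Listed.down {a : ℕ → ℕ → ℕ} {b b' c : ℕ} (h : Listed a S b c) (hb : b' < b)
    (hn : ∀ x ∈ S, b' < x → x < b → False) (hbS : b ∉ S) : Listed a S b' c := by
  refine ⟨fun x => ?_, h.decr, h.cnt⟩
  rw [← h.mem]
  refine and_congr_right fun hx => ⟨fun h1 => ?_, fun h1 => by omega⟩
  rcases lt_trichotomy x b with h2 | h2 | h2
  · exact (hn x hx h1 h2).elim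
  · exact absurd (h2 ▸ hx) hbS
  · exact h2

/-- Passing a key that has elements. -/
lemma Listed.push {a a' : ℕ → ℕ → ℕ} {b b' c : ℕ} (h : Listed a S b c) (hb : b' < b)
    (hn : ∀ x ∈ S, b' < x → x < b → False) (hbS : b ∈ S)
    (h5 : ∀ i, a' 5 i = if i = c then b else a 5 i)
    (h6 : ∀ i, a' 6 i = if i = c then S.count b else a 6 i) : Listed a' S b' (c + 1) := by
  refine ⟨fun x => ⟨?_, ?_⟩, fun i j hij hj => ?_, fun i hi => ?_⟩
  · rintro ⟨hx, h1⟩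
    rcases lt_trichotomy x b with h2 | h2 | h2
    · exact (hn x hx h1 h2).elim
    · exact ⟨c, by omega, by rw [h5, if_pos rfl, h2]⟩
    · obtain ⟨i, hi, h3⟩ := (h.mem x).1 ⟨hx, h2⟩
      exact ⟨i, by omega, by rw [h5, if_neg (by omega), h3]⟩
  · rintro ⟨i, hi, rfl⟩
    rw [h5]
    split_ifs with h1
    · exact ⟨hbS, hb⟩
    · have := (h.mem _).2 ⟨i, by omega, rfl⟩
      exact ⟨this.1, by omega⟩
  · rw [h5, h5]
    split_ifs with h1 h2 h2
    · omega
    · exact ((h.mem _).2 ⟨i, by omega, rfl⟩).2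
    · omega
    · exact h.decr i j hij (by omega)
  · rw [h5, h6]
    split_ifs with h1
    · rfl
    · exact h.cnt i (by omega)

/-- The nonzero keys of the contained elements get listed. Elements with the key `0` belong to
the sentinel. -/
theorem collect_spec (hBW : B ≤ W) (hB : 8 * C ≤ B) {st : HS} (hH : Holds W st.a u S)
    (huC : u < C) : Wp W B collect st fun τ c => c ≤ 6 * u + 4 ∧
      (∀ x < 42, x ≠ Rstat → τ.v x = st.v x) ∧ (∀ f < 5, τ.a f = st.a f) ∧
      (∀ f, ∀ i ≥ C, τ.a f i = st.a f i) ∧ τ.v Rstat ≤ u ∧ Listed τ.a S 0 (τ.v Rstat) := by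
  let F : ℕ → Finset ℕ := fun p =>
    (Finset.range (u + 1)).filter fun i => 0 < i ∧ st.a 0 i ≤ st.a 0 p
  have hFu : ∀ p, (F p).card ≤ u := fun p => by
    have : F p ⊆ (Finset.range (u + 1)).erase 0 := fun i hi => by
      simp only [F, Finset.mem_filter] at hi
      simp only [Finset.mem_erase]; exact ⟨by omega, hi.1⟩
    have := Finset.card_le_card this
    rwa [Finset.card_erase_of_mem (by simp), Finset.card_range] at this
  have hloop := Wp.loop (W := W) (B := B) (e := .lt 0 (V Rp))
    (c := .ite (.lt 0 (cntA (V Rp)))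
      (.sto 5 (V Rj) (keyA (V Rp)) ;; .sto 6 (V Rj) (cntA (V Rp)) ;; Rj ≔ V Rj + 1) .skip ;;
      Rp ≔ prvA (V Rp))
    (fun n τ => n = 6 * (F (τ.v Rp)).card ∧ (∀ x < 42, τ.v x = st.v x) ∧ (∀ f < 5, τ.a f = st.a f) ∧
      (∀ f, ∀ i ≥ C, τ.a f i = st.a f i) ∧ τ.v Rp ≤ u ∧ τ.v Rj + (F (τ.v Rp)).card ≤ u ∧
      Listed τ.a S (st.a 0 (τ.v Rp)) (τ.v Rj))
    (fun τ => (∀ x < 42, τ.v x = st.v x) ∧ (∀ f < 5, τ.a f = st.a f) ∧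
      (∀ f, ∀ i ≥ C, τ.a f i = st.a f i) ∧ τ.v Rj ≤ u ∧ Listed τ.a S 0 (τ.v Rj))
    (by
      rintro n τ ⟨hn, hv, ha, hC, h1, h2, h3⟩
      simp; omega)
    (by
      rintro n τ ⟨hn, hv, ha, hC, h1, h2, h3⟩ h0
      simp at h0
      rw [h0, hH.zero] at h3
      exact ⟨hv, ha, hC, by omega, h3⟩)
    (by
      rintro n τ ⟨hn, hv, ha, hC, h1, h2, h3⟩ h0
      simp at h0
      have hprv := hH.prv_lt _ h1 h0
      have hle := hH.prv_le _ h1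
      have hlt : F (st.a 2 (τ.v Rp)) ⊂ F (τ.v Rp) := by
        refine Finset.ssubset_iff_subset_ne.2 ⟨fun x hx => ?_, fun hc => ?_⟩
        · simp only [F, Finset.mem_filter] at hx ⊢
          exact ⟨hx.1, hx.2.1, by omega⟩
        · have hmem : τ.v Rp ∈ F (τ.v Rp) :=
            Finset.mem_filter.2 ⟨Finset.mem_range.2 (by omega), by omega, le_rfl⟩
          rw [← hc] at hmem
          have := (Finset.mem_filter.1 hmem).2.2
          omega
      have hlt := Finset.card_lt_card hlt
      have a0 := ha 0 (by norm_num)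
      have a1 := ha 1 (by norm_num)
      have a2 := ha 2 (by norm_num)
      have hcnt := hH.cnt _ h1
      have hn : ∀ x ∈ S, st.a 0 (st.a 2 (τ.v Rp)) < x → x < st.a 0 (τ.v Rp) → False := by
        intro x hx hx1 hx2
        obtain ⟨j, hj, rfl⟩ := hH.cover x hx
        have := hH.prv_gap _ h1 h0 j hj hx2
        omega
      refine Wp.seq (Wp.ite (by simp; omega) ?_ ?_)
      · intro hc
        simp [a1] at hc
        refine Wp.seq (Wp.sto (by simp) (by simp; omega) (by norm_num) (by simp; omega) ?_)
        refine Wp.seq (Wp.sto (by simp) (by simp; omega) (by norm_num) (by simp; omega) ?_)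
        refine Wp.asg (by norm_num) (by simp; omega) (Wp.asg (by norm_num) (by simp; omega) ?_)
        set τ₁ := HS.set _ Rp _ with hτ
        have e1 : τ₁.v Rp = st.a 2 (τ.v Rp) := by simp [hτ, a2]
        have e2 : τ₁.v Rj = τ.v Rj + 1 := by simp [hτ]
        have e3 : ∀ i, τ₁.a 5 i = if i = τ.v Rj then st.a 0 (τ.v Rp) else τ.a 5 i := fun i => by
          simp [hτ, a0]
        have e4 : ∀ i, τ₁.a 6 i = if i = τ.v Rj then S.count (st.a 0 (τ.v Rp)) else τ.a 6 i :=
          fun i => by simp [hτ, a1, hcnt]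
        refine ⟨_, ⟨rfl, ?_, ?_, ?_, ?_, ?_, ?_⟩, ?_⟩
        · intro x hx
          rw [← hv x hx, hτ, HS.set_v, if_neg (by omega), HS.set_v, if_neg (by omega)]; rfl
        · intro f hf
          rw [← ha f hf]; funext i; simp [hτ, (show f ≠ 5 by omega), (show f ≠ 6 by omega)]
        · intro f i hi
          rw [← hC f i hi]; simp [hτ, (show i ≠ τ.v Rj by omega)]
        · rw [e1]; exact hle
        · rw [e1, e2]; omega
        · rw [e1, e2]
          exact h3.push hprv hn (by rw [← Multiset.count_pos]; omega) e3 e4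
        · rw [e1]; omega
      · intro hc
        simp [a1] at hc
        refine Wp.skip (Wp.asg (by norm_num) (by simp; omega) ?_)
        set τ₁ := HS.set _ Rp _ with hτ
        have e1 : τ₁.v Rp = st.a 2 (τ.v Rp) := by simp [hτ, a2]
        have e2 : τ₁.v Rj = τ.v Rj := by simp [hτ]
        refine ⟨_, ⟨rfl, ?_, ha, hC, ?_, ?_, ?_⟩, ?_⟩
        · intro x hx
          rw [← hv x hx, hτ, HS.set_v, if_neg (by omega)]
        · rw [e1]; exact hle
        · rw [e1, e2]; omega
        · rw [e1, e2]
          exact h3.down hprv hn (by rw [← Multiset.count_eq_zero]; omega)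
        · rw [e1]; omega)
  unfold collect
  refine Wp.seq (Wp.asg (by norm_num) (by simp; omega) ?_)
  refine Wp.seq (Wp.asg (by norm_num) (by simp; omega) ?_)
  refine Wp.seq (Wp.mono (hloop (6 * (F (st.a 2 0)).card) _ ⟨?_, ?_, ?_, ?_, ?_, ?_, ?_⟩) ?_)
  · simp
  · intro x hx
    simp only [HS.set_v]; rw [if_neg (by omega), if_neg (by omega)]
  · intro f hf; rfl
  · intro f i hi; rfl
  · simpa using hH.prv_le 0 (by omega)
  · simpa using hFu _
  · simp
    refine ⟨fun x => ⟨fun ⟨h1, h2⟩ => ?_, fun ⟨i, hi, _⟩ => by omega⟩, fun i j _ hj => by omega,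
      fun i hi => by omega⟩
    obtain ⟨j, hj, rfl⟩ := hH.cover x h1
    have := hH.prv_zero j hj
    omega
  · rintro τ n ⟨⟨hv, ha, hC, h1, h2⟩, hn⟩
    have := hFu (st.a 2 0)
    refine Wp.asg (by norm_num) (by simp) ⟨by omega, fun x hx hx' => ?_, ha, hC, ?_, ?_⟩
    · rw [← hv x hx, HS.set_v, if_neg hx']
    · simpa using h1
    · simpa using h2

/-- Nodes `1, …, m` with increasing keys form a list. -/
lemma Holds.of_sorted {a : ℕ → ℕ → ℕ} (hD : IncrOn D m) (hpos : ∀ i < m, 0 < D i) (hW : 0 < W)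
    (hlt : ∀ i < m, D i < W) (h00 : a 0 0 = 0) (h0 : ∀ i < m, a 0 (i + 1) = D i)
    (h10 : a 1 0 = S.count 0) (h1 : ∀ i < m, a 1 (i + 1) = S.count (D i)) (h20 : a 2 0 = m)
    (h2 : ∀ i < m, a 2 (i + 1) = i) (hS : ∀ x ∈ S, x ≠ 0 → ∃ i < m, D i = x) :
    Holds W a m S := by
  have mono : ∀ i ≤ m, ∀ j ≤ m, i < j → a 0 i < a 0 j := by
    intro i hi j hj hij
    obtain ⟨j, rfl⟩ : ∃ j', j = j' + 1 := ⟨j - 1, by omega⟩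
    rcases i with _ | i
    · rw [h00, h0 j (by omega)]; exact hpos j (by omega)
    · rw [h0 i (by omega), h0 j (by omega)]; exact hD i j (by omega) (by omega)
  have mono' : ∀ i ≤ m, ∀ j ≤ m, i ≤ j → a 0 i ≤ a 0 j := fun i hi j hj hij => by
    rcases hij.eq_or_lt with rfl | h
    · exact le_rfl
    · exact (mono i hi j hj h).le
  refine ⟨⟨h00, ?_, ?_, ?_, ?_, ?_⟩, ?_, ?_, ?_⟩
  · intro i hi j hj hij
    rcases lt_trichotomy i j with h | h | h
    · have := mono i hi j hj h; omega
    · exact h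
    · have := mono j hj i hi h; omega
  · intro i hi
    rcases i with _ | i
    · omega
    · rw [h2 i (by omega)]; omega
  · intro j hj; rw [h20]; exact mono' j hj m le_rfl hj
  · intro i hi hi0
    obtain ⟨i, rfl⟩ : ∃ j', i = j' + 1 := ⟨i - 1, by omega⟩
    rw [h2 i (by omega)]; exact mono i (by omega) _ hi (by omega)
  · intro i hi hi0 j hj hji
    obtain ⟨i, rfl⟩ : ∃ j', i = j' + 1 := ⟨i - 1, by omega⟩
    rw [h2 i (by omega)]
    refine mono' j hj i (by omega) ?_
    by_contra hc
    have := mono' _ hi j hj (by omega)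
    omega
  · intro i hi
    rcases i with _ | i
    · omega
    · rw [h0 i (by omega)]; exact hlt i (by omega)
  · intro i hi
    rcases i with _ | i
    · rw [h00, h10]
    · rw [h0 i (by omega), h1 i (by omega)]
  · intro x hx
    rcases eq_or_ne x 0 with rfl | h
    · exact ⟨0, by omega, h00⟩
    · obtain ⟨i, hi, rfl⟩ := hS x hx h
      exact ⟨i + 1, hi, h0 i hi⟩

/-- The listed keys become the static nodes `1, …, m`. -/
theorem layout_spec (hBW : B ≤ W) (hB : 8 * C ≤ B) {st : HS} (hm : st.v Rstat + 1 < C)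
    (hL : Listed st.a S 0 (st.v Rstat)) (hW : ∀ x ∈ S, x < W) (h0 : st.a 0 0 = 0)
    (h1 : st.a 1 0 = S.count 0) : Wp W B layout st fun τ c => c ≤ 5 * st.v Rstat + 4 ∧
      (∀ x < 42, x ≠ Rused → τ.v x = st.v x) ∧ τ.v Rused = st.v Rstat ∧
      (∀ f, 3 ≤ f → τ.a f = st.a f) ∧ (∀ f, ∀ i ≥ C, τ.a f i = st.a f i) ∧
      Holds W τ.a (st.v Rstat) S ∧ ∃ D, IncrOn D (st.v Rstat) ∧ (∀ i < st.v Rstat, 0 < D i) ∧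
      (∀ i < st.v Rstat, D i < W) ∧ (∀ i < st.v Rstat, τ.a 0 (i + 1) = D i) ∧
      ∀ x > 0, x ∈ S ↔ ∃ i < st.v Rstat, D i = x := by
  obtain ⟨m, hvm⟩ : ∃ m, st.v Rstat = m := ⟨_, rfl⟩
  rw [hvm] at hm hL
  simp only [hvm]
  set D : ℕ → ℕ := fun i => st.a 5 (m - (i + 1)) with hD
  have hloop := Wp.loop (W := W) (B := B) (e := .lt (V Rj) (V Rstat))
    (c := .sto 0 (V Rj + 1) (.arr 5 (V Rstat - (V Rj + 1))) ;;
      .sto 1 (V Rj + 1) (.arr 6 (V Rstat - (V Rj + 1))) ;;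
      .sto 2 (V Rj + 1) (V Rj) ;; Rj ≔ V Rj + 1)
    (fun n τ => n = 5 * (m - τ.v Rj) ∧ (∀ x < 42, τ.v x = st.v x) ∧
      (∀ f, 3 ≤ f → τ.a f = st.a f) ∧ (∀ f, ∀ i ≥ C, τ.a f i = st.a f i) ∧ τ.v Rj ≤ m ∧
      (∀ f, τ.a f 0 = st.a f 0) ∧ ∀ i < τ.v Rj, τ.a 0 (i + 1) = D i ∧
        τ.a 1 (i + 1) = S.count (D i) ∧ τ.a 2 (i + 1) = i)
    (fun τ => (∀ x < 42, τ.v x = st.v x) ∧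
      (∀ f, 3 ≤ f → τ.a f = st.a f) ∧ (∀ f, ∀ i ≥ C, τ.a f i = st.a f i) ∧
      (∀ f, τ.a f 0 = st.a f 0) ∧ ∀ i < m, τ.a 0 (i + 1) = D i ∧
        τ.a 1 (i + 1) = S.count (D i) ∧ τ.a 2 (i + 1) = i)
    (by
      rintro n τ ⟨hn, hv, ha, hC, h1, h2, h3⟩
      simp)
    (by
      rintro n τ ⟨hn, hv, ha, hC, h1, h2, h3⟩ h0
      have hvr := hv Rstat (by norm_num)
      simp [hvr, hvm] at h0
      exact ⟨hv, ha, hC, h2, fun i hi => h3 i (by omega)⟩)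
    (by
      rintro n τ ⟨hn, hv, ha, hC, h1, h2, h3⟩ h0
      have hvr := hv Rstat (by norm_num)
      simp [hvr, hvm] at h0
      have a5 := ha 5 (by norm_num)
      have a6 := ha 6 (by norm_num)
      have hc6 : st.a 6 (m - (τ.v Rj + 1)) = S.count (D (τ.v Rj)) := hL.cnt _ (by omega)
      refine Wp.seq (Wp.sto (by simp; omega) (by simp [hvr, hvm]; omega) (by norm_num)
        (by simp; omega) ?_)
      refine Wp.seq (Wp.sto (by simp; omega) (by simp [hvr, hvm]; omega) (by norm_num)
        (by simp; omega) ?_)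
      refine Wp.seq (Wp.sto (by simp; omega) (by simp) (by norm_num)
        (by simp; omega) ?_)
      refine Wp.asg (by norm_num) (by simp; omega) ?_
      set τ₁ := HS.set _ Rj _ with hτ
      have e1 : τ₁.v Rj = τ.v Rj + 1 := by simp [hτ]
      have e2 : ∀ i, τ₁.a 0 i = if i = τ.v Rj + 1 then D (τ.v Rj) else τ.a 0 i := fun i => by
        simp [hτ, hvr, hvm, a5, hD]
      have e3 : ∀ i, τ₁.a 1 i = if i = τ.v Rj + 1 then S.count (D (τ.v Rj)) else τ.a 1 i :=
        fun i => by simp [hτ, hvr, hvm, a6, hc6]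
      have e4 : ∀ i, τ₁.a 2 i = if i = τ.v Rj + 1 then τ.v Rj else τ.a 2 i :=
        fun i => by simp [hτ]
      refine ⟨_, ⟨rfl, ?_, ?_, ?_, ?_, ?_, ?_⟩, ?_⟩
      · intro x hx
        rw [← hv x hx, hτ, HS.set_v, if_neg (by omega)]; rfl
      · intro f hf
        rw [← ha f hf]
        funext i; simp [hτ, (show f ≠ 0 by omega), (show f ≠ 1 by omega), (show f ≠ 2 by omega)]
      · intro f i hi
        rw [← hC f i hi]; simp [hτ, (show i ≠ τ.v Rj + 1 by omega)]
      · omega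
      · intro f
        rw [← h2 f]; simp [hτ]
      · intro i hi
        rw [e2, e3, e4]
        by_cases hij : i = τ.v Rj
        · subst hij; simp
        · simp only [add_left_inj, hij, if_false]
          exact h3 i (by omega)
      · rw [e1]; omega)
  unfold layout
  refine Wp.seq (Wp.asg (by norm_num) (by simp; omega) ?_)
  refine Wp.seq (Wp.mono (hloop (5 * m) _ ⟨?_, ?_, ?_, ?_, ?_, ?_, ?_⟩) ?_)
  · simp
  · intro x hx
    rw [HS.set_v, if_neg (by omega)]
  · intro f _; rfl
  · intro f i _; rfl
  · simp
  · intro f; rfl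
  · intro i hi; simp at hi
  rintro τ n ⟨⟨hv, ha, hC, h2, h3⟩, hn⟩
  have hvr := hv Rstat (by norm_num)
  refine Wp.seq (Wp.sto (by simp; omega) (by simp) (by norm_num) (by simp; omega) ?_)
  refine Wp.asg (by norm_num) (by simp) ?_
  set τ₁ := HS.set _ Rused _ with hτ
  have dpos : ∀ i < m, 0 < D i ∧ D i ∈ S := fun i hi => by
    have := (hL.mem (D i)).2 ⟨m - (i + 1), by omega, rfl⟩
    exact ⟨this.2, this.1⟩
  have dinc : IncrOn D m := fun i j hij hj => hL.decr _ _ (by omega) (by omega)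
  have dlt : ∀ i < m, D i < W := fun i hi => hW _ (dpos i hi).2
  have dmem : ∀ x > 0, x ∈ S ↔ ∃ i < m, D i = x := by
    intro x hx
    have := hL.mem x
    refine ⟨fun h => ?_, ?_⟩
    · obtain ⟨i, hi, h'⟩ := this.1 ⟨h, hx⟩
      exact ⟨m - (i + 1), by omega, by simp only [hD]; rw [← h']; congr 1; omega⟩
    · rintro ⟨i, hi, rfl⟩
      exact (dpos i hi).2
  have e0 : ∀ i, τ₁.a 0 i = τ.a 0 i := fun i => by simp [hτ]
  have e1 : ∀ i, τ₁.a 1 i = τ.a 1 i := fun i => by simp [hτ]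
  have e2 : ∀ i, τ₁.a 2 i = if i = 0 then m else τ.a 2 i := fun i => by simp [hτ, hvr, hvm]
  refine ⟨by omega, ?_, ?_, ?_, ?_, ?_, D, dinc, fun i hi => (dpos i hi).1, dlt, ?_, dmem⟩
  · intro x hx hx'
    rw [← hv x hx, hτ, HS.set_v, if_neg hx']; rfl
  · simp [hτ, hvr, hvm]
  · intro f hf
    rw [← ha f hf]; funext i; simp [hτ, (show f ≠ 2 by omega)]
  · intro f i hi
    rw [← hC f i hi]; simp [hτ, (show i ≠ 0 by omega)]
  · refine Holds.of_sorted dinc (fun i hi => (dpos i hi).1) (by omega) dlt ?_ ?_ ?_ ?_ ?_ ?_ ?_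
    · rw [e0, h2, h0]
    · intro i hi; rw [e0, (h3 i hi).1]
    · rw [e1, h2, h1]
    · intro i hi; rw [e1, (h3 i hi).2.1]
    · rw [e2, if_pos rfl]
    · intro i hi; rw [e2, if_neg (by omega), (h3 i hi).2.2]
    · intro x hx hx0; exact (dmem x (by omega)).1 hx
  · intro i hi; rw [e0, (h3 i hi).1]

/-- The distance `g` between samples is about `log m`, found by repeated doubling. -/
theorem chooseGap_spec (hBW : B ≤ W) (hB : 8 * C ≤ B) {st : HS} (hm : st.v Rstat < C) :
    Wp W B chooseGap st fun τ c => c ≤ 3 * st.v Rstat + 7 ∧ τ.a = st.a ∧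
      (∀ x < 42, x ≠ Rgap → x ≠ Rsamp → τ.v x = st.v x) ∧
      1 ≤ τ.v Rgap ∧ τ.v Rgap ≤ Nat.log 2 (st.v Rstat) + 2 ∧
      st.v Rstat < 2 ^ (τ.v Rgap - 1) ∧
      τ.v Rsamp = (st.v Rstat + τ.v Rgap - 1) / τ.v Rgap := by
  obtain ⟨m, hvm⟩ : ∃ m, st.v Rstat = m := ⟨_, rfl⟩
  rw [hvm] at hm
  simp only [hvm]
  have hloop := Wp.loop (W := W) (B := B) (e := .lt (V Rt) (V Rstat + 1))
    (c := Rt ≔ V Rt + V Rt ;; Rgap ≔ V Rgap + 1)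
    (fun n τ => n = 3 * (m + 1 - τ.v Rt) ∧ τ.a = st.a ∧ (∀ x < 42, x ≠ Rgap → τ.v x = st.v x) ∧
      1 ≤ τ.v Rgap ∧ τ.v Rgap ≤ Nat.log 2 m + 2 ∧ τ.v Rt = 2 ^ (τ.v Rgap - 1))
    (fun τ => τ.a = st.a ∧ (∀ x < 42, x ≠ Rgap → τ.v x = st.v x) ∧
      1 ≤ τ.v Rgap ∧ τ.v Rgap ≤ Nat.log 2 m + 2 ∧ m < 2 ^ (τ.v Rgap - 1))
    (by
      rintro n τ ⟨hn, ha, hv, h1, h2, h3⟩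
      have hvr := hv Rstat (by norm_num) (by norm_num)
      simp [hvr, hvm]; omega)
    (by
      rintro n τ ⟨hn, ha, hv, h1, h2, h3⟩ h0
      have hvr := hv Rstat (by norm_num) (by norm_num)
      simp [hvr, hvm] at h0
      exact ⟨ha, hv, h1, h2, by omega⟩)
    (by
      rintro n τ ⟨hn, ha, hv, h1, h2, h3⟩ h0
      have hvr := hv Rstat (by norm_num) (by norm_num)
      simp [hvr, hvm] at h0
      have hpos : 0 < 2 ^ (τ.v Rgap - 1) := by positivity
      have hlog : τ.v Rgap - 1 ≤ Nat.log 2 m :=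
        Nat.le_log_of_pow_le (by norm_num) (by omega)
      have hlm := Nat.log_le_self 2 m
      refine Wp.seq (Wp.asg (by norm_num) (by simp; omega) ?_)
      refine Wp.asg (by norm_num) (by simp; omega) ?_
      refine ⟨_, ⟨rfl, ha, ?_, ?_, ?_, ?_⟩, ?_⟩
      · intro x hx hx'
        rw [← hv x hx hx', HS.set_v, if_neg hx', HS.set_v, if_neg (by omega)]
      · simp
      · simp; omega
      · simp [h3]; rw [← two_mul, ← pow_succ']; congr 1; omega
      · simp; omega)
  unfold chooseGap
  have hlm := Nat.log_le_self 2 m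
  refine Wp.seq (Wp.asg (by norm_num) (by simp; omega) ?_)
  refine Wp.seq (Wp.asg (by norm_num) (by simp; omega) ?_)
  refine Wp.seq (Wp.mono (hloop (3 * m) _ ⟨?_, ?_, ?_, ?_, ?_, ?_⟩) ?_)
  · simp
  · rfl
  · intro x hx hx'
    rw [HS.set_v, if_neg (by omega), HS.set_v, if_neg hx']
  · simp
  · simp
  · simp
  rintro τ n ⟨⟨ha, hv, h1, h2, h3⟩, hn⟩
  have hvr := hv Rstat (by norm_num) (by norm_num)
  refine Wp.asg (by norm_num) (by simp [hvr, hvm]; omega) ⟨by omega, ha, ?_, ?_, ?_, ?_, ?_⟩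
  · intro x hx hx' hx2
    rw [← hv x hx hx', HS.set_v, if_neg hx2]
  · simpa using h1
  · simpa using h2
  · simpa using h3
  · simp [hvr, hvm]

/-- The tables of `g + 1` levels over `m / g` samples fit into linear space. -/
lemma size_bound (hm : 0 < m) (hg : 1 ≤ g) (hgl : g ≤ Nat.log 2 m + 2)
    (hM : M = (m + g - 1) / g) : (g + 1) * M ≤ 4 * m := by
  have h1 := Nat.log_lt_self 2 hm.ne'
  have h2 : g * M ≤ m + g - 1 := by rw [hM]; exact Nat.mul_div_le _ _
  have h3 : M ≤ m := by
    rw [hM]; refine Nat.div_le_of_le_mul ?_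
    obtain ⟨g, rfl⟩ : ∃ g', g = g' + 1 := ⟨g - 1, by omega⟩
    have : g ≤ g * m := Nat.le_mul_of_pos_right _ hm
    rw [add_mul, one_mul]; omega
  rw [add_mul, one_mul]; omega

end Rebuild

/-! ### Filling the tables -/

/-- The cell of a sample in the grid of the current node. -/
abbrev cellE : Ex := (smpA (V Ry) - V Rlo) / V Rwd

/-- Fill in the table of a node, and the ends of its children. -/
def fillNode : Stm :=
  Rend ≔ segA (V Rb + V Rnode) ;;
  Rlo ≔ smpA (V Rnode) ;;
  Rwd ≔ (smpA (V Rend - 1) - V Rlo) / (V Rend - V Rnode) + 1 ;;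
  Rj ≔ 0 ;; Ry ≔ V Rnode ;;
  .loop (.lt (V Rj) (V Rend - V Rnode))
    (.ite (.and (.lt (V Ry) (V Rend)) (.lt cellE (V Rj))) (Ry ≔ V Ry + 1)
      (.sto 3 (V Rb + (V Rnode + V Rj)) (V Ry) ;; Rj ≔ V Rj + 1)) ;;
  Ry ≔ V Rnode ;;
  .loop (.lt (V Ry) (V Rend))
    (.sto 4 (V Rb + V Rsamp + tabA (V Rb + (V Rnode + cellE))) (V Ry + 1) ;; Ry ≔ V Ry + 1) ;;
  Rnode ≔ V Rend

/-- Fill in the tables of all nodes, level by level. -/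
def fillTables : Stm :=
  .sto 4 0 (V Rsamp) ;; Rb ≔ 0 ;; Rl ≔ 0 ;;
  .loop (.lt (V Rl) (V Rgap))
    (Rnode ≔ 0 ;; .loop (.lt (V Rnode) (V Rsamp)) fillNode ;;
      Rb ≔ V Rb + V Rsamp ;; Rl ≔ V Rl + 1)

section Fill

variable {W B C : ℕ} {m g M u : ℕ} {D : ℕ → ℕ} {S : Multiset ℕ}

/-- The table of the node above `y` at depth `d` is correct. -/
def TabOK (κ : ℕ → ℕ) (M : ℕ) (a : ℕ → ℕ) (d y : ℕ) : Prop :=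
  ∀ j < (node κ M d y).2 - (node κ M d y).1, a (d * M + ((node κ M d y).1 + j)) =
    cellStart κ (node κ M d y).1 (node κ M d y).2 j

/-- The end of the node above `y` at depth `d` is correct. -/
def SegOK (κ : ℕ → ℕ) (M : ℕ) (a : ℕ → ℕ) (d y : ℕ) : Prop :=
  a (d * M + (node κ M d y).1) = (node κ M d y).2

/-- A criterion for the start of a cell, as found by a scan over the node. -/
lemma cellStart_eq {κ : ℕ → ℕ} {L R y j : ℕ} (h : IncrOn κ M) (hR : R ≤ M) (hLy : L ≤ y)
    (hyR : y ≤ R) (h1 : ∀ z, L ≤ z → z < y → cellOf κ L R (κ z) < j)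
    (h2 : y < R → j ≤ cellOf κ L R (κ y)) : cellStart κ L R j = y := by
  rcases lt_trichotomy (cellStart κ L R j) y with h3 | h3 | h3
  · have := (cellStart_iff h hR (le_cellStart j) (h3.trans_le hyR) j).2 (h1 _ (le_cellStart j) h3)
    omega
  · exact h3
  · have : cellStart κ L R j ≤ R := cellStart_le (hLy.trans hyR) j
    have hy : y < R := by omega
    have := (cellStart_iff h hR hLy hy j).1 h3
    have := h2 hy
    omega

/-- One scan over a node and its grid yields the starts of all cells. -/
lemma fillTab_spec (hBW : B ≤ W) (hB : 8 * C ≤ B) {st : HS} {κ : ℕ → ℕ} (hinc : IncrOn κ M)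
    {L R b : ℕ} (hL : L < R) (hR : R ≤ M) (hbC : b + M ≤ C)
    (hsmp : ∀ x < M, st.a 0 (1 + x * g) = κ x ∧ 1 + x * g < C)
    (vg : st.v Rgap = g) (vb : st.v Rb = b) (vL : st.v Rnode = L) (vR : st.v Rend = R)
    (vlo : st.v Rlo = κ L) (vwd : st.v Rwd = gridWidth κ L R) (vj : st.v Rj = 0)
    (vy : st.v Ry = L) :
    Wp W B (.loop (.lt (V Rj) (V Rend - V Rnode))
      (.ite (.and (.lt (V Ry) (V Rend)) (.lt cellE (V Rj))) (Ry ≔ V Ry + 1)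
        (.sto 3 (V Rb + (V Rnode + V Rj)) (V Ry) ;; Rj ≔ V Rj + 1))) st fun τ c =>
      c ≤ 8 * (R - L) + 1 ∧ (∀ x < 49, τ.v x = st.v x) ∧ (∀ f ≠ 3, τ.a f = st.a f) ∧
      (∀ i, (i < b + L ∨ b + R ≤ i) → τ.a 3 i = st.a 3 i) ∧
      ∀ j < R - L, τ.a 3 (b + (L + j)) = cellStart κ L R j := by
  have hκlt : ∀ x < M, L ≤ x → κ L ≤ κ x := fun x hx hLx => hinc.le hLx hx
  refine Wp.mono (Wp.loop (W := W) (B := B)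
    (fun n τ => n = 4 * (R - τ.v Ry) + 4 * (R - L - τ.v Rj) ∧ (∀ x < 49, τ.v x = st.v x) ∧
      (∀ f ≠ 3, τ.a f = st.a f) ∧
      (∀ i, (i < b + L ∨ b + R ≤ i) → τ.a 3 i = st.a 3 i) ∧ L ≤ τ.v Ry ∧ τ.v Ry ≤ R ∧
      τ.v Rj ≤ R - L ∧ (∀ z, L ≤ z → z < τ.v Ry → cellOf κ L R (κ z) < τ.v Rj) ∧
      ∀ j < τ.v Rj, τ.a 3 (b + (L + j)) = cellStart κ L R j)
    (fun τ => (∀ x < 49, τ.v x = st.v x) ∧ (∀ f ≠ 3, τ.a f = st.a f) ∧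
      (∀ i, (i < b + L ∨ b + R ≤ i) → τ.a 3 i = st.a 3 i) ∧
      ∀ j < R - L, τ.a 3 (b + (L + j)) = cellStart κ L R j)
    ?_ ?_ ?_ (8 * (R - L)) st ⟨?_, ?_, ?_, ?_, ?_, ?_, ?_, ?_, ?_⟩) ?_
  · rintro n τ ⟨hn, hv, ha, h3, h4, h5, h6, h7, h8⟩
    have v1 := hv Rend (by norm_num)
    have v2 := hv Rnode (by norm_num)
    simp [v1, v2, vL, vR]; omega
  · rintro n τ ⟨hn, hv, ha, h3, h4, h5, h6, h7, h8⟩ h0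
    have v1 := hv Rend (by norm_num)
    have v2 := hv Rnode (by norm_num)
    simp [v1, v2, vL, vR] at h0
    exact ⟨hv, ha, h3, fun j hj => h8 j (by omega)⟩
  · rintro n τ ⟨hn, hv, ha, h3, h4, h5, h6, h7, h8⟩ h0
    have v1 := hv Rend (by norm_num)
    have v2 := hv Rnode (by norm_num)
    have v3 := hv Rgap (by norm_num)
    have v4 := hv Rlo (by norm_num)
    have v5 := hv Rwd (by norm_num)
    have v6 := hv Rb (by norm_num)
    simp [v1, v2, vL, vR] at h0
    have a0 := ha 0 (by norm_num)
    refine Wp.ite ?_ ?_ ?_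
    · simp [v1, v3, v4, a0, vR, vg, vlo]
      intro hy
      have e1 := hsmp (τ.v Ry) (by omega)
      have e2 := hκlt (τ.v Ry) (by omega) h4
      rw [e1.1]; omega
    · intro hc
      by_cases hy : τ.v Ry < R
      swap
      · simp [v1, vR, hy] at hc
      have e1 := hsmp (τ.v Ry) (by omega)
      simp [v1, v3, v4, v5, a0, vR, vg, vlo, vwd, hy, e1.1] at hc
      refine Wp.asg (by norm_num) (by simp; omega) ⟨_, ⟨rfl, ?_, ha, h3, ?_, ?_, ?_, ?_, ?_⟩, ?_⟩
      · intro x hx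
        rw [HS.set_v, if_neg (by omega), hv x hx]
      · simp; omega
      · simp; omega
      · simpa using h6
      · intro z hz hz'
        simp at hz' ⊢
        rcases Nat.lt_or_eq_of_le hz' with h | h
        · exact h7 z hz h
        · rw [h]; exact hc
      · simpa using h8
      · simp; omega
    · intro hc
      have hc' : τ.v Ry < R → τ.v Rj ≤ cellOf κ L R (κ (τ.v Ry)) := fun hy => by
        have e1 := hsmp (τ.v Ry) (by omega)
        simp [v1, v3, v4, v5, a0, vR, vg, vlo, vwd, e1.1, not_le.2 hy] at hc
        exact hc
      have e2 := cellStart_eq hinc hR h4 h5 h7 hc'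
      refine Wp.seq (Wp.sto (by simp [v6, v2, vb, vL]; omega) (by simp) (by norm_num)
        (by simp [v6, v2, vb, vL]; omega) ?_)
      refine Wp.asg (by norm_num) (by simp; omega) ?_
      set τ₁ := HS.set _ Rj _ with hτ
      have e3 : ∀ i, τ₁.a 3 i = if i = b + (L + τ.v Rj) then τ.v Ry else τ.a 3 i := fun i => by
        simp [hτ, v6, v2, vb, vL]
      have e4 : τ₁.v Rj = τ.v Rj + 1 := by simp [hτ]
      have e5 : τ₁.v Ry = τ.v Ry := by simp [hτ]
      refine ⟨_, ⟨rfl, ?_, ?_, ?_, ?_, ?_, ?_, ?_, ?_⟩, ?_⟩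
      · intro x hx
        rw [← hv x hx, hτ, HS.set_v, if_neg (by omega)]; rfl
      · intro f hf
        rw [← ha f hf]; funext i; simp [hτ, hf]
      · intro i hi
        rw [e3, if_neg (by omega), h3 i hi]
      · rwa [e5]
      · rwa [e5]
      · rw [e4]; omega
      · intro z hz hz'
        rw [e5] at hz'
        have := h7 z hz hz'
        omega
      · intro j hj
        rw [e3]
        by_cases h : j = τ.v Rj
        · rw [h, if_pos rfl, e2]
        · rw [if_neg (by omega), h8 j (by omega)]
      · omega
  · rw [vy, vj]; omega
  · intro x _; rfl
  · intro f _; rfl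
  · intro i _; rfl
  · omega
  · omega
  · omega
  · intro z _ _; omega
  · intro j _; omega
  · rintro τ n ⟨h1, h2⟩
    exact ⟨by omega, h1⟩

/-- In a scan over a node, the last write to the end of a child is the correct one. -/
lemma fillSeg_spec (hBW : B ≤ W) (hB : 8 * C ≤ B) {st : HS} {κ : ℕ → ℕ} (hinc : IncrOn κ M)
    {d L R b : ℕ} (hLM : L < M) (hnode : node κ M d L = (L, R)) (hb : b = d * M)
    (hbC : b + M + M ≤ C) (hsmp : ∀ x < M, st.a 0 (1 + x * g) = κ x ∧ 1 + x * g < C)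
    (vg : st.v Rgap = g) (vM : st.v Rsamp = M) (vb : st.v Rb = b) (vL : st.v Rnode = L)
    (vR : st.v Rend = R) (vlo : st.v Rlo = κ L) (vwd : st.v Rwd = gridWidth κ L R)
    (vy : st.v Ry = L) (htab : ∀ j < R - L, st.a 3 (b + (L + j)) = cellStart κ L R j) :
    Wp W B (.loop (.lt (V Ry) (V Rend))
      (.sto 4 (V Rb + V Rsamp + tabA (V Rb + (V Rnode + cellE))) (V Ry + 1) ;; Ry ≔ V Ry + 1))
      st fun τ c =>
      c ≤ 3 * (R - L) + 1 ∧ (∀ x < 49, τ.v x = st.v x) ∧ (∀ f ≠ 4, τ.a f = st.a f) ∧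
      (∀ i, (i < b + M + L ∨ b + M + R ≤ i) → τ.a 4 i = st.a 4 i) ∧
      ∀ y, L ≤ y → y < R → SegOK κ M (τ.a 4) (d + 1) y := by
  have hmL := node_mem hinc hLM d
  rw [hnode] at hmL
  simp only at hmL
  have hκlt : ∀ x < M, L ≤ x → κ L ≤ κ x := fun x hx hLx => hinc.le hLx hx
  have hnd : ∀ y, L ≤ y → y < R → node κ M d y = (L, R) := fun y h1 h2 => by
    rw [← hnode]; exact node_eq hinc hLM d y (by rw [hnode]; exact h1) (by rw [hnode]; exact h2)
  have hn1 : ∀ y, L ≤ y → y < R → (node κ M (d + 1) y).1 = cellStart κ L R (cellOf κ L R (κ y)) :=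
    fun y h1 h2 => by simp only [node, hnd y h1 h2]
  have hmem : ∀ y, L ≤ y → y < R → L ≤ (node κ M (d + 1) y).1 ∧ (node κ M (d + 1) y).1 ≤ y ∧
      y < (node κ M (d + 1) y).2 ∧ (node κ M (d + 1) y).2 ≤ R := fun y h1 h2 => by
    have h3 := node_mem hinc (show y < M by omega) (d + 1)
    have h4 := node_succ_le hinc (show y < M by omega) d
    rw [hnd y h1 h2] at h4
    simp only at h4
    omega
  have hcell : ∀ y, L ≤ y → y < R → cellOf κ L R (κ y) < R - L := fun y h1 h2 =>
    cellOf_lt (by omega) (hinc.le (by omega) (by omega))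
  have hbM : (d + 1) * M = b + M := by rw [hb, add_mul, one_mul]
  refine Wp.mono (Wp.loop (W := W) (B := B)
    (fun n τ => n = 3 * (R - τ.v Ry) ∧ (∀ x < 49, τ.v x = st.v x) ∧
      (∀ f ≠ 4, τ.a f = st.a f) ∧
      (∀ i, (i < b + M + L ∨ b + M + R ≤ i) → τ.a 4 i = st.a 4 i) ∧ L ≤ τ.v Ry ∧ τ.v Ry ≤ R ∧
      ∀ z, L ≤ z → z < τ.v Ry → τ.a 4 (b + M + (node κ M (d + 1) z).1) =
        min (τ.v Ry) (node κ M (d + 1) z).2)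
    (fun τ => (∀ x < 49, τ.v x = st.v x) ∧ (∀ f ≠ 4, τ.a f = st.a f) ∧
      (∀ i, (i < b + M + L ∨ b + M + R ≤ i) → τ.a 4 i = st.a 4 i) ∧
      ∀ y, L ≤ y → y < R → SegOK κ M (τ.a 4) (d + 1) y)
    ?_ ?_ ?_ (3 * (R - L)) st ⟨?_, ?_, ?_, ?_, ?_, ?_, ?_⟩) ?_
  · rintro n τ ⟨hn, hv, ha, h3, h4, h5, h6⟩
    simp
  · rintro n τ ⟨hn, hv, ha, h3, h4, h5, h6⟩ h0
    have v1 := hv Rend (by norm_num)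
    simp [v1, vR] at h0
    refine ⟨hv, ha, h3, fun y h1 h2 => ?_⟩
    have := hmem y h1 h2
    rw [SegOK, hbM, h6 y h1 (by omega)]
    omega
  · rintro n τ ⟨hn, hv, ha, h3, h4, h5, h6⟩ h0
    have v1 := hv Rend (by norm_num)
    have v2 := hv Rnode (by norm_num)
    have v3 := hv Rgap (by norm_num)
    have v4 := hv Rlo (by norm_num)
    have v5 := hv Rwd (by norm_num)
    have v6 := hv Rb (by norm_num)
    have v7 := hv Rsamp (by norm_num)
    simp [v1, vR] at h0
    have a0 := ha 0 (by norm_num)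
    have a3 := ha 3 (by norm_num)
    have e1 := hsmp (τ.v Ry) (by omega)
    have e2 := hκlt (τ.v Ry) (by omega) h4
    have e3 := hcell (τ.v Ry) h4 h0
    have e4 := htab _ e3
    rw [← hn1 _ h4 h0] at e4
    have e5 := hmem _ h4 h0
    have e6 : (κ (τ.v Ry) - κ L) / gridWidth κ L R = cellOf κ L R (κ (τ.v Ry)) := rfl
    refine Wp.seq (Wp.sto ?_ (by simp; omega) (by norm_num) ?_ ?_)
    · simp [v2, v3, v4, v5, v6, v7, a0, a3, vL, vg, vlo, vwd, vb, vM, e1.1, e6, e4]; omega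
    · simp [v2, v3, v4, v5, v6, v7, a0, a3, vL, vg, vlo, vwd, vb, vM, e1.1, e6, e4]; omega
    refine Wp.asg (by norm_num) (by simp; omega) ?_
    set τ₁ := HS.set _ Ry _ with hτ
    have e7 : ∀ i, τ₁.a 4 i = if i = b + M + (node κ M (d + 1) (τ.v Ry)).1 then τ.v Ry + 1
        else τ.a 4 i := fun i => by
      simp [hτ, v2, v3, v4, v5, v6, v7, a0, a3, vL, vg, vlo, vwd, vb, vM, e1.1, e6, e4]
    have e8 : τ₁.v Ry = τ.v Ry + 1 := by simp [hτ]
    refine ⟨_, ⟨rfl, ?_, ?_, ?_, ?_, ?_, ?_⟩, ?_⟩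
    · intro x hx
      rw [← hv x hx, hτ, HS.set_v, if_neg (by omega)]; rfl
    · intro f hf
      rw [← ha f hf]; funext i; simp [hτ, hf]
    · intro i hi
      rw [e7, if_neg (by omega), h3 i hi]
    · omega
    · omega
    · intro z hz hz'
      rw [e8] at hz' ⊢
      have hz2 := hmem z hz (by omega)
      rw [e7]
      by_cases hs : (node κ M (d + 1) z).1 = (node κ M (d + 1) (τ.v Ry)).1
      · rw [if_pos (by omega)]
        have k1 := node_eq hinc (show z < M by omega) (d + 1) _ le_rfl (by omega)
        have k2 := node_eq hinc (show τ.v Ry < M by omega) (d + 1) _ le_rfl (by omega)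
        rw [← hs, k1] at k2
        rw [k2]; omega
      · rw [if_neg (by omega)]
        have hne : z ≠ τ.v Ry := fun h => hs (by rw [h])
        rw [h6 z hz (by omega)]
        have : (node κ M (d + 1) z).2 ≤ τ.v Ry := by
          by_contra hc
          have := node_eq hinc (show z < M by omega) (d + 1) (τ.v Ry) (by omega) (by omega)
          rw [this] at hs
          exact hs rfl
        omega
    · omega
  · rw [vy]
  · intro x _; rfl
  · intro f _; rfl
  · intro i _; rfl
  · omega
  · omega
  · intro z _ _; omega
  · rintro τ n ⟨h1, h2⟩
    exact ⟨by omega, h1⟩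

/-- The table of one node, and the ends of its children, are computed in time linear in the
number of samples in the node. -/
theorem fillNode_spec (hBW : B ≤ W) (hB : 8 * C ≤ B) {st : HS} {κ : ℕ → ℕ} (hinc : IncrOn κ M)
    {d L R b : ℕ} (hLM : L < M) (hnode : node κ M d L = (L, R)) (hb : b = d * M)
    (hbC : b + M + M ≤ C) (hsmp : ∀ x < M, st.a 0 (1 + x * g) = κ x ∧ 1 + x * g < C)
    (hκW : ∀ x < M, κ x < W)
    (vg : st.v Rgap = g) (vM : st.v Rsamp = M) (vb : st.v Rb = b) (vL : st.v Rnode = L)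
    (hseg : st.a 4 (b + L) = R) :
    Wp W B fillNode st fun τ c =>
      c ≤ 11 * (R - L) + 9 ∧ (∀ x < 45, τ.v x = st.v x) ∧ τ.v Rnode = R ∧
      (∀ f ≠ 3, f ≠ 4 → τ.a f = st.a f) ∧
      (∀ i, (i < b + L ∨ b + R ≤ i) → τ.a 3 i = st.a 3 i) ∧
      (∀ i, (i < b + M + L ∨ b + M + R ≤ i) → τ.a 4 i = st.a 4 i) ∧
      ∀ y, L ≤ y → y < R → TabOK κ M (τ.a 3) d y ∧ SegOK κ M (τ.a 4) (d + 1) y := by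
  have hmL := node_mem hinc hLM d
  rw [hnode] at hmL
  simp only at hmL
  obtain ⟨s1, s1'⟩ := hsmp L (by omega)
  obtain ⟨s2, s2'⟩ := hsmp (R - 1) (by omega)
  have k1 := hκW (R - 1) (by omega)
  have hLR : κ L ≤ κ (R - 1) := hinc.le (by omega) (by omega)
  have hwd : (κ (R - 1) - κ L) / (R - L) + 1 = gridWidth κ L R := rfl
  have hwdW : (κ (R - 1) - κ L) / (R - L) + 1 < W ∨ κ (R - 1) = κ L := by
    rcases Nat.eq_or_lt_of_le hLR with h | h
    · exact Or.inr h.symm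
    · left
      rcases Nat.lt_or_ge (R - L) 2 with h2 | h2
      · have : L = R - 1 := by omega
        rw [← this] at h; omega
      · have := Nat.div_lt_self (show 0 < κ (R - 1) - κ L by omega) h2; omega
  have hwdW' : (κ (R - 1) - κ L) / (R - L) + 1 < W := by
    rcases hwdW with h | h
    · exact h
    · rw [h]; simp; omega
  unfold fillNode
  refine Wp.seq (Wp.asg (by norm_num) (by simp [vb, vL]; omega) ?_)
  refine Wp.seq (Wp.asg (by norm_num) (by simp [vg, vL]; omega) ?_)
  refine Wp.seq (Wp.asg (by norm_num) (by simp [vg, vL, vb, hseg, s1, s2]; omega) ?_)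
  refine Wp.seq (Wp.asg (by norm_num) (by simp; omega) ?_)
  refine Wp.seq (Wp.asg (by norm_num) (by simp) ?_)
  set τ₀ := HS.set _ Ry _ with hτ₀
  have hv0 : ∀ x < 46, τ₀.v x = st.v x := fun x hx => by
    rw [hτ₀, HS.set_v, if_neg (by omega), HS.set_v, if_neg (by omega), HS.set_v, if_neg (by omega),
      HS.set_v, if_neg (by omega), HS.set_v, if_neg (by omega)]
  have ha0 : τ₀.a = st.a := rfl
  have g1 : τ₀.v Rend = R := by simp [hτ₀, vb, vL, hseg]
  have g2 : τ₀.v Rlo = κ L := by simp [hτ₀, vg, vL, s1]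
  have g3 : τ₀.v Rwd = gridWidth κ L R := by simp [hτ₀, vb, vg, vL, hseg, s1, s2, hwd]
  have g4 : τ₀.v Rj = 0 := by simp [hτ₀]
  have g5 : τ₀.v Ry = L := by simp [hτ₀, vL]
  clear_value τ₀
  refine Wp.seq (Wp.mono (fillTab_spec (C := C) (L := L) (R := R) (b := b) (g := g)
    hBW hB hinc (by omega) (by omega) (by omega)
    (by rw [ha0]; exact hsmp) (by rw [hv0 _ (by norm_num), vg]) (by rw [hv0 _ (by norm_num), vb])
    (by rw [hv0 _ (by norm_num), vL]) g1 g2 g3 g4 g5) ?_)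
  rintro τ₁ n₁ ⟨h1, h2, h3, h4, h5⟩
  have hv1 : ∀ x < 46, τ₁.v x = st.v x := fun x hx => by rw [h2 x (by omega), hv0 x hx]
  refine Wp.seq (Wp.asg (by norm_num) (by simp) ?_)
  set τ₂ := HS.set _ Ry _ with hτ₂
  have hv2 : ∀ x < 49, τ₂.v x = τ₁.v x := fun x hx => by
    rw [hτ₂, HS.set_v, if_neg (by omega)]
  have ha2 : τ₂.a = τ₁.a := rfl
  have g6 : τ₂.v Ry = L := by simp [hτ₂, hv1, vL]
  clear_value τ₂
  refine Wp.seq (Wp.mono (fillSeg_spec (C := C) (L := L) (R := R) (b := b) (g := g) (d := d)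
    hBW hB hinc hLM hnode hb hbC
    (by rw [ha2, h3 0 (by norm_num), ha0]; exact hsmp)
    (by rw [hv2 _ (by norm_num), hv1 _ (by norm_num), vg])
    (by rw [hv2 _ (by norm_num), hv1 _ (by norm_num), vM])
    (by rw [hv2 _ (by norm_num), hv1 _ (by norm_num), vb])
    (by rw [hv2 _ (by norm_num), hv1 _ (by norm_num), vL])
    (by rw [hv2 _ (by norm_num), h2 _ (by norm_num), g1])
    (by rw [hv2 _ (by norm_num), h2 _ (by norm_num), g2])
    (by rw [hv2 _ (by norm_num), h2 _ (by norm_num), g3]) g6 (by rw [ha2]; exact h5)) ?_)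
  rintro τ₃ n₃ ⟨k1, k2, k3, k4, k5⟩
  refine Wp.asg (by norm_num) (by simp) ⟨by omega, ?_, ?_, ?_, ?_, ?_, ?_⟩
  · intro x hx
    rw [HS.set_v, if_neg (by omega), k2 x (by omega), hv2 x (by omega), hv1 x (by omega)]
  · simp [k2, hv2, h2, g1]
  · intro f hf hf'
    rw [HS.set_a, k3 f hf', ha2, h3 f hf, ha0]
  · intro i hi
    rw [HS.set_a, k3 3 (by norm_num), ha2, h4 i hi, ha0]
  · intro i hi
    rw [HS.set_a, k4 i hi, ha2, h3 4 (by norm_num), ha0]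
  · intro y hy hy'
    refine ⟨?_, k5 y hy hy'⟩
    have hn : node κ M d y = (L, R) := by
      rw [← hnode]; exact node_eq hinc hLM d y (by rw [hnode]; exact hy) (by rw [hnode]; exact hy')
    rw [TabOK, hn, HS.set_a, k3 3 (by norm_num), ha2, ← hb]
    exact h5

end Fill

/-! ### Global rebuilding -/

/-- Zero the cells beyond the new capacity, and start a new epoch. -/
def trim : Stm :=
  Rx ≔ V Rcount + V Rcount ;; Rx ≔ V Rx + V Rx ;; Rj ≔ V Rx + 2 + 2 ;;
  .loop (.lt (V Rj) (V Rcap + 2 + 2))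
    (.sto 0 (V Rj) 0 ;; .sto 1 (V Rj) 0 ;; .sto 2 (V Rj) 0 ;; .sto 3 (V Rj) 0 ;;
      .sto 4 (V Rj) 0 ;; .sto 5 (V Rj) 0 ;; .sto 6 (V Rj) 0 ;; .sto 7 (V Rj) 0 ;;
      Rj ≔ V Rj + 1) ;;
  Rcap ≔ V Rx ;; Rleft ≔ V Rcount / 2

/-- Global rebuilding. -/
def rebuild : Stm := collect ;; layout ;; chooseGap ;; fillTables ;; trim

/-- The end of an update. -/
def finish : Stm := .ite (.lt 0 (V Rleft)) (Rleft ≔ V Rleft - 1) rebuild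

/-- The insertion program. -/
def insertStm : Stm := Rk ≔ V 0 ;; find ;; store ;; finish

/-- The deletion program. -/
def deleteStm : Stm := Rk ≔ V 0 ;; find ;; remove ;; finish

section Fill

variable {W B C : ℕ} {m g M u : ℕ} {D : ℕ → ℕ} {S : Multiset ℕ}

/-- All tables at depths below `d`, and all ends of nodes at depths up to `d`, are correct. -/
def LevelsOK (κ : ℕ → ℕ) (M : ℕ) (τ : HS) (d : ℕ) : Prop :=
  (∀ e < d, ∀ y < M, TabOK κ M (τ.a 3) e y) ∧ ∀ e ≤ d, ∀ y < M, SegOK κ M (τ.a 4) e y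

lemma TabOK.congr {κ : ℕ → ℕ} {a a' : ℕ → ℕ} {d y : ℕ} (hinc : IncrOn κ M) (hy : y < M)
    (h : TabOK κ M a d y)
    (hh : ∀ x, (node κ M d y).1 ≤ x → x < (node κ M d y).2 → a' (d * M + x) = a (d * M + x)) :
    TabOK κ M a' d y := by
  intro j hj
  have := node_mem hinc hy d
  rw [hh _ (by omega) (by omega)]
  exact h j hj

lemma SegOK.congr {κ : ℕ → ℕ} {a a' : ℕ → ℕ} {d y : ℕ} (h : SegOK κ M a d y)
    (hh : a' (d * M + (node κ M d y).1) = a (d * M + (node κ M d y).1)) :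
    SegOK κ M a' d y := by
  rw [SegOK, hh]; exact h

/-- One level of the tables. -/
lemma fillLevel_spec (hBW : B ≤ W) (hB : 8 * C ≤ B) {st : HS} {κ : ℕ → ℕ} (hinc : IncrOn κ M)
    {d : ℕ} (hd : (d + 1) * M + M ≤ C) (hsmp : ∀ x < M, st.a 0 (1 + x * g) = κ x ∧ 1 + x * g < C)
    (hκW : ∀ x < M, κ x < W) (vg : st.v Rgap = g) (vM : st.v Rsamp = M) (vb : st.v Rb = d * M)
    (vn : st.v Rnode = 0) (hok : LevelsOK κ M st d) :
    Wp W B (.loop (.lt (V Rnode) (V Rsamp)) fillNode) st fun τ c => c ≤ 21 * M + 1 ∧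
      (∀ x < 45, τ.v x = st.v x) ∧ (∀ f ≠ 3, f ≠ 4 → τ.a f = st.a f) ∧
      (∀ f, ∀ i ≥ C, τ.a f i = st.a f i) ∧ LevelsOK κ M τ (d + 1) := by
  have hbM : (d + 1) * M = d * M + M := by rw [add_mul, one_mul]
  have hle : ∀ e ≤ d, ∀ x < M, e * M + x < (d + 1) * M := fun e he x hx => by
    have := Nat.mul_le_mul_right M he; omega
  refine Wp.mono (Wp.loop (W := W) (B := B)
    (fun n τ => n = 21 * (M - τ.v Rnode) ∧ (∀ x < 45, τ.v x = st.v x) ∧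
      (∀ f ≠ 3, f ≠ 4 → τ.a f = st.a f) ∧ (∀ f, ∀ i ≥ C, τ.a f i = st.a f i) ∧
      τ.v Rnode ≤ M ∧ (τ.v Rnode < M → (node κ M d (τ.v Rnode)).1 = τ.v Rnode) ∧
      LevelsOK κ M τ d ∧ ∀ y < τ.v Rnode, TabOK κ M (τ.a 3) d y ∧ SegOK κ M (τ.a 4) (d + 1) y)
    (fun τ => (∀ x < 45, τ.v x = st.v x) ∧ (∀ f ≠ 3, f ≠ 4 → τ.a f = st.a f) ∧
      (∀ f, ∀ i ≥ C, τ.a f i = st.a f i) ∧ LevelsOK κ M τ (d + 1))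
    ?_ ?_ ?_ (21 * M) st ⟨?_, ?_, ?_, ?_, ?_, ?_, ?_, ?_⟩) ?_
  · rintro n τ -; simp
  · rintro n τ ⟨hn, hv, ha, hC, h1, h2, h3, h4⟩ h0
    have v1 := hv Rsamp (by norm_num)
    simp [v1, vM] at h0
    refine ⟨hv, ha, hC, fun e he y hy => ?_, fun e he y hy => ?_⟩
    · rcases Nat.lt_succ_iff_lt_or_eq.1 he with h | rfl
      · exact h3.1 e h y hy
      · exact (h4 y (by omega)).1
    · rcases Nat.le_succ_iff.1 he with h | rfl
      · exact h3.2 e h y hy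
      · exact (h4 y (by omega)).2
  · rintro n τ ⟨hn, hv, ha, hC, h1, h2, h3, h4⟩ h0
    have v1 := hv Rsamp (by norm_num)
    simp [v1, vM] at h0
    obtain ⟨L, hL⟩ : ∃ L, τ.v Rnode = L := ⟨_, rfl⟩
    rw [hL] at h0 h1 h2 h4 hn
    obtain ⟨R, hR⟩ : ∃ R, (node κ M d L).2 = R := ⟨_, rfl⟩
    have hnode : node κ M d L = (L, R) := Prod.ext (h2 h0) hR
    have hmem := node_mem hinc h0 d
    rw [hnode] at hmem
    simp only at hmem
    have hseg := h3.2 d le_rfl L h0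
    rw [SegOK, hnode] at hseg
    refine Wp.mono (fillNode_spec (C := C) (L := L) (R := R) (g := g) (d := d)
      hBW hB hinc h0 hnode rfl
      (by omega) (by rw [ha 0 (by norm_num) (by norm_num)]; exact hsmp) hκW
      (by rw [hv _ (by norm_num), vg]) (by rw [hv _ (by norm_num), vM])
      (by rw [hv _ (by norm_num), vb]) hL hseg) ?_
    rintro τ₁ n₁ ⟨k1, k2, k3, k4, k5, k6, k7⟩
    have hmemy : ∀ e, ∀ y < M, (node κ M e y).1 ≤ y ∧ (node κ M e y).2 ≤ M ∧
        y < (node κ M e y).2 := fun e y hy => by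
      have := node_mem hinc hy e; omega
    refine ⟨_, ⟨rfl, ?_, ?_, ?_, ?_, ?_, ⟨?_, ?_⟩, ?_⟩, ?_⟩
    · intro x hx; rw [k2 x hx, hv x hx]
    · intro f hf hf'; rw [k4 f hf hf', ha f hf hf']
    · intro f i hi
      rw [← hC f i hi]
      by_cases hf : f = 3
      · subst hf; exact k5 i (by omega)
      by_cases hf' : f = 4
      · subst hf'; exact k6 i (by omega)
      rw [k4 f hf hf']
    · omega
    · intro h
      rw [k3] at h ⊢
      have := node_next hinc h0 d (by rw [hR]; exact h)
      rwa [hR] at this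
    · intro e he y hy
      refine (h3.1 e he y hy).congr hinc hy fun x hx hx' => k5 _ (Or.inl ?_)
      have := Nat.mul_le_mul_right M (show e + 1 ≤ d by omega)
      have := hmemy e y hy
      rw [add_mul, one_mul] at *
      omega
    · intro e he y hy
      refine (h3.2 e he y hy).congr (k6 _ (Or.inl ?_))
      have := hle e he (node κ M e y).1 (by have := hmemy e y hy; omega)
      omega
    · intro y hy
      rw [k3] at hy
      by_cases hyL : y < L
      · have h5 := h4 y hyL
        have h6 := hmemy (d + 1) y (by omega)
        refine ⟨h5.1.congr hinc (by omega) fun x hx hx' => k5 _ (Or.inl ?_),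
          h5.2.congr (k6 _ (Or.inl ?_))⟩
        · by_contra hc
          have h7 := node_eq hinc (show y < M by omega) d L (by
            have := hmemy d y (by omega); omega) (by omega)
          rw [hnode] at h7
          have h8 := hmemy d y (by omega)
          rw [← h7] at h8
          simp only at h8
          omega
        · omega
      · exact k7 y (by omega) hy
    · omega
  · rw [vn]; rfl
  · intro x _; rfl
  · intro f _ _; rfl
  · intro f i _; rfl
  · omega
  · rw [vn]
    intro h0
    have := node_mem hinc h0 d
    omega
  · exact hok
  · rw [vn]; intro y hy; omega
  · rintro τ n ⟨h1, h2⟩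
    exact ⟨by omega, h1⟩

/-- All tables are computed in time linear in their total size. -/
theorem fillTables_spec (hBW : B ≤ W) (hB : 8 * C ≤ B) {st : HS} {κ : ℕ → ℕ} (hinc : IncrOn κ M)
    (hC0 : 0 < C) (hgC : g < C) (hsize : (g + 1) * M ≤ C)
    (hsmp : ∀ x < M, st.a 0 (1 + x * g) = κ x ∧ 1 + x * g < C)
    (hκW : ∀ x < M, κ x < W) (vg : st.v Rgap = g) (vM : st.v Rsamp = M) :
    Wp W B fillTables st fun τ c => c ≤ 21 * C + 5 * g + 4 ∧
      (∀ x < 42, τ.v x = st.v x) ∧ (∀ f ≠ 3, f ≠ 4 → τ.a f = st.a f) ∧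
      (∀ f, ∀ i ≥ C, τ.a f i = st.a f i) ∧ LevelsOK κ M τ g := by
  have hMC : M ≤ C := le_trans (Nat.le_mul_of_pos_left _ (by omega)) hsize
  have hgM : (g + 1) * M = g * M + M := by rw [add_mul, one_mul]
  unfold fillTables
  refine Wp.seq (Wp.sto (by simp; omega) (by simp) (by norm_num) (by simp; omega) ?_)
  refine Wp.seq (Wp.asg (by norm_num) (by simp; omega) ?_)
  refine Wp.seq (Wp.asg (by norm_num) (by simp; omega) ?_)
  set τ₀ := HS.set _ Rl _ with hτ₀
  have hv0 : ∀ x < 42, τ₀.v x = st.v x := fun x hx => by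
    rw [hτ₀, HS.set_v, if_neg (by omega), HS.set_v, if_neg (by omega)]; rfl
  have ha0 : ∀ f ≠ 3, f ≠ 4 → τ₀.a f = st.a f := fun f hf hf' => by
    funext i; simp [hτ₀, hf']
  have hC0' : ∀ f, ∀ i ≥ C, τ₀.a f i = st.a f i := fun f i hi => by
    simp [hτ₀, (show i ≠ 0 by omega)]
  have h40 : τ₀.a 4 0 = M := by simp [hτ₀, vM]
  have hl0 : τ₀.v Rl = 0 := by simp [hτ₀]
  have hb0 : τ₀.v Rb = 0 := by simp [hτ₀]
  clear_value τ₀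
  refine Wp.mono (Wp.loop (W := W) (B := B)
    (fun n τ => ∃ d, n = (21 * M + 5) * (g - d) ∧ τ.v Rl = d ∧ τ.v Rb = d * M ∧ d ≤ g ∧
      (∀ x < 42, τ.v x = st.v x) ∧ (∀ f ≠ 3, f ≠ 4 → τ.a f = st.a f) ∧
      (∀ f, ∀ i ≥ C, τ.a f i = st.a f i) ∧ LevelsOK κ M τ d)
    (fun τ => (∀ x < 42, τ.v x = st.v x) ∧ (∀ f ≠ 3, f ≠ 4 → τ.a f = st.a f) ∧
      (∀ f, ∀ i ≥ C, τ.a f i = st.a f i) ∧ LevelsOK κ M τ g)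
    ?_ ?_ ?_ ((21 * M + 5) * g) τ₀ ⟨0, ?_, ?_, ?_, ?_, ?_, ?_, ?_, ?_, ?_⟩) ?_
  · rintro n τ -; simp
  · rintro n τ ⟨d, hn, hl, hb, hd, hv, ha, hC, hok⟩ h0
    have v1 := hv Rgap (by norm_num)
    simp [v1, vg, hl] at h0
    have : d = g := by omega
    subst this
    exact ⟨hv, ha, hC, hok⟩
  · rintro n τ ⟨d, hn, hl, hb, hd, hv, ha, hC, hok⟩ h0
    have v1 := hv Rgap (by norm_num)
    have v2 := hv Rsamp (by norm_num)
    simp [v1, vg, hl] at h0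
    have hdM := Nat.mul_le_mul_right M (show d + 1 ≤ g by omega)
    have hdM' : (d + 1) * M = d * M + M := by rw [add_mul, one_mul]
    refine Wp.seq (Wp.asg (by norm_num) (by simp; omega) ?_)
    refine Wp.seq (Wp.mono (fillLevel_spec (C := C) (g := g) (d := d) hBW hB hinc
      (by omega) ?_ hκW ?_ ?_ ?_ ?_ hok) ?_)
    · rw [HS.set_a, ha 0 (by norm_num) (by norm_num)]; exact hsmp
    · simp [v1, vg]
    · simp [v2, vM]
    · simp [hb]
    · simp
    rintro τ₁ n₁ ⟨k1, k2, k3, k4, k5⟩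
    have w1 := k2 Rb (by norm_num)
    have w2 := k2 Rsamp (by norm_num)
    have w3 := k2 Rl (by norm_num)
    simp [hb, v2, vM, hl] at w1 w2 w3
    refine Wp.seq (Wp.asg (by norm_num) (by simp [w1, w2]; omega) ?_)
    refine Wp.asg (by norm_num) (by simp [w3]; omega)
      ⟨_, ⟨d + 1, rfl, ?_, ?_, by omega, ?_, ?_, ?_, k5⟩, ?_⟩
    · simp [w3]
    · simp [w1, w2, hdM']
    · intro x hx
      rw [HS.set_v, if_neg (by omega), HS.set_v, if_neg (by omega), k2 x (by omega), HS.set_v,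
        if_neg (by omega), hv x hx]
    · intro f hf hf'; exact (k3 f hf hf').trans (ha f hf hf')
    · intro f i hi; exact (k4 f i hi).trans (hC f i hi)
    · rw [hn, show g - d = g - (d + 1) + 1 by omega, mul_add, mul_one]
      omega
  · simp
  · exact hl0
  · simpa using hb0
  · omega
  · exact hv0
  · exact ha0
  · exact hC0'
  · intro e he; omega
  · intro e he y hy
    obtain rfl : e = 0 := by omega
    simpa [SegOK, node] using h40
  · rintro τ n ⟨h1, h2⟩
    refine ⟨?_, h1⟩
    have : (21 * M + 5) * g = 21 * (g * M) + 5 * g := by ring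
    omega

/-- The cells between the new and the old capacity become zero. -/
theorem trim_spec (hBW : B ≤ W) (hB : 8 * C ≤ B) {st : HS} {n N : ℕ} (vn : st.v Rcount = n)
    (vc : st.v Rcap = 4 * N) (hn : 4 * n + 4 ≤ C) (hN : 4 * N + 4 ≤ C) :
    Wp W B trim st fun τ c => c ≤ 10 * C + 6 ∧ (∀ x < 42, x ≠ Rcap → x ≠ Rleft → τ.v x = st.v x) ∧
      τ.v Rcap = 4 * n ∧ τ.v Rleft = n / 2 ∧
      (∀ f, ∀ i < 4 * n + 4, τ.a f i = st.a f i) ∧ (∀ f, ∀ i ≥ 4 * N + 4, τ.a f i = st.a f i) ∧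
      (∀ f < 8, ∀ i, 4 * n + 4 ≤ i → i < 4 * N + 4 → τ.a f i = 0) := by
  unfold trim
  refine Wp.seq (Wp.asg (by norm_num) (by simp [vn]; omega) ?_)
  refine Wp.seq (Wp.asg (by norm_num) (by simp [vn]; omega) ?_)
  refine Wp.seq (Wp.asg (by norm_num) (by simp [vn]; omega) ?_)
  set τ₀ := HS.set _ Rj _ with hτ₀
  have hv0 : ∀ x < 42, τ₀.v x = st.v x := fun x hx => by
    rw [hτ₀, HS.set_v, if_neg (by omega), HS.set_v, if_neg (by omega), HS.set_v, if_neg (by omega)]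
  have g1 : τ₀.v Rj = 4 * n + 4 := by simp [hτ₀, vn]; omega
  have g2 : τ₀.v Rx = 4 * n := by simp [hτ₀, vn]; omega
  have ha0 : τ₀.a = st.a := rfl
  clear_value τ₀
  refine Wp.seq (Wp.mono (Wp.loop (W := W) (B := B)
    (fun c τ => c = 10 * (4 * N + 4 - τ.v Rj) ∧ (∀ x < 42, τ.v x = st.v x) ∧ τ.v Rx = 4 * n ∧
      4 * n + 4 ≤ τ.v Rj ∧ (∀ f, ∀ i < 4 * n + 4, τ.a f i = st.a f i) ∧
      (∀ f, ∀ i ≥ 4 * N + 4, τ.a f i = st.a f i) ∧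
      (∀ f < 8, ∀ i, 4 * n + 4 ≤ i → i < τ.v Rj → i < 4 * N + 4 → τ.a f i = 0))
    (fun τ => (∀ x < 42, τ.v x = st.v x) ∧ τ.v Rx = 4 * n ∧
      (∀ f, ∀ i < 4 * n + 4, τ.a f i = st.a f i) ∧ (∀ f, ∀ i ≥ 4 * N + 4, τ.a f i = st.a f i) ∧
      (∀ f < 8, ∀ i, 4 * n + 4 ≤ i → i < 4 * N + 4 → τ.a f i = 0))
    ?_ ?_ ?_ (10 * (4 * N + 4 - (4 * n + 4))) τ₀ ⟨?_, ?_, ?_, ?_, ?_, ?_, ?_⟩) ?_)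
  · rintro c τ ⟨hc, hv, hx, h1, h2, h3, h4⟩
    have v1 := hv Rcap (by norm_num)
    simp [v1, vc]; omega
  · rintro c τ ⟨hc, hv, hx, h1, h2, h3, h4⟩ h0
    have v1 := hv Rcap (by norm_num)
    simp [v1, vc] at h0
    exact ⟨hv, hx, h2, h3, fun f hf i hi hi' => h4 f hf i hi (by omega) hi'⟩
  · rintro c τ ⟨hc, hv, hx, h1, h2, h3, h4⟩ h0
    have v1 := hv Rcap (by norm_num)
    simp [v1, vc] at h0
    have step : ∀ (f : ℕ) (σ : HS) (rest : Stm) (Q : HS → ℕ → Prop), f < 8 → σ.v = τ.v →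
        Wp W B rest (σ.put f (τ.v Rj) 0) (fun t m => Q t (1 + m)) →
        Wp W B (.sto f (V Rj) 0 ;; rest) σ Q := fun f σ rest Q hf hσ h => by
      refine Wp.seq (Wp.sto (by simp) (by simp; omega) hf (by simp [hσ]; omega) ?_)
      simpa [hσ] using h
    refine step 0 _ _ _ (by norm_num) rfl ?_
    refine step 1 _ _ _ (by norm_num) rfl ?_
    refine step 2 _ _ _ (by norm_num) rfl ?_
    refine step 3 _ _ _ (by norm_num) rfl ?_
    refine step 4 _ _ _ (by norm_num) rfl ?_
    refine step 5 _ _ _ (by norm_num) rfl ?_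
    refine step 6 _ _ _ (by norm_num) rfl ?_
    refine step 7 _ _ _ (by norm_num) rfl ?_
    refine Wp.asg (by norm_num) (by simp; omega) ?_
    set τ₁ := HS.set _ Rj _ with hτ
    have e1 : τ₁.v Rj = τ.v Rj + 1 := by simp [hτ]
    have e2 : ∀ f, ∀ i ≠ τ.v Rj, τ₁.a f i = τ.a f i := fun f i hi => by simp [hτ, hi]
    have e3 : ∀ f < 8, τ₁.a f (τ.v Rj) = 0 := fun f hf => by interval_cases f <;> simp [hτ]
    refine ⟨_, ⟨rfl, ?_, ?_, ?_, ?_, ?_, ?_⟩, ?_⟩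
    · intro x hx
      rw [← hv x hx, hτ, HS.set_v, if_neg (by omega)]; rfl
    · simpa [hτ] using hx
    · omega
    · intro f i hi; rw [e2 f i (by omega), h2 f i hi]
    · intro f i hi; rw [e2 f i (by omega), h3 f i hi]
    · intro f hf i hi hi' hi2
      by_cases h : i = τ.v Rj
      · rw [h, e3 f hf]
      · rw [e2 f i h, h4 f hf i hi (by omega) hi2]
    · omega
  · rw [g1]
  · exact hv0
  · exact g2
  · omega
  · intro f i _; rw [ha0]
  · intro f i _; rw [ha0]
  · intro f _ i h1 h2; omega
  rintro τ c ⟨⟨hv, hx, h2, h3, h4⟩, hc⟩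
  have v1 := hv Rcount (by norm_num)
  refine Wp.seq (Wp.asg (by norm_num) (by simp) ?_)
  refine Wp.asg (by norm_num) (by simp; omega) ⟨by omega, ?_, ?_, ?_, h2, h3, h4⟩
  · intro x hx h1 h2
    rw [HS.set_v, if_neg h2, HS.set_v, if_neg h1, hv x hx]
  · simp [hx]
  · simp [v1, vn]

/-- The represented multiset depends on the first three arrays only. -/
lemma Holds.congr {a a' : ℕ → ℕ → ℕ} (hH : Holds W a u S)
    (h : ∀ f ≤ 2, ∀ i ≤ u, a' f i = a f i) : Holds W a' u S := by
  have h0 := h 0 (by norm_num)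
  have h1 := h 1 (by norm_num)
  have h2 := h 2 (by norm_num)
  refine ⟨⟨by rw [h0 0 (by omega), hH.zero], fun i hi j hj => ?_, fun i hi => ?_, fun j hj => ?_,
    fun i hi h0' => ?_, fun i hi h0' j hj => ?_⟩, fun i hi => ?_, fun i hi => ?_, fun x hx => ?_⟩
  · rw [h0 i hi, h0 j hj]; exact hH.inj i hi j hj
  · rw [h2 i hi]; exact hH.prv_le i hi
  · rw [h2 0 (by omega), h0 j hj, h0 _ (hH.prv_le 0 (by omega))]; exact hH.prv_zero j hj
  · rw [h2 i hi, h0 i hi, h0 _ (hH.prv_le i hi)]; exact hH.prv_lt i hi h0'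
  · rw [h2 i hi, h0 i hi, h0 j hj, h0 _ (hH.prv_le i hi)]; exact hH.prv_gap i hi h0' j hj
  · rw [h0 i hi]; exact hH.lt i hi
  · rw [h1 i hi, h0 i hi]; exact hH.cnt i hi
  · obtain ⟨i, hi, hx⟩ := hH.cover x hx
    exact ⟨i, hi, by rw [h0 i hi, hx]⟩

/-- Rebuilding a structure that holds `S` and was built with capacity for `N` elements. -/
theorem rebuild_spec (hBW : B ≤ W) {st : HS} {N : ℕ} (hH : Holds W st.a u S)
    (vn : st.v Rcount = S.card) (vc : st.v Rcap = 4 * N) (hu : u + 1 < 4 * N + 4)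
    (hBn : 8 * (4 * S.card + 4) ≤ B) (hBN : 8 * (4 * N + 4) ≤ B)
    (hz : ∀ f < 8, ∀ i ≥ 4 * N + 4, st.a f i = 0) :
    Wp W B rebuild st fun τ c => c ≤ 400 * (S.card + N + 2) ∧ ∃ m g M D, Static W τ.a m g M D ∧
      τ.v Rstat = m ∧ τ.v Rgap = g ∧ τ.v Rsamp = M ∧ τ.v Rused = m ∧ Holds W τ.a m S ∧
      (∀ x > 0, x ∈ S ↔ ∃ i < m, D i = x) ∧ m ≤ S.card ∧ τ.v Rcount = S.card ∧
      τ.v Rleft = S.card / 2 ∧ τ.v Rcap = 4 * S.card ∧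
      ∀ f < 8, ∀ i ≥ 4 * S.card + 4, τ.a f i = 0 := by
  obtain ⟨C, hC⟩ : ∃ C, C = max (4 * S.card + 4) (4 * N + 4) := ⟨_, rfl⟩
  have hB : 8 * C ≤ B := by omega
  have hn : 4 * S.card + 4 ≤ C := by omega
  have hN : 4 * N + 4 ≤ C := by omega
  unfold rebuild
  refine Wp.seq (Wp.mono (collect_spec (C := C) hBW hB hH (by omega)) ?_)
  rintro τ₁ n₁ ⟨h1, h2, h3, h4, h5, h6⟩
  have hSW : ∀ x ∈ S, x < W := fun x hx => by
    obtain ⟨i, hi, rfl⟩ := hH.cover x hx; exact hH.lt i hi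
  refine Wp.seq (Wp.mono (layout_spec (C := C) hBW hB (by omega) h6 hSW
    (by rw [h3 0 (by norm_num), hH.zero])
    (by rw [h3 1 (by norm_num), hH.cnt 0 (by omega), hH.zero])) ?_)
  rintro τ₂ n₂ ⟨i1, i2, i3, i4, i5, i6, D, i7, i8, i9, i10, i11⟩
  have i2' := i2 Rstat (by norm_num) (by norm_num)
  obtain ⟨m, hm⟩ : ∃ m, τ₁.v Rstat = m := ⟨_, rfl⟩
  rw [hm] at h5 h6 i1 i2' i3 i6 i7 i8 i9 i10 i11
  have hmS : m ≤ S.card := by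
    have : (Finset.range m).image D ⊆ S.toFinset := fun x hx => by
      obtain ⟨i, hi, rfl⟩ := Finset.mem_image.1 hx
      rw [Finset.mem_range] at hi
      exact Multiset.mem_toFinset.2 ((i11 _ (i8 i hi)).2 ⟨i, hi, rfl⟩)
    have := Finset.card_le_card this
    rw [Finset.card_image_of_injOn, Finset.card_range] at this
    · exact this.trans (Multiset.toFinset_card_le S)
    · intro i hi j hj hij
      simp only [Finset.coe_range, Set.mem_Iio] at hi hj
      rcases lt_trichotomy i j with h | h | h
      · have := i7 i j h hj; omega
      · exact h
      · have := i7 j i h hi; omega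
  refine Wp.seq (Wp.mono (chooseGap_spec (C := C) hBW hB (by omega)) ?_)
  rintro τ₃ n₃ ⟨j1, j2, j3, j4, j5, j6, j7⟩
  have j3' := j3 Rstat (by norm_num) (by norm_num) (by norm_num)
  obtain ⟨g, hg⟩ : ∃ g, τ₃.v Rgap = g := ⟨_, rfl⟩
  obtain ⟨M, hM⟩ : ∃ M, τ₃.v Rsamp = M := ⟨_, rfl⟩
  rw [i2'] at j1 j5 j6 j7 j3'
  rw [hg] at j4 j5 j6 j7
  rw [hM] at j7
  have hlm := Nat.log_le_self 2 m
  have hsize : (g + 1) * M ≤ 4 * m := by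
    rcases Nat.eq_zero_or_pos m with h0 | h0
    · have : M = 0 := by rw [j7]; exact Nat.div_eq_of_lt (by omega)
      simp [this]
    · exact size_bound h0 j4 j5 j7
  have hsm : ∀ y < M, y * g < m := fun y hy => by
    rw [j7, Nat.lt_iff_add_one_le, Nat.le_div_iff_mul_le j4, add_mul] at hy
    omega
  set κ := fun y => D (y * g) with hκ
  have hinc : IncrOn κ M := fun a b hab hb => i7 _ _ (Nat.mul_lt_mul_of_pos_right hab j4) (hsm b hb)
  refine Wp.seq (Wp.mono (fillTables_spec (C := C) (g := g) hBW hB hinc (by omega) (by omega)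
    (by omega) (fun x hx => ⟨by rw [j2, add_comm, i10 _ (hsm x hx)], by
      have := hsm x hx; omega⟩) (fun x hx => i9 _ (hsm x hx)) hg hM) ?_)
  rintro τ₄ n₄ ⟨k1, k2, k3, k4, k5, k6⟩
  have hv : ∀ x < 42, x ≠ Rstat → x ≠ Rused → x ≠ Rgap → x ≠ Rsamp → τ₄.v x = st.v x :=
    fun x hx e1 e2 e3 e4 => by rw [k2 x hx, j3 x hx e3 e4, i2 x hx e2, h2 x hx e1]
  refine Wp.mono (trim_spec (C := C) (n := S.card) (N := N) hBW hB
    (by rw [hv _ (by norm_num) (by norm_num) (by norm_num) (by norm_num) (by norm_num), vn])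
    (by rw [hv _ (by norm_num) (by norm_num) (by norm_num) (by norm_num) (by norm_num), vc])
    hn hN) ?_
  rintro τ₅ n₅ ⟨l1, l2, l3, l4, l5, l6, l7⟩
  have key : ∀ i < m, τ₅.a 0 (i + 1) = D i := fun i hi => by
    rw [l5 _ _ (by omega), k3 0 (by norm_num) (by norm_num), j2, i10 i hi]
  have low : ∀ f ≤ 2, ∀ i ≤ m, τ₅.a f i = τ₂.a f i := fun f hf i hi => by
    rw [l5 _ _ (by omega), k3 f (by omega) (by omega), j2]
  have hlev : ∀ d ≤ g, ∀ x < M, d * M + x < 4 * S.card + 4 := fun d hd x hx => by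
    have := Nat.mul_le_mul_right M hd
    rw [add_mul, one_mul] at hsize
    omega
  refine ⟨?_, m, g, M, D, ⟨i7, i8, i9, key, fun _ => j4, j5, fun _ => j6, fun _ => j7,
    fun _ => hsize, ?_, ?_⟩, ?_, ?_, ?_, ?_, ?_, i11, hmS, ?_, l4, l3, ?_⟩
  · omega
  · intro _ d hd y hy j hj
    have := node_mem (κ := fun y => D (y * g)) hinc hy d
    rw [l5 _ _ (hlev d hd.le _ (by omega))]
    exact k5 d hd y hy j hj
  · intro _ d hd y hy
    have := node_mem (κ := fun y => D (y * g)) hinc hy d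
    rw [l5 _ _ (hlev d hd _ (by omega))]
    exact k6 d hd y hy
  · rw [l2 _ (by norm_num) (by norm_num) (by norm_num), k2 _ (by norm_num), j3']
  · rw [l2 _ (by norm_num) (by norm_num) (by norm_num), k2 _ (by norm_num), hg]
  · rw [l2 _ (by norm_num) (by norm_num) (by norm_num), k2 _ (by norm_num), hM]
  · rw [l2 _ (by norm_num) (by norm_num) (by norm_num), k2 _ (by norm_num),
      j3 _ (by norm_num) (by norm_num) (by norm_num), i3]
  · exact i6.congr low
  · rw [l2 _ (by norm_num) (by norm_num) (by norm_num),
      hv _ (by norm_num) (by norm_num) (by norm_num) (by norm_num) (by norm_num), vn]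
  · intro f hf i hi
    by_cases h : i < 4 * N + 4
    · exact l7 f hf i hi h
    · have hi' : C ≤ i := by omega
      rw [l6 f i (by omega), k4 f i hi', j2, i5 f i hi', h4 f i hi', hz f hf i (by omega)]

end Fill

/-! ### The invariant -/

/-- The tables for a search may have been built for the key set of `S` from these data. -/
structure Layout (S : Multiset ℕ) (m g M : ℕ) (D : ℕ → ℕ) : Prop where
  m_pos : 0 < m
  incr : IncrOn D m
  pos : ∀ i < m, 0 < D i
  mem : ∀ x > 0, x ∈ S ↔ ∃ i < m, D i = x
  m_le : m ≤ S.card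
  g_pos : 1 ≤ g
  g_le : g ≤ Nat.log 2 m + 2
  m_lt : m < 2 ^ (g - 1)
  M_eq : M = (m + g - 1) / g

/-- The least number of iterations that suffices for every search among the samples of `S`. -/
noncomputable def searchDepth (S : Multiset ℕ) : ℕ :=
  sInf {t | ∀ m g M D, Layout S m g M D → SearchBound (fun y => D (y * g)) M t}

/-- The abstract state of the data structure. -/
structure Epoch where
  /-- the keys stored at the start of the epoch -/
  base : Multiset ℕ
  /-- the keys of the nodes; a node stays to the end of the epoch, even without elements -/
  keys : Finset ℕ
  /-- the number of updates to come before the one that ends the epoch -/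
  left : ℕ
  /-- the keys stored now -/
  now : Multiset ℕ

/-- The end of an update: the epoch goes on, or a new epoch starts. -/
def Epoch.tick (A : Epoch) : Epoch :=
  if A.left = 0 then ⟨A.now, insert 0 A.now.toFinset, A.now.card / 2, A.now⟩
  else { A with left := A.left - 1 }

/-- The effect of a request. -/
def Epoch.step {w : ℕ} (A : Epoch) : Request w → Epoch
  | .insert k => Epoch.tick
      { A with keys := insert k.toNat A.keys, now := k.toNat ::ₘ A.now }
  | .delete k => Epoch.tick { A with now := A.now.erase k.toNat }
  | .pred _ => A

/-- The key that is searched for when a request is served. -/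
def Request.target {w : ℕ} : Request w → ℕ
  | .insert k => k.toNat
  | .delete k => k.toNat
  | .pred q => q.toNat - 1

/-- The keys that are stored now and were stored at the start of the epoch. -/
def Epoch.stable (A : Epoch) : Finset ℕ := A.base.toFinset ∩ A.now.toFinset

/-- The cost of a search, up to a constant factor. -/
noncomputable def Epoch.cost (A : Epoch) (k : ℕ) : ℕ :=
  1 + searchDepth A.base + Nat.log 2 (Nat.log 2 A.base.card + 2) +
    (above A.keys A.stable k).card + (below A.keys A.stable k).card

/-- The state `st` represents `A`; between the parts of an update, `e = 1`. -/
structure Inv (W : ℕ) (st : HS) (A : Epoch) (e m g M u : ℕ) (D : ℕ → ℕ) : Prop where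
  static : Static W st.a m g M D
  holds : Holds W st.a u A.now
  mem_base : ∀ x > 0, x ∈ A.base ↔ ∃ i < m, D i = x
  stat_le : m ≤ u
  m_le : m ≤ A.base.card
  keys : nodeKeys st.a u ⊆ A.keys
  used_le : u + A.left ≤ m + A.base.card / 2 + e
  left_le : A.left ≤ A.base.card / 2
  now_le : A.now.card + A.left ≤ A.base.card + A.base.card / 2 + e
  le_now : A.base.card + A.left ≤ A.now.card + A.base.card / 2 + e
  vcount : st.v Rcount = A.now.card
  vstat : st.v Rstat = m
  vused : st.v Rused = u
  vleft : st.v Rleft = A.left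
  vgap : st.v Rgap = g
  vsamp : st.v Rsamp = M
  vcap : st.v Rcap = 4 * A.base.card
  zero : ∀ f < 8, ∀ i ≥ 4 * A.base.card + 4, st.a f i = 0

section Invariant

variable {W B C : ℕ} {e m g M u : ℕ} {D : ℕ → ℕ} {S : Multiset ℕ} {A : Epoch} {st : HS}

lemma Layout.samples_le (h : Layout S m g M D) : M ≤ 2 ^ (g - 1) := by
  have h1 := h.m_lt
  have h2 : M ≤ m := by
    rw [h.M_eq]
    refine Nat.div_le_of_le_mul ?_
    obtain ⟨g, rfl⟩ : ∃ g', g = g' + 1 := ⟨g - 1, by have := h.g_pos; omega⟩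
    have : g ≤ g * m := Nat.le_mul_of_pos_right _ h.m_pos
    rw [add_mul, one_mul]; omega
  omega

lemma Layout.log_le (h : Layout S m g M D) : g - 1 ≤ Nat.log 2 S.card + 1 := by
  have := h.g_le
  have := Nat.log_mono_right (b := 2) h.m_le
  omega

/-- Halving alone finishes a search among the samples in logarithmic time. -/
lemma searchBound_log (S : Multiset ℕ) : ∀ m g M D, Layout S m g M D →
    SearchBound (fun y => D (y * g)) M (Nat.log 2 S.card + 1) := by
  intro m g M D h y _
  refine ⟨0, Nat.zero_le _, ?_⟩
  simp only [node]
  exact (Nat.sub_le _ _).trans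
    (h.samples_le.trans (Nat.pow_le_pow_right (by norm_num) (by have := h.log_le; omega)))

/-- The bound for arbitrary keys. It makes up for samples that are not spread, which have small
probability. -/
lemma searchDepth_le_log (S : Multiset ℕ) : searchDepth S ≤ Nat.log 2 S.card + 1 :=
  Nat.sInf_le (searchBound_log S)

lemma searchDepth_le {t : ℕ}
    (h : ∀ m g M D, Layout S m g M D → SearchBound (fun y => D (y * g)) M t) :
    searchDepth S ≤ t := Nat.sInf_le h

lemma Layout.searchBound (h : Layout S m g M D) :
    SearchBound (fun y => D (y * g)) M (searchDepth S) :=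
  Nat.sInf_mem (s := {t | ∀ m g M D, Layout S m g M D → SearchBound (fun y => D (y * g)) M t})
    ⟨_, searchBound_log S⟩ m g M D h

lemma Inv.layout (h : Inv W st A e m g M u D) (hm : 0 < m) : Layout A.base m g M D :=
  ⟨hm, h.static.incr, h.static.pos, h.mem_base, h.m_le, h.static.g_pos hm, h.static.g_le,
    h.static.m_lt hm, h.static.M_eq hm⟩

lemma Inv.congr {st' : HS} (h : Inv W st A e m g M u D) (ha : st'.a = st.a)
    (hv : ∀ x < 41, 34 ≤ x → st'.v x = st.v x) : Inv W st' A e m g M u D := by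
  obtain ⟨h1, h2, h3, h4, h5, h6, h7, h8, h9, h10, h11, h12, h13, h14, h15, h16, h17, h18⟩ := h
  rw [← ha] at h1 h2 h6 h18
  refine ⟨h1, h2, h3, h4, h5, h6, h7, h8, h9, h10, ?_, ?_, ?_, ?_, ?_, ?_, ?_, h18⟩ <;>
    rw [hv _ (by norm_num) (by norm_num)] <;> assumption

/-- The credit `A.base.card / 2 - A.left` collected by the updates of an epoch pays for the
rebuilding at its end. -/
theorem finish_spec (hBW : B ≤ W) (h : Inv W st A 1 m g M u D)
    (hB1 : 8 * (4 * A.now.card + 4) ≤ B) (hB2 : 8 * (4 * A.base.card + 4) ≤ B) :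
    Wp W B finish st fun τ c => c + 2000 * (A.tick.base.card / 2 - A.tick.left) ≤
        4500 + 2000 * (A.base.card / 2 - A.left) ∧
      ∃ m g M u D, Inv W τ A.tick 0 m g M u D := by
  have hl := h.vleft
  have h1 := h.left_le
  have h2 := h.used_le
  have h3 := h.now_le
  have h4 := h.le_now
  unfold finish
  refine Wp.ite (by simp; omega) ?_ ?_
  · intro hc
    simp [hl] at hc
    refine Wp.asg (by norm_num) (by simp; omega) ?_
    rw [Epoch.tick, if_neg hc]
    refine ⟨by simp only; omega, m, g, M, u, D, h.static, h.holds, h.mem_base, h.stat_le, h.m_le,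
      h.keys, by simp only; omega, by simp only; omega, by simp only; omega, by simp only; omega,
      ?_, ?_, ?_, ?_, ?_, ?_, ?_, h.zero⟩ <;> simp
    · exact h.vcount
    · exact h.vstat
    · exact h.vused
    · rw [hl]
    · exact h.vgap
    · exact h.vsamp
    · exact h.vcap
  · intro hc
    simp [hl] at hc
    have hm := h.m_le
    refine Wp.mono (rebuild_spec hBW h.holds h.vcount h.vcap (by omega) hB1 hB2 h.zero) ?_
    rintro τ n ⟨k1, m, g, M, D, k2, k3, k4, k5, k6, k7, k8, k9, k10, k11, k12, k13⟩
    rw [Epoch.tick, if_pos hc]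
    refine ⟨by simp only; omega, m, g, M, m, D, k2, k7, k8, le_rfl, k9, ?_, by simp only; omega,
      le_rfl, by simp only; omega, by simp only; omega, k10, k3, k6, k11, k4, k5, k12, k13⟩
    intro x hx
    obtain ⟨i, hi, rfl⟩ := Finset.mem_image.1 hx
    rw [Finset.mem_range] at hi
    rcases i with _ | i
    · rw [k7.zero]; exact Finset.mem_insert_self _ _
    · rw [k2.key i (by omega)]
      exact Finset.mem_insert_of_mem (Multiset.mem_toFinset.2 ((k8 _ (k2.pos i (by omega))).2
        ⟨i, by omega, rfl⟩))

lemma above_card_mono {P P' E : Finset ℕ} {k : ℕ} (h : P ⊆ P') :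
    (above P E k).card ≤ (above P' E k).card :=
  Finset.card_le_card (Finset.filter_subset_filter _ h)

lemma below_card_mono {P P' E : Finset ℕ} {k : ℕ} (h : P ⊆ P') :
    (below P E k).card ≤ (below P' E k).card :=
  Finset.card_le_card (Finset.filter_subset_filter _ h)

/-- A search in a state that satisfies the invariant. -/
theorem Inv.find_spec (h : Inv W st A 0 m g M u D) (hBW : B ≤ W) (hB : B = 64 * (A.now.card + 1))
    (hk : st.v Rk < W) :
    Wp W B find st fun τ c => c ≤ 25 * (A.cost (st.v Rk)) ∧ τ.a = st.a ∧
      (∀ x < 42, τ.v x = st.v x) ∧ τ.v Rp ≤ u ∧ τ.v Rs ≤ u ∧ st.a 2 (τ.v Rs) = τ.v Rp ∧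
      st.a 0 (τ.v Rp) ≤ st.v Rk ∧ (τ.v Rs = 0 ∨ st.v Rk < st.a 0 (τ.v Rs)) := by
  have h1 := h.left_le
  have h2 := h.used_le
  have h3 := h.now_le
  have h4 := h.le_now
  have h5 := h.m_le
  have hlog : Nat.log 2 g ≤ Nat.log 2 (Nat.log 2 A.base.card + 2) := by
    refine Nat.log_mono_right (h.static.g_le.trans ?_)
    have := Nat.log_mono_right (b := 2) h5
    omega
  have hab := above_card_mono (E := A.stable) (k := st.v Rk) h.keys
  refine Wp.mono (WordRAM.find_spec (C := 8 * (A.now.card + 1)) (E := A.stable) hBW (by omega)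
    h.static (by omega) (fun hm => (h.layout hm).searchBound) h.vgap h.vsamp h.vstat hk
    h.holds.toNodes (by omega) h.stat_le ?_) ?_
  · intro y hy hy0
    rw [← h.mem_base y hy0]
    exact Multiset.mem_toFinset.1 (Finset.mem_inter.1 hy).1
  · rintro τ c ⟨hc, hτ⟩
    refine ⟨?_, hτ⟩
    rw [Epoch.cost]
    omega

/-- An insertion, with its amortized cost. -/
theorem insert_spec (h : Inv W st A 0 m g M u D) (hBW : B ≤ W) (hB : B = 64 * (A.now.card + 1))
    (hk : st.v 0 < W) :
    let A' := Epoch.tick { A with keys := insert (st.v 0) A.keys, now := st.v 0 ::ₘ A.now }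
    Wp W B insertStm st fun τ c => c + 2000 * (A'.base.card / 2 - A'.left) ≤
        5000 * A.cost (st.v 0) + 2000 * (A.base.card / 2 - A.left) ∧
      ∃ m g M u D, Inv W τ A' 0 m g M u D := by
  have h1 := h.left_le
  have h2 := h.used_le
  have h3 := h.now_le
  have h4 := h.le_now
  have h5 := h.m_le
  have h6 := h.stat_le
  have hcost : 1 ≤ A.cost (st.v 0) := by rw [Epoch.cost]; omega
  intro A'
  unfold insertStm
  refine Wp.seq (Wp.asg (by norm_num) (by simp) ?_)
  simp only [ev_var]
  set st₁ := st.set Rk (st.v 0) with hst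
  have hI : Inv W st₁ A 0 m g M u D := h.congr rfl fun x hx _ => by
    rw [hst, HS.set_v, if_neg (by omega)]
  have hk1 : st₁.v Rk = st.v 0 := by simp [hst]
  clear_value st₁
  refine Wp.seq (Wp.mono (hI.find_spec hBW hB (by rw [hk1]; exact hk)) ?_)
  rintro τ₁ c₁ ⟨i1, i2, i3, i4, i5, i6, i7, i8⟩
  have i3k := i3 Rk (by norm_num)
  have hI1 : Inv W τ₁ A 0 m g M u D := hI.congr i2 fun x hx _ => i3 x (by omega)
  rw [← i2] at i6 i7 i8
  rw [hk1] at i3k i1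
  refine Wp.seq (Wp.mono (store_spec (C := u + 2) hBW (by omega) hI1.holds
    hI1.vused hI1.vcount (by omega) (by omega) (by omega) i4 i5 i6 (by rw [i3k, ← hk1]; exact i7)
    (by rw [i3k, ← hk1]; exact i8)) ?_)
  rintro τ₂ c₂ ⟨j1, j2, j3, j4, j5, j6, j7, j8, j9, j10, j11⟩
  rw [i3k] at j6 j7
  have key : ∀ i < m, τ₂.a 0 (i + 1) = D i := fun i hi => by
    rw [j8 _ (by omega), hI1.static.key i hi]
  have hI2 : Inv W τ₂ { A with keys := insert (st.v 0) A.keys, now := st.v 0 ::ₘ A.now } 1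
      m g M (τ₂.v Rused) D := by
    have hs := hI1.static
    refine ⟨⟨hs.incr, hs.pos, hs.lt, key, hs.g_pos, hs.g_le, hs.m_lt, hs.M_eq, hs.size, ?_, ?_⟩,
      j6, h.mem_base, by omega, h5, j7.trans (Finset.insert_subset_insert _ hI1.keys),
      by simp only; omega, h1, by simp only [Multiset.card_cons]; omega,
      by simp only [Multiset.card_cons]; omega, by simp only [Multiset.card_cons]; exact j3,
      ?_, rfl, ?_, ?_, ?_, ?_, ?_⟩
    · rw [j9]; exact hs.tab
    · rw [j10]; exact hs.seg
    · rw [j2 _ (by norm_num) (by norm_num) (by norm_num), hI1.vstat]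
    · rw [j2 _ (by norm_num) (by norm_num) (by norm_num), hI1.vleft]
    · rw [j2 _ (by norm_num) (by norm_num) (by norm_num), hI1.vgap]
    · rw [j2 _ (by norm_num) (by norm_num) (by norm_num), hI1.vsamp]
    · rw [j2 _ (by norm_num) (by norm_num) (by norm_num), hI1.vcap]
    · intro f hf i hi
      rw [j11 f i (by simp only at hi; omega), hI1.zero f hf i hi]
  refine Wp.mono (finish_spec hBW hI2 (by simp only [Multiset.card_cons]; omega) (by
    simp only; omega)) ?_
  rintro τ₃ c₃ ⟨l1, l2⟩
  refine ⟨?_, l2⟩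
  simp only at l1
  simp only [A']
  omega

/-- A deletion, with its amortized cost. -/
theorem delete_spec (h : Inv W st A 0 m g M u D) (hBW : B ≤ W) (hB : B = 64 * (A.now.card + 1))
    (hk : st.v 0 < W) :
    let A' := Epoch.tick { A with now := A.now.erase (st.v 0) }
    Wp W B deleteStm st fun τ c => c + 2000 * (A'.base.card / 2 - A'.left) ≤
        5000 * A.cost (st.v 0) + 2000 * (A.base.card / 2 - A.left) ∧
      ∃ m g M u D, Inv W τ A' 0 m g M u D := by
  have h1 := h.left_le
  have h2 := h.used_le
  have h3 := h.now_le
  have h4 := h.le_now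
  have h5 := h.m_le
  have h6 := h.stat_le
  have hcost : 1 ≤ A.cost (st.v 0) := by rw [Epoch.cost]; omega
  have he1 := Multiset.card_erase_le (a := st.v 0) (s := A.now)
  have he2 : A.now.card ≤ (A.now.erase (st.v 0)).card + 1 := by
    by_cases hm : st.v 0 ∈ A.now
    · rw [Multiset.card_erase_of_mem hm, Nat.pred_eq_sub_one]; omega
    · rw [Multiset.erase_of_notMem hm]; omega
  intro A'
  unfold deleteStm
  refine Wp.seq (Wp.asg (by norm_num) (by simp) ?_)
  simp only [ev_var]
  set st₁ := st.set Rk (st.v 0) with hst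
  have hI : Inv W st₁ A 0 m g M u D := h.congr rfl fun x hx _ => by
    rw [hst, HS.set_v, if_neg (by omega)]
  have hk1 : st₁.v Rk = st.v 0 := by simp [hst]
  clear_value st₁
  refine Wp.seq (Wp.mono (hI.find_spec hBW hB (by rw [hk1]; exact hk)) ?_)
  rintro τ₁ c₁ ⟨i1, i2, i3, i4, i5, i6, i7, i8⟩
  have i3k := i3 Rk (by norm_num)
  have hI1 : Inv W τ₁ A 0 m g M u D := hI.congr i2 fun x hx _ => i3 x (by omega)
  rw [← i2] at i6 i7 i8
  rw [hk1] at i3k i1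
  refine Wp.seq (Wp.mono (remove_spec (C := u + 2) (by omega) hI1.holds
    hI1.vcount (by omega) (by omega) i4 i5 i6 (by rw [i3k, ← hk1]; exact i7)
    (by rw [i3k, ← hk1]; exact i8)) ?_)
  rintro τ₂ c₂ ⟨j1, j2, j3, j4, j5, j6⟩
  rw [i3k] at j3 j4
  have hI2 : Inv W τ₂ { A with now := A.now.erase (st.v 0) } 1 m g M u D := by
    have hs := hI1.static
    have hkeys := hI1.keys
    refine ⟨⟨hs.incr, hs.pos, hs.lt, ?_, hs.g_pos, hs.g_le, hs.m_lt, hs.M_eq, hs.size, ?_, ?_⟩,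
      j4, h.mem_base, by omega, h5, ?_,
      by simp only; omega, h1, by simp only; omega,
      by simp only; omega, j3, ?_, ?_, ?_, ?_, ?_, ?_, ?_⟩
    · rw [j5 0 (by norm_num)]; exact hs.key
    · rw [j5 3 (by norm_num)]; exact hs.tab
    · rw [j5 4 (by norm_num)]; exact hs.seg
    · rw [nodeKeys, j5 0 (by norm_num)]; exact hkeys
    · rw [j2 _ (by norm_num) (by norm_num), hI1.vstat]
    · rw [j2 _ (by norm_num) (by norm_num), hI1.vused]
    · rw [j2 _ (by norm_num) (by norm_num), hI1.vleft]
    · rw [j2 _ (by norm_num) (by norm_num), hI1.vgap]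
    · rw [j2 _ (by norm_num) (by norm_num), hI1.vsamp]
    · rw [j2 _ (by norm_num) (by norm_num), hI1.vcap]
    · intro f hf i hi
      rw [j6 f i (by simp only at hi; omega), hI1.zero f hf i hi]
  refine Wp.mono (finish_spec hBW hI2 (by simp only; omega) (by
    simp only; omega)) ?_
  rintro τ₃ c₃ ⟨l1, l2⟩
  refine ⟨?_, l2⟩
  simp only at l1
  simp only [A']
  omega

/-- A query for the largest key less than `q` searches for `q - 1`, unless `q = 0`. -/
theorem predStm_spec (h : Inv W st A 0 m g M u D) (hBW : B ≤ W) (hB : B = 64 * (A.now.card + 1))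
    (hk : st.v 0 < W) :
    Wp W B predStm st fun τ c => c ≤ 5000 * A.cost (st.v 0 - 1) ∧ Inv W τ A 0 m g M u D ∧
      ((τ.v 0 = 0 ∧ ∀ x ∈ A.now, ¬ x < st.v 0) ∨ (τ.v 0 ≠ 0 ∧ τ.v 1 ∈ A.now ∧ τ.v 1 < st.v 0 ∧
        ∀ x ∈ A.now, x < st.v 0 → x ≤ τ.v 1)) := by
  have h1 := h.left_le
  have h2 := h.used_le
  have h3 := h.now_le
  have h4 := h.le_now
  have h5 := h.m_le
  have h6 := h.stat_le
  have hcost : 1 ≤ A.cost (st.v 0 - 1) := by rw [Epoch.cost]; omega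
  unfold predStm
  refine Wp.ite (by simp; omega) ?_ ?_
  · intro hc
    simp at hc
    exact Wp.skip ⟨by omega, h, Or.inl ⟨hc, fun x _ => by omega⟩⟩
  intro hc
  simp at hc
  refine Wp.seq (Wp.asg (by norm_num) (by simp; omega) ?_)
  simp only [ev_var, ev_sub, ev_one]
  set st₁ := st.set Rk (st.v 0 - 1) with hst
  have hI : Inv W st₁ A 0 m g M u D := h.congr rfl fun x hx _ => by
    rw [hst, HS.set_v, if_neg (by omega)]
  have hk1 : st₁.v Rk = st.v 0 - 1 := by simp [hst]
  clear_value st₁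
  refine Wp.seq (Wp.mono (hI.find_spec hBW hB (by rw [hk1]; omega)) ?_)
  rintro τ₁ c₁ ⟨i1, i2, i3, i4, i5, i6, i7, i8⟩
  have i3k := i3 Rk (by norm_num)
  have hI1 : Inv W τ₁ A 0 m g M u D := hI.congr i2 fun x hx _ => i3 x (by omega)
  rw [← i2] at i6 i7 i8
  rw [hk1] at i3k i1
  refine Wp.mono (report_spec (C := u + 2) (E := A.stable) (by omega) hI1.holds
    (by omega) (by omega) i4 i5 i6 (by rw [i3k, ← hk1]; exact i7)
    (by rw [i3k, ← hk1]; exact i8)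
    (fun y hy => Multiset.mem_toFinset.1 (Finset.mem_inter.1 hy).2)) ?_
  rintro τ₂ c₂ ⟨j1, j2, j3, j4⟩
  rw [i3k] at j1 j4
  have hbe := below_card_mono (E := A.stable) (k := st.v 0 - 1) hI1.keys
  refine ⟨?_, hI1.congr j2 fun x hx hx' => j3 x (by omega) (by omega), ?_⟩
  · have : A.cost (st.v 0 - 1) ≥ (below A.keys A.stable (st.v 0 - 1)).card := by
      rw [Epoch.cost]; omega
    omega
  · rcases j4 with ⟨j4, j5⟩ | ⟨j4, j5, j6, j7⟩
    · exact Or.inl ⟨j4, fun x hx => by have := j5 x hx; omega⟩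
    · exact Or.inr ⟨j4, j5, by omega, fun x hx hx' => j7 x hx (by omega)⟩

end Invariant

/-! ### The data structure on the word RAM -/

/-- The dynamic predecessor structure. -/
def predecessorStructure : DataStructure := ⟨insertStm.code, deleteStm.code, predStm.code⟩

/-- The number of machine steps per unit of cost. -/
def costUnit : ℕ := max insertStm.unit (max deleteStm.unit predStm.unit)

/-- The state at the beginning. -/
def Epoch.init : Epoch := ⟨0, {0}, 0, 0⟩

/-- The updates done in the current epoch; each of them pays for a part of the next
rebuilding. -/
def Epoch.credit (A : Epoch) : ℕ := A.base.card / 2 - A.left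

/-- The total cost of a sequence of requests. -/
noncomputable def Epoch.totalCost {w : ℕ} : List (Request w) → Epoch → ℕ
  | [], _ => 0
  | r :: rs, A => A.cost r.target + Epoch.totalCost rs (A.step r)

lemma Epoch.tick_now (A : Epoch) : A.tick.now = A.now := by
  rw [Epoch.tick]; split_ifs <;> rfl

lemma Epoch.step_now {w : ℕ} {A : Epoch} {S : Multiset (BitVec w)} (h : A.now = S.map BitVec.toNat)
    (r : Request w) : (A.step r).now = (r.apply S).map BitVec.toNat := by
  cases r with
  | insert k => simp [Epoch.step, Epoch.tick_now, Request.apply, h]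
  | delete k =>
    simp [Epoch.step, Epoch.tick_now, Request.apply, h]
    rw [Multiset.map_erase _ (fun _ _ => BitVec.eq_of_toNat_eq)]
  | pred q => exact h

section Machine

variable {w : ℕ} {ω : ℕ → Fin (2 ^ w)}

lemma Rel.call {σ : State w} {st : HS} (h : Rel σ st) (k : BitVec w) :
    Rel (σ.call k) (st.set 0 k.toNat) := by
  refine ⟨fun i hi => ?_, h.2⟩
  simp only [State.call, Function.update_apply, HS.set_v]
  split_ifs
  · rfl
  · exact h.1 i hi

lemma unit_le_costUnit (r : Request w) : ∃ c : Stm, predecessorStructure.program r = c.code ∧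
    c.unit ≤ costUnit ∧ c = match r with
      | .insert _ => insertStm | .delete _ => deleteStm | .pred _ => predStm := by
  cases r with
  | insert k => exact ⟨_, rfl, le_max_left _ _, rfl⟩
  | delete k => exact ⟨_, rfl, (le_max_left _ _).trans (le_max_right _ _), rfl⟩
  | pred k => exact ⟨_, rfl, (le_max_right _ _).trans (le_max_right _ _), rfl⟩

/-- The machine state `σ` represents the abstract state `A`. -/
def Represents (σ : State w) (A : Epoch) : Prop :=
  ∃ st, Rel σ st ∧ ∃ m g M u D, Inv (2 ^ w) st A 0 m g M u D

/-- One request, served by the machine: correctness, space, and amortized time. -/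
theorem serve_one {σ : State w} {A : Epoch} {S : Multiset (BitVec w)} (hσ : Represents σ A)
    (hS : A.now = S.map BitVec.toNat) (r : Request w) (hK : 64 * (S.card + 1) ≤ 2 ^ w) :
    ∃ τ, Exec ω (predecessorStructure.program r) (σ.call r.key) τ ∧ Represents τ (A.step r) ∧
      r.Answered S τ ∧ τ.peak ≤ 64 * (S.card + 1) ∧
      (∀ x, 64 * ((r.apply S).card + 1) ≤ x.toNat → τ.mem x = 0) ∧
      τ.time + 2000 * costUnit * (A.step r).credit ≤
        σ.time + 5000 * costUnit * A.cost r.target + 2000 * costUnit * A.credit := by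
  obtain ⟨st, hR, m, g, M, u, D, hI⟩ := hσ
  have hcard : A.now.card = S.card := by rw [hS, Multiset.card_map]
  have hk : r.key.toNat < 2 ^ w := r.key.isLt
  have hI0 : Inv (2 ^ w) (st.set 0 r.key.toNat) A 0 m g M u D := hI.congr rfl fun x _ hx => by
    rw [HS.set_v, if_neg (by omega)]
  have hv0 : (st.set 0 r.key.toNat).v 0 = r.key.toNat := by simp
  have key : ∃ t n, BS (2 ^ w) (64 * (S.card + 1)) (match r with
      | .insert _ => insertStm | .delete _ => deleteStm | .pred _ => predStm)
      (st.set 0 r.key.toNat) t n ∧ n + 2000 * (A.step r).credit ≤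
        5000 * A.cost r.target + 2000 * A.credit ∧
      (∃ m g M u D, Inv (2 ^ w) t (A.step r) 0 m g M u D) ∧ (∀ τ, Rel τ t → r.Answered S τ) := by
    cases r with
    | insert k =>
      obtain ⟨t, n, h1, h2, h3⟩ := insert_spec hI0 hK (by rw [hcard]) (by rw [hv0]; exact hk)
      rw [hv0] at h2 h3
      exact ⟨t, n, h1, h2, h3, fun _ _ => trivial⟩
    | delete k =>
      obtain ⟨t, n, h1, h2, h3⟩ := delete_spec hI0 hK (by rw [hcard]) (by rw [hv0]; exact hk)
      rw [hv0] at h2 h3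
      exact ⟨t, n, h1, h2, h3, fun _ _ => trivial⟩
    | pred q =>
      obtain ⟨t, n, h1, h2, h3, h4⟩ := predStm_spec hI0 hK (by rw [hcard]) (by rw [hv0]; exact hk)
      rw [hv0] at h2 h4
      refine ⟨t, n, h1, ?_, ⟨m, g, M, u, D, h3⟩, fun τ hτ => ?_⟩
      · simp only [Epoch.step, Request.target, Request.key] at h2 ⊢
        omega
      · have t0 := hτ.1 0 (by norm_num)
        have t1 := hτ.1 1 (by norm_num)
        simp only [Request.key] at h4
        rw [hS] at h4
        rcases h4 with ⟨h5, h6⟩ | ⟨h5, h6, h7, h8⟩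
        · refine Or.inl ⟨BitVec.eq_of_toNat_eq (by rw [t0, h5]; simp), fun k hk => ?_⟩
          rw [BitVec.lt_def]
          exact h6 _ (Multiset.mem_map_of_mem _ hk)
        · refine Or.inr ⟨fun h => h5 (by rw [← t0, h]; simp), ⟨?_, ?_⟩, ?_⟩
          · obtain ⟨k, hk, hk'⟩ := Multiset.mem_map.1 h6
            rwa [← BitVec.eq_of_toNat_eq (hk'.trans t1.symm)]
          · rw [BitVec.lt_def, t1]; exact h7
          · rintro k ⟨hk, hk'⟩
            rw [BitVec.lt_def] at hk'
            rw [BitVec.le_def, t1]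
            exact h8 _ (Multiset.mem_map_of_mem _ hk) hk'
  obtain ⟨t, n, h1, h2, h3, h4⟩ := key
  obtain ⟨c, hc1, hc2, hc3⟩ := unit_le_costUnit r
  rw [← hc3] at h1
  obtain ⟨τ, e1, e2, e3, e4⟩ := Stm.code_correct (ω := ω) hK (by omega) h1 costUnit hc2
    (σ.call r.key) (hR.call r.key)
  refine ⟨τ, hc1 ▸ e1, ⟨t, e2, h3⟩, h4 τ e2, e4.trans (by simp [State.call]), ?_, ?_⟩
  · intro x hx
    obtain ⟨m, g, M, u, D, hI'⟩ := h3
    have h5 := hI'.le_now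
    have h6 := hI'.left_le
    have h7 : (A.step r).now.card = (r.apply S).card := by
      rw [Epoch.step_now hS, Multiset.card_map]
    refine BitVec.eq_of_toNat_eq ?_
    rw [e2.2, hI'.zero _ (Nat.mod_lt _ (by norm_num)) _ (by omega)]
    simp
  · have h5 : costUnit * (n + 2000 * (A.step r).credit) ≤
        costUnit * (5000 * A.cost r.target + 2000 * A.credit) := Nat.mul_le_mul_left _ h2
    have h6 : (σ.call r.key).time = σ.time := rfl
    rw [h6] at e3
    nlinarith

lemma represents_zero : Represents (State.zero w) Epoch.init := by
  refine ⟨⟨fun _ => 0, fun _ _ => 0⟩, ⟨fun i _ => by simp [State.zero],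
    fun x => by simp [State.zero]⟩, 0, 0, 0, 0, fun _ => 0, ?_⟩
  refine ⟨⟨?_, ?_, ?_, ?_, ?_, ?_, ?_, ?_, ?_, ?_, ?_⟩, ⟨⟨?_, ?_, ?_, ?_, ?_, ?_⟩, ?_, ?_, ?_⟩,
    ?_, ?_, ?_, ?_, ?_, ?_, ?_, ?_, ?_, ?_, ?_, ?_, ?_, ?_, ?_, ?_⟩ <;>
    simp [Epoch.init, IncrOn, nodeKeys]

/-- All requests, by summation of `serve_one`; the credits telescope. -/
theorem serves_of_represents : ∀ (rs : List (Request w)) (S : Multiset (BitVec w)) (σ : State w)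
    (A : Epoch), Represents σ A → A.now = S.map BitVec.toNat →
    (∀ i, 64 * (((rs.take i).foldl (fun S r => r.apply S) S).card + 1) ≤ 2 ^ w) →
    predecessorStructure.Serves 64 ω rs S σ ∧ ∃ τ, predecessorStructure.ExecAll ω rs σ τ ∧
      τ.time ≤ σ.time + 5000 * costUnit * A.totalCost rs + 2000 * costUnit * A.credit
  | [], S, σ, A, _, _, _ => ⟨trivial, σ, rfl, by omega⟩
  | r :: rs, S, σ, A, hσ, hS, hK => by
    obtain ⟨τ, h1, h2, h3, h4, h5, h6⟩ := serve_one (ω := ω) hσ hS r (by simpa using hK 0)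
    obtain ⟨g1, ρ, g2, g3⟩ := serves_of_represents rs (r.apply S) τ (A.step r) h2
      (Epoch.step_now hS r) (fun i => by simpa using hK (i + 1))
    refine ⟨⟨τ, h1, h3, h4, h5, g1⟩, ρ, ⟨τ, h1, g2⟩, ?_⟩
    rw [Epoch.totalCost, mul_add]
    omega

/-- Correctness and linear space, for every outcome of the random words, which are not used. -/
theorem serves (rs : List (Request w))
    (hK : ∀ i, 64 * ((contents (rs.take i)).card + 1) ≤ 2 ^ w) :
    predecessorStructure.Serves 64 ω rs 0 (State.zero w) :=
  (serves_of_represents rs 0 _ _ represents_zero rfl hK).1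

/-- The running time in terms of the abstract states. -/
theorem totalTime_le (rs : List (Request w))
    (hK : ∀ i, 64 * ((contents (rs.take i)).card + 1) ≤ 2 ^ w) :
    predecessorStructure.totalTime ω rs ≤ (5000 * costUnit * Epoch.init.totalCost rs : ℕ) := by
  obtain ⟨-, τ, h1, h2⟩ := serves_of_represents (ω := ω) rs 0 _ _ represents_zero rfl hK
  refine (iInf₂_le τ h1).trans ?_
  rw [Nat.cast_le]
  simpa [State.zero, Epoch.init, Epoch.credit] using h2

end Machine

/-! ### The depth of the search for well-spread keys -/

/-- The number of elements of `S` strictly between `lo` and `hi`. -/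
def countBetween (S : Multiset ℕ) (lo hi : ℕ) : ℕ := (S.filter fun x => lo < x ∧ x < hi).card

/-- The numbers of elements in the intervals between two elements are approximated by the
values of `ν`, and `ν` is spread over these intervals. -/
structure Spread (S : Multiset ℕ) (ν : ℕ → ℕ → ℝ) (l β γ : ℝ) : Prop where
  upper : ∀ lo ∈ S, ∀ hi ∈ S, 0 < lo → ∀ lo' hi', lo ≤ lo' → lo' + 1 < hi' → hi' ≤ hi →
    (countBetween S lo' hi' : ℝ) ≤ l * (ν lo' hi' + 1)
  lower : ∀ lo ∈ S, ∀ hi ∈ S, 0 < lo → ∀ lo' hi', lo ≤ lo' → lo' + 1 < hi' → hi' ≤ hi →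
    ν lo' hi' ≤ l * (countBetween S lo' hi' + 1)
  smooth : ∀ lo ∈ S, ∀ hi ∈ S, 0 < lo → ∀ lo' hi', lo ≤ lo' → lo' + 1 < hi' → hi' ≤ hi →
    ν lo' hi' ≤ β * (((hi' - lo' - 1 : ℕ) : ℝ) / ((hi - lo - 1 : ℕ) : ℝ)) ^ γ * ν lo hi

section Depth

variable {S : Multiset ℕ} {m g M : ℕ} {D : ℕ → ℕ} {ν : ℕ → ℕ → ℝ} {l β γ : ℝ}

lemma count_eq_countBetween {k : ℕ} (hk : 0 < k) : S.count k = countBetween S (k - 1) (k + 1) := by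
  rw [Multiset.count_eq_card_filter_eq, countBetween]
  congr 1
  refine Multiset.filter_congr fun x _ => ?_
  omega

/-- Elements strictly between two static keys are counted key by key. -/
lemma countBetween_eq_sum (h : Layout S m g M D) {i j : ℕ} (hi : i < m) (hj : j < m) :
    countBetween S (D i) (D j) = ∑ x ∈ Finset.Ioo i j, S.count (D x) := by
  classical
  rw [countBetween, ← Multiset.toFinset_sum_count_eq]
  have hset : (S.filter fun x => D i < x ∧ x < D j).toFinset = (Finset.Ioo i j).image D := by
    ext x
    simp only [Multiset.mem_toFinset, Multiset.mem_filter, Finset.mem_image, Finset.mem_Ioo]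
    constructor
    · rintro ⟨h1, h2, h3⟩
      obtain ⟨y, hy, rfl⟩ := (h.mem x (by omega)).1 h1
      exact ⟨y, ⟨h.incr.lt_of_lt hi h2, h.incr.lt_of_lt hy h3⟩, rfl⟩
    · rintro ⟨y, ⟨h1, h2⟩, rfl⟩
      exact ⟨(h.mem _ (h.pos y (by omega))).2 ⟨y, by omega, rfl⟩, h.incr _ _ h1 (by omega),
        h.incr _ _ h2 hj⟩
  rw [hset, Finset.sum_image]
  · refine Finset.sum_congr rfl fun x hx => ?_
    rw [Finset.mem_Ioo] at hx
    exact Multiset.count_filter_of_pos ⟨h.incr _ _ hx.1 (by omega), h.incr _ _ hx.2 hj⟩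
  · intro x hx y hy hxy
    simp only [Finset.coe_Ioo, Set.mem_Ioo] at hx hy
    rcases lt_trichotomy x y with h1 | h1 | h1
    · have := h.incr _ _ h1 (by omega); omega
    · exact h1
    · have := h.incr _ _ h1 (by omega); omega

/-- Distinct natural numbers lie at least as far apart as their indices. -/
lemma IncrOn.add_le (h : IncrOn D m) {i : ℕ} : ∀ {j : ℕ}, i ≤ j → j < m → D i + (j - i) ≤ D j := by
  intro j
  induction j with
  | zero => intro h1 h2; obtain rfl : i = 0 := by omega
            simp
  | succ j ih =>
    intro h1 h2
    rcases Nat.eq_or_lt_of_le h1 with h3 | h3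
    · subst h3; simp
    · have := ih (by omega) (by omega)
      have := h j (j + 1) (by omega) h2
      omega

lemma Layout.samples_incr (h : Layout S m g M D) : IncrOn (fun y => D (y * g)) M :=
    fun _ _ hab hb =>
  h.incr _ _ (Nat.mul_lt_mul_of_pos_right hab h.g_pos) (sample_lt h.g_pos h.M_eq hb)

/-- The measure of progress for a node over the sample keys from `lo` to `hi`: the number of
elements strictly between them, or, if this is smaller, a power of the number of words. -/
noncomputable def spreadSize (S : Multiset ℕ) (γ : ℝ) (lo hi : ℕ) : ℝ :=
  min (countBetween S lo hi) (((hi - lo - 1 : ℕ) : ℝ) ^ γ)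

/-- A node with `s ≥ 3` samples contains at least `s - 2` elements. -/
lemma node_facts (h : Layout S m g M D) {L R : ℕ} (hLR : L + 3 ≤ R) (hR : R ≤ M) :
    L * g < m ∧ (R - 1) * g < m ∧ R - L - 2 ≤ countBetween S (D (L * g)) (D ((R - 1) * g)) ∧
    R - L - 2 ≤ D ((R - 1) * g) - D (L * g) - 1 ∧ D (L * g) ∈ S ∧ D ((R - 1) * g) ∈ S ∧
    (Finset.Ioo (L * g) ((R - 1) * g)).card ≤ (R - L) * g := by
  have hg := h.g_pos
  have h1 : L * g < m := sample_lt hg h.M_eq (by omega)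
  have h2 : (R - 1) * g < m := sample_lt hg h.M_eq (by omega)
  have h3 : (R - 1) * g = L * g + (R - 1 - L) * g := by rw [← add_mul]; congr 1; omega
  have h4 : R - 1 - L ≤ (R - 1 - L) * g := Nat.le_mul_of_pos_right _ hg
  refine ⟨h1, h2, ?_, ?_, ?_, ?_, ?_⟩
  · rw [countBetween_eq_sum h h1 h2]
    have : (Finset.Ioo (L * g) ((R - 1) * g)).card • 1 ≤
        ∑ x ∈ Finset.Ioo (L * g) ((R - 1) * g), S.count (D x) := by
      refine Finset.card_nsmul_le_sum _ _ _ fun x hx => ?_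
      rw [Finset.mem_Ioo] at hx
      exact Multiset.one_le_count_iff_mem.2
        ((h.mem _ (h.pos x (by omega))).2 ⟨x, by omega, rfl⟩)
    rw [Nat.card_Ioo, smul_eq_mul, mul_one] at this
    omega
  · have := h.incr.add_le (show L * g ≤ (R - 1) * g by omega) h2
    omega
  · exact (h.mem _ (h.pos _ h1)).2 ⟨_, h1, rfl⟩
  · exact (h.mem _ (h.pos _ h2)).2 ⟨_, h2, rfl⟩
  · rw [Nat.card_Ioo]
    have : (R - 1 - L) * g ≤ (R - L) * g := Nat.mul_le_mul_right _ (by omega)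
    omega

lemma one_le_spreadSize (hγ : 0 < γ) {lo hi : ℕ} (h1 : 1 ≤ countBetween S lo hi)
    (h2 : 1 ≤ hi - lo - 1) : 1 ≤ spreadSize S γ lo hi :=
  le_min (by exact_mod_cast h1) (Real.one_le_rpow (by exact_mod_cast h2) hγ.le)

/-- The factor by which the number of elements may exceed the number of samples. -/
noncomputable def sampleFactor (g : ℕ) (l β : ℝ) : ℝ := g * (l * (2 * β * l + 1))

/-- No word has many copies, so many elements make many samples. -/
lemma spreadSize_le (h : Layout S m g M D) (hS : Spread S ν l β γ) (hγ : 0 < γ)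
    (hl : 1 ≤ l) (hβ : 1 ≤ β) {L R : ℕ} (hLR : L + 3 ≤ R) (hR : R ≤ M) :
    spreadSize S γ (D (L * g)) (D ((R - 1) * g)) ≤ (R - L : ℕ) * sampleFactor g l β := by
  obtain ⟨h1, h2, h3, h4, h5, h6, h7⟩ := node_facts h hLR hR
  set lo := D (L * g) with hlo
  set hi := D ((R - 1) * g) with hhi
  have hlo0 : 0 < lo := h.pos _ h1
  set N : ℝ := (countBetween S lo hi : ℝ) with hN
  set a : ℝ := ((hi - lo - 1 : ℕ) : ℝ) ^ γ with ha
  have hN1 : 1 ≤ N := by rw [hN]; exact_mod_cast (by omega : 1 ≤ countBetween S lo hi)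
  have ha1 : 1 ≤ a :=
    Real.one_le_rpow (by exact_mod_cast (by omega : 1 ≤ hi - lo - 1)) hγ.le
  have hcount : ∀ x ∈ Finset.Ioo (L * g) ((R - 1) * g),
      (S.count (D x) : ℝ) ≤ l * (2 * β * l * (N / a) + 1) := by
    intro x hx
    rw [Finset.mem_Ioo] at hx
    have e1 := h.incr _ _ hx.1 (by omega)
    have e2 := h.incr _ _ hx.2 h2
    rw [← hlo] at e1
    rw [← hhi] at e2
    have e0 : 0 < D x := h.pos x (by omega)
    rw [count_eq_countBetween e0]
    have e3 := hS.upper lo h5 hi h6 hlo0 (D x - 1) (D x + 1) (by omega) (by omega) (by omega)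
    have e4 := hS.smooth lo h5 hi h6 hlo0 (D x - 1) (D x + 1) (by omega) (by omega) (by omega)
    have e5 := hS.lower lo h5 hi h6 hlo0 lo hi le_rfl (by omega) le_rfl
    rw [show D x + 1 - (D x - 1) - 1 = 1 by omega, Nat.cast_one,
      Real.div_rpow zero_le_one (Nat.cast_nonneg _), Real.one_rpow, ← ha] at e4
    have e6 : ν (D x - 1) (D x + 1) ≤ 2 * β * l * (N / a) := by
      refine e4.trans ?_
      have : ν lo hi ≤ l * (2 * N) := e5.trans (by gcongr; linarith)
      calc β * (1 / a) * ν lo hi ≤ β * (1 / a) * (l * (2 * N)) := by gcongr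
        _ = 2 * β * l * (N / a) := by ring
    refine e3.trans ?_
    gcongr
  have hsum : N ≤ (R - L : ℕ) * (g * (l * (2 * β * l * (N / a) + 1))) := by
    have e1 : N = ∑ x ∈ Finset.Ioo (L * g) ((R - 1) * g), (S.count (D x) : ℝ) := by
      rw [hN, hlo, hhi, countBetween_eq_sum h h1 h2]; push_cast; rfl
    rw [e1]
    refine (Finset.sum_le_card_nsmul _ _ _ hcount).trans ?_
    rw [← e1, nsmul_eq_mul]
    have : ((Finset.Ioo (L * g) ((R - 1) * g)).card : ℝ) ≤ (R - L : ℕ) * g := by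
      exact_mod_cast h7
    calc _ ≤ ((R - L : ℕ) * g : ℝ) * (l * (2 * β * l * (N / a) + 1)) := by gcongr
      _ = _ := by ring
  rw [sampleFactor, spreadSize, ← hN, ← ha]
  rcases le_total N a with hc | hc
  · refine (min_le_left _ _).trans (hsum.trans ?_)
    have : N / a ≤ 1 := div_le_one_of_le₀ hc (by linarith)
    have : 2 * β * l * (N / a) ≤ 2 * β * l * 1 := by gcongr
    rw [mul_one] at this
    gcongr
  · refine (min_le_right _ _).trans ?_
    have e1 : a = a / N * N := by field_simp
    have e2 : a / N ≤ 1 := div_le_one_of_le₀ hc (by linarith)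
    rw [e1]
    calc a / N * N ≤ a / N * ((R - L : ℕ) * (g * (l * (2 * β * l * (N / a) + 1)))) := by gcongr
      _ = (R - L : ℕ) * (g * (l * (2 * β * l + a / N))) := by field_simp
      _ ≤ _ := by gcongr

/-- The loss factor in the passage to a child. -/
noncomputable def stepFactor (g : ℕ) (l β : ℝ) : ℝ := 2 * l ^ 2 * β * sampleFactor g l β + l

lemma one_le_sampleFactor (hg : 1 ≤ g) (hl : 1 ≤ l) (hβ : 1 ≤ β) : 1 ≤ sampleFactor g l β := by
  have h1 : (1 : ℝ) ≤ g := by exact_mod_cast hg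
  have h2 : 1 ≤ 2 * β * l + 1 := by nlinarith
  rw [sampleFactor]
  exact one_le_mul_of_one_le_of_one_le h1 (one_le_mul_of_one_le_of_one_le hl h2)

lemma sampleFactor_le_stepFactor (hg : 1 ≤ g) (hl : 1 ≤ l) (hβ : 1 ≤ β) :
    sampleFactor g l β ≤ stepFactor g l β := by
  have h1 := one_le_sampleFactor hg hl hβ
  rw [stepFactor]
  have : 1 ≤ 2 * l ^ 2 * β := by nlinarith [mul_le_mul hl hl zero_le_one (by linarith : 0 ≤ l)]
  nlinarith

/-- The arithmetic of the passage to a child. A node with `s` samples has a range of `x` words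
and `N` elements, and its child a range of `x' ≤ x / s` words and `N'` elements. The size `Z =
min N (x ^ γ)` of the node is at most `s * Q`. If it equals `x ^ γ`, then the size of the child
is at most `x' ^ γ ≤ Z / s ^ γ`; if it equals `N`, then smoothness bounds `N'` by about `N / s ^
γ`. In both cases `s ≥ Z / Q` gives the exponent `1 - γ`. -/
lemma child_arith {Q s x x' N N' n n' : ℝ} (hγ : 0 < γ) (hγ1 : γ ≤ 1) (hl : 1 ≤ l) (hβ : 1 ≤ β)
    (hQ1 : 1 ≤ Q) (hQP : Q ≤ 2 * l ^ 2 * β * Q + l) (hs1 : 1 ≤ s) (hx1 : 1 ≤ x) (hN1 : 1 ≤ N)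
    (hx'0 : 0 ≤ x') (hsx : s * x' ≤ x) (hA : min N (x ^ γ) ≤ s * Q) (e3 : N' ≤ l * (n' + 1))
    (e4 : n' ≤ β * (x' / x) ^ γ * n) (e5 : n ≤ l * (N + 1)) :
    min N' (x' ^ γ) ≤ (2 * l ^ 2 * β * Q + l) * min N (x ^ γ) ^ (1 - γ) := by
  have hZ1 : 1 ≤ min N (x ^ γ) := le_min hN1 (Real.one_le_rpow hx1 hγ.le)
  obtain ⟨Z, hZ⟩ : ∃ Z, Z = min N (x ^ γ) := ⟨_, rfl⟩
  rw [← hZ] at hA hZ1 ⊢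
  have hZ0 : 0 < Z := by linarith
  have hsγ : 0 < s ^ γ := Real.rpow_pos_of_pos (by linarith) _
  have hxγ : 0 < x ^ γ := Real.rpow_pos_of_pos (by linarith) _
  have hr : x' ^ γ ≤ x ^ γ / s ^ γ := by
    rw [le_div_iff₀ hsγ, ← Real.mul_rpow hx'0 (by linarith), mul_comm]
    exact Real.rpow_le_rpow (by positivity) hsx hγ.le
  -- `s ≥ Z / Q`
  have hZs : Z / s ^ γ ≤ Q * Z ^ (1 - γ) := by
    rw [div_le_iff₀ hsγ]
    have f1 : Z ^ γ ≤ s ^ γ * Q := by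
      calc Z ^ γ ≤ (s * Q) ^ γ := Real.rpow_le_rpow hZ0.le hA hγ.le
        _ = s ^ γ * Q ^ γ := Real.mul_rpow (by linarith) (by linarith)
        _ ≤ s ^ γ * Q := by
          have : Q ^ γ ≤ Q ^ (1 : ℝ) := Real.rpow_le_rpow_of_exponent_le hQ1 hγ1
          rw [Real.rpow_one] at this
          gcongr
    have f2 : Z = Z ^ (1 - γ) * Z ^ γ := by
      rw [← Real.rpow_add hZ0]; simp
    calc Z = Z ^ (1 - γ) * Z ^ γ := f2
      _ ≤ Z ^ (1 - γ) * (s ^ γ * Q) := by gcongr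
      _ = _ := by ring
  have hZp : 1 ≤ Z ^ (1 - γ) := Real.one_le_rpow hZ1 (by linarith)
  rcases le_total N (x ^ γ) with hc | hc
  · have hZN : Z = N := by rw [hZ]; exact min_eq_left hc
    refine (min_le_left _ _).trans (e3.trans ?_)
    have f1 : n ≤ l * (2 * N) := e5.trans (by gcongr; linarith)
    have f2 : (x' / x) ^ γ ≤ 1 / s ^ γ := by
      rw [Real.div_rpow hx'0 (by linarith), div_le_iff₀ hxγ]
      calc x' ^ γ ≤ x ^ γ / s ^ γ := hr
        _ = _ := by ring
    have f3 : n' ≤ 2 * l * β * (Q * Z ^ (1 - γ)) := by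
      calc n' ≤ β * (x' / x) ^ γ * n := e4
        _ ≤ β * (x' / x) ^ γ * (l * (2 * N)) := by gcongr
        _ ≤ β * (1 / s ^ γ) * (l * (2 * N)) := by gcongr
        _ = 2 * l * β * (Z / s ^ γ) := by rw [hZN]; ring
        _ ≤ _ := by gcongr
    calc l * (n' + 1) ≤ l * (2 * l * β * (Q * Z ^ (1 - γ)) + Z ^ (1 - γ)) := by gcongr
      _ = _ := by ring
  · have hZN : Z = x ^ γ := by rw [hZ]; exact min_eq_right hc
    refine (min_le_right _ _).trans (hr.trans ?_)
    rw [← hZN]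
    refine hZs.trans ?_
    gcongr

/-- The passage to a child raises the size to the power `1 - γ`, up to a factor. -/
lemma spreadSize_child_le (h : Layout S m g M D) (hS : Spread S ν l β γ) (hγ : 0 < γ) (hγ1 : γ ≤ 1)
    (hl : 1 ≤ l) (hβ : 1 ≤ β) {L R L' R' : ℕ} (hLR : L + 3 ≤ R) (hR : R ≤ M) (hL' : L ≤ L')
    (hLR' : L' + 3 ≤ R') (hR' : R' ≤ R)
    (hcell : cellOf (fun y => D (y * g)) L R (D (L' * g)) =
      cellOf (fun y => D (y * g)) L R (D ((R' - 1) * g))) :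
    spreadSize S γ (D (L' * g)) (D ((R' - 1) * g)) ≤ stepFactor g l β *
      spreadSize S γ (D (L * g)) (D ((R - 1) * g)) ^ (1 - γ) := by
  have hA := spreadSize_le h hS hγ hl hβ hLR hR
  obtain ⟨h1, h2, h3, h4, h5, h6, h7⟩ := node_facts h hLR hR
  obtain ⟨k1, k2, k3, k4, k5, k6, k7⟩ := node_facts h hLR' (hR'.trans hR)
  have hQ1 := one_le_sampleFactor h.g_pos hl hβ
  have hQP := sampleFactor_le_stepFactor h.g_pos hl hβ
  have hZ1 := one_le_spreadSize (S := S) (lo := D (L * g)) (hi := D ((R - 1) * g))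
    hγ (by omega) (by omega)
  have hinc := h.samples_incr
  have i1 : D (L * g) ≤ D (L' * g) := hinc.le hL' (by omega)
  have i2 : D ((R' - 1) * g) ≤ D ((R - 1) * g) := hinc.le (show R' - 1 ≤ R - 1 by omega) (by omega)
  -- the keys of a child lie in one cell
  have hlen : (R - L) * (D ((R' - 1) * g) - D (L' * g) - 1) ≤ D ((R - 1) * g) - D (L * g) - 1 := by
    simp only [cellOf, gridWidth] at hcell
    set lo := D (L * g)
    set hi := D ((R - 1) * g)
    set lo' := D (L' * g)
    set hi' := D ((R' - 1) * g)
    obtain ⟨q, hq⟩ : ∃ q, (hi - lo) / (R - L) = q := ⟨_, rfl⟩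
    rw [hq] at hcell
    have e1 : (hi' - lo) < (lo' - lo) + (q + 1) := by
      have f1 := Nat.mul_div_le (lo' - lo) (q + 1)
      have f2 := Nat.lt_mul_div_succ (hi' - lo) (Nat.succ_pos q)
      rw [← hcell, mul_add, mul_one] at f2
      exact f2.trans_le (Nat.add_le_add_right f1 _)
    have e2 : q * (R - L) ≤ hi - lo := hq ▸ Nat.div_mul_le_self _ _
    have e3 : (R - L) * (hi' - lo' - 1) ≤ (R - L) * (q - 1) := Nat.mul_le_mul_left _ (by omega)
    have e4 : (R - L) * (q - 1) + (R - L) = (R - L) * q := by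
      rw [← Nat.mul_succ]; congr 1; omega
    rw [mul_comm] at e2
    omega
  have hlo0 : 0 < D (L * g) := h.pos _ h1
  have e3 := hS.upper _ h5 _ h6 hlo0 (D (L' * g)) (D ((R' - 1) * g)) i1 (by omega) i2
  have e4 := hS.smooth _ h5 _ h6 hlo0 (D (L' * g)) (D ((R' - 1) * g)) i1 (by omega) i2
  have e5 := hS.lower _ h5 _ h6 hlo0 _ _ le_rfl (by omega) le_rfl
  set lo := D (L * g)
  set hi := D ((R - 1) * g)
  set lo' := D (L' * g)
  set hi' := D ((R' - 1) * g)
  have hs1 : (1 : ℝ) ≤ (R - L : ℕ) := by exact_mod_cast (by omega : 1 ≤ R - L)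
  have hx1 : (1 : ℝ) ≤ (hi - lo - 1 : ℕ) := by exact_mod_cast (by omega : 1 ≤ hi - lo - 1)
  have hN1 : (1 : ℝ) ≤ countBetween S lo hi := by
    exact_mod_cast (by omega : 1 ≤ countBetween S lo hi)
  have hsx : ((R - L : ℕ) : ℝ) * (hi' - lo' - 1 : ℕ) ≤ (hi - lo - 1 : ℕ) := by
    exact_mod_cast hlen
  exact child_arith hγ hγ1 hl hβ hQ1 hQP hs1 hx1 hN1 (Nat.cast_nonneg _) hsx hA e3 e4 e5

/-- The size of a node decreases doubly exponentially with the depth. -/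
theorem spreadSize_node_le (h : Layout S m g M D) (hS : Spread S ν l β γ) (hγ : 0 < γ) (hγ1 : γ ≤ 1)
    (hl : 1 ≤ l) (hβ : 1 ≤ β) {y : ℕ} (hy : y < M) (d : ℕ)
    (hd : (node (fun y => D (y * g)) M d y).1 + 3 ≤ (node (fun y => D (y * g)) M d y).2) :
    spreadSize S γ (D ((node (fun y => D (y * g)) M d y).1 * g))
      (D (((node (fun y => D (y * g)) M d y).2 - 1) * g)) ≤
      stepFactor g l β ^ (1 / γ) * (S.card : ℝ) ^ ((1 - γ) ^ d) := by
  have hinc := h.samples_incr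
  have hP1 : 1 ≤ stepFactor g l β :=
    (one_le_sampleFactor h.g_pos hl hβ).trans (sampleFactor_le_stepFactor h.g_pos hl hβ)
  induction d with
  | zero =>
    refine (min_le_left _ _).trans ?_
    rw [pow_zero, Real.rpow_one]
    have h1 : (countBetween S (D ((node (fun y => D (y * g)) M 0 y).1 * g))
      (D (((node (fun y => D (y * g)) M 0 y).2 - 1) * g)) : ℝ) ≤ S.card := by
      exact_mod_cast Multiset.card_le_card (Multiset.filter_le _ _)
    have h2 : 1 ≤ stepFactor g l β ^ (1 / γ) := Real.one_le_rpow hP1 (by positivity)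
    nlinarith [Nat.cast_nonneg (α := ℝ) S.card]
  | succ d ih =>
    have hm := node_mem hinc hy d
    have hm' := node_mem hinc hy (d + 1)
    have hs := node_succ_le hinc hy d
    have ih := ih (by omega)
    have hc1 := (mem_node_succ hinc hy d (z := (node (fun y => D (y * g)) M (d + 1) y).1)
      (by omega) (by omega)).1 ⟨by omega, by omega⟩
    have hc2 := (mem_node_succ hinc hy d (z := (node (fun y => D (y * g)) M (d + 1) y).2 - 1)
      (by omega) (by omega)).1 ⟨by omega, by omega⟩
    have hstep := spreadSize_child_le h hS hγ hγ1 hl hβ (by omega) hm.2.2 hs.1 hd hs.2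
      (hc1.trans hc2.symm)
    refine hstep.trans ?_
    have hf := node_facts h (show (node (fun y => D (y * g)) M d y).1 + 3 ≤ _ by omega) hm.2.2
    have hZ1 := one_le_spreadSize (S := S) hγ (show 1 ≤ countBetween S
      (D ((node (fun y => D (y * g)) M d y).1 * g))
      (D (((node (fun y => D (y * g)) M d y).2 - 1) * g)) by omega) (by omega)
    calc _ ≤ stepFactor g l β *
          (stepFactor g l β ^ (1 / γ) * (S.card : ℝ) ^ ((1 - γ) ^ d)) ^ (1 - γ) := by
          gcongr
      _ = stepFactor g l β ^ (1 / γ) * (S.card : ℝ) ^ ((1 - γ) ^ (d + 1)) := by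
          rw [Real.mul_rpow (by positivity) (by positivity), ← Real.rpow_mul (by positivity),
            ← Real.rpow_mul (by positivity), ← mul_assoc]
          nth_rewrite 1 [← Real.rpow_one (stepFactor g l β)]
          rw [← Real.rpow_add (by positivity), pow_succ]
          congr 2
          field_simp
          ring

/-- The number of samples in a node at depth `d`. -/
theorem node_card_le (h : Layout S m g M D) (hS : Spread S ν l β γ) (hγ : 0 < γ) (hγ1 : γ ≤ 1)
    (hl : 1 ≤ l) (hβ : 1 ≤ β) {y : ℕ} (hy : y < M) (d : ℕ) :
    (((node (fun y => D (y * g)) M d y).2 - (node (fun y => D (y * g)) M d y).1 : ℕ) : ℝ) ≤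
      2 + (stepFactor g l β ^ (1 / γ) * (S.card : ℝ) ^ ((1 - γ) ^ d)) ^ (1 / γ) := by
  have hP1 : 1 ≤ stepFactor g l β :=
    (one_le_sampleFactor h.g_pos hl hβ).trans (sampleFactor_le_stepFactor h.g_pos hl hβ)
  by_cases hd : (node (fun y => D (y * g)) M d y).1 + 3 ≤ (node (fun y => D (y * g)) M d y).2
  swap
  · have : (((node (fun y => D (y * g)) M d y).2 - (node (fun y => D (y * g)) M d y).1 : ℕ) : ℝ)
        ≤ 2 := by exact_mod_cast (by omega)
    have : 0 ≤ (stepFactor g l β ^ (1 / γ) * (S.card : ℝ) ^ ((1 - γ) ^ d)) ^ (1 / γ) :=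
      by positivity
    linarith
  have hZ := spreadSize_node_le h hS hγ hγ1 hl hβ hy d hd
  have hm := node_mem h.samples_incr hy d
  obtain ⟨h1, h2, h3, h4, -⟩ := node_facts h hd hm.2.2
  generalize (node (fun y => D (y * g)) M d y).1 = L at *
  generalize (node (fun y => D (y * g)) M d y).2 = R at *
  have hz : ((R - L - 2 : ℕ) : ℝ) ^ γ ≤ spreadSize S γ (D (L * g)) (D ((R - 1) * g)) := by
    have e1 : (1 : ℝ) ≤ ((R - L - 2 : ℕ) : ℝ) := by exact_mod_cast (by omega)
    refine le_min ?_ (Real.rpow_le_rpow (by positivity) (by exact_mod_cast h4) hγ.le)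
    calc ((R - L - 2 : ℕ) : ℝ) ^ γ ≤ ((R - L - 2 : ℕ) : ℝ) ^ (1 : ℝ) :=
          Real.rpow_le_rpow_of_exponent_le e1 hγ1
      _ ≤ _ := by rw [Real.rpow_one]; exact_mod_cast h3
  have e2 : ((R - L - 2 : ℕ) : ℝ) ≤
      (stepFactor g l β ^ (1 / γ) * (S.card : ℝ) ^ ((1 - γ) ^ d)) ^ (1 / γ) := by
    have := Real.rpow_le_rpow (by positivity) (hz.trans hZ) (show 0 ≤ 1 / γ by positivity)
    rwa [← Real.rpow_mul (by positivity), mul_one_div_cancel hγ.ne', Real.rpow_one] at this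
  rw [Nat.cast_sub (by omega)] at e2
  push_cast at e2 ⊢
  linarith

end Depth

/-! ### Samples from a smooth distribution -/

section Smooth

variable {μ : Measure ℝ} {a b α δ β γ : ℝ}

lemma HasDensityOn.noAtoms (h : HasDensityOn μ a b) : NullSingletonClass μ := by
  obtain ⟨f, -, rfl⟩ := h
  infer_instance

lemma HasDensityOn.ac (h : HasDensityOn μ a b) : μ (Set.Icc a b)ᶜ = 0 := by
  obtain ⟨f, -, rfl⟩ := h
  refine withDensity_absolutelyContinuous _ _ ?_
  rw [Measure.restrict_apply measurableSet_Icc.compl]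
  simp

/-- The part of the mass of an interval that a subinterval carries is bounded by a power of the
ratio of the lengths. -/
lemma SmoothWith.measure_le [IsProbabilityMeasure μ] (hα : 0 < α) (hδ : 0 < δ)
    (h : SmoothWith (fun s => (s : ℝ) ^ α) (fun s => (s : ℝ) ^ (1 - δ)) β μ a b)
    (hγ : γ ≤ δ / α) {c₁ c₃ d₁ d₂ : ℝ} (h1 : a ≤ c₁) (h2 : c₁ ≤ d₁) (h3 : d₁ < d₂)
    (h4 : d₂ ≤ c₃) (h5 : c₃ ≤ b) :
    μ.real (Set.Icc d₁ d₂) ≤ (|β| * 2 ^ δ + 1) * ((d₂ - d₁) / (c₃ - c₁)) ^ γ *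
      μ.real (Set.Icc c₁ c₃) := by
  obtain ⟨r, hr⟩ : ∃ r, r = (d₂ - d₁) / (c₃ - c₁) := ⟨_, rfl⟩
  have hc : 0 < c₃ - c₁ := by linarith
  have hr0 : 0 < r := by rw [hr]; exact div_pos (by linarith) hc
  have hr1 : r ≤ 1 := by rw [hr, div_le_one hc]; linarith
  -- For `s = ⌊r ^ (-1 / α)⌋` the window of length `(c₃ - c₁) / s ^ α` in the smoothness condition
  -- covers `[d₁, d₂]`, and its mass is bounded by a power of `r`.
  obtain ⟨z, hz⟩ : ∃ z, z = r ^ (-(1 / α)) := ⟨_, rfl⟩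
  have hz1 : 1 ≤ z := by
    rw [hz]; exact Real.one_le_rpow_of_pos_of_le_one_of_nonpos hr0 hr1 (by
      have : 0 < 1 / α := by positivity
      linarith)
  have hs1 : 1 ≤ ⌊z⌋₊ := Nat.one_le_floor_iff _ |>.2 hz1
  have hsz : (⌊z⌋₊ : ℝ) ≤ z := Nat.floor_le (by linarith)
  have hzs : z / 2 ≤ ⌊z⌋₊ := by
    have := Nat.lt_floor_add_one z
    have : (1 : ℝ) ≤ ⌊z⌋₊ := by exact_mod_cast hs1
    linarith
  have key := h c₁ d₂ c₃ h1 (by linarith) h4 h5 ⌊z⌋₊ hs1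
  simp only at key
  generalize hs : (⌊z⌋₊ : ℝ) = s at *
  have hs1' : 1 ≤ s := by rw [← hs]; exact_mod_cast hs1
  have hzα : z ^ α = r⁻¹ := by
    rw [hz, ← Real.rpow_mul hr0.le, show -(1 / α) * α = -1 by field_simp, Real.rpow_neg_one]
  have hsα : s ^ α ≤ r⁻¹ := hzα ▸ Real.rpow_le_rpow (by linarith) hsz hα.le
  have hsub : Set.Icc d₁ d₂ ⊆ Set.Icc c₁ c₃ ∩ Set.Icc (d₂ - (c₃ - c₁) / s ^ α) d₂ := by
    have e1 : d₂ - d₁ ≤ (c₃ - c₁) / s ^ α := by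
      rw [le_div_iff₀ (by positivity)]
      calc (d₂ - d₁) * s ^ α ≤ (d₂ - d₁) * r⁻¹ := by
            have : 0 < d₂ - d₁ := by linarith
            gcongr
        _ = c₃ - c₁ := by
            rw [hr]; have : d₂ - d₁ ≠ 0 := by linarith
            field_simp
    intro x hx
    exact ⟨⟨h2.trans hx.1, hx.2.trans h4⟩, by linarith [hx.1], hx.2⟩
  have hle : μ.real (Set.Icc d₁ d₂) ≤ (β * s ^ (1 - δ) / s) * μ.real (Set.Icc c₁ c₃) := by
    refine (measureReal_mono hsub).trans ?_
    rw [measureReal_def, cond_apply measurableSet_Icc, ENNReal.toReal_mul, ENNReal.toReal_inv,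
      ← measureReal_def, ← measureReal_def] at key
    rcases eq_or_lt_of_le (measureReal_nonneg (μ := μ) (s := Set.Icc c₁ c₃)) with h0 | h0
    · rw [← h0, mul_zero, h0]
      exact measureReal_mono Set.inter_subset_left
    · rw [inv_mul_le_iff₀ h0] at key
      exact key.trans_eq (mul_comm _ _)
  refine hle.trans ?_
  rw [← hr]
  gcongr
  have e1 : s ^ (1 - δ) / s = s ^ (-δ) := by
    nth_rewrite 2 [← Real.rpow_one s]
    rw [← Real.rpow_sub (by linarith)]; congr 1; ring
  have e2 : s ^ (-δ) ≤ 2 ^ δ * r ^ γ := by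
    calc s ^ (-δ) ≤ (z / 2) ^ (-δ) :=
          Real.rpow_le_rpow_of_nonpos (by linarith) hzs (by linarith)
      _ = 2 ^ δ * z ^ (-δ) := by
          rw [Real.div_rpow (by linarith) (by norm_num), Real.rpow_neg (by norm_num : (0:ℝ) ≤ 2)]
          field_simp
      _ = 2 ^ δ * r ^ (δ / α) := by
          rw [hz, ← Real.rpow_mul hr0.le]; congr 2; field_simp
      _ ≤ 2 ^ δ * r ^ γ := by
          have := Real.rpow_le_rpow_of_exponent_ge hr0 hr1 hγ
          gcongr
  rw [mul_div_assoc, e1]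
  have hrγ : 0 ≤ r ^ γ := by positivity
  calc β * s ^ (-δ) ≤ |β| * s ^ (-δ) := by gcongr; exact le_abs_self β
    _ ≤ |β| * (2 ^ δ * r ^ γ) := by gcongr
    _ ≤ _ := by rw [add_mul, mul_assoc]; linarith

end Smooth

/-! ### Blocks of equal mass -/

section Quantiles

variable {μ : Measure ℝ} [IsProbabilityMeasure μ] {a b : ℝ}

/-- A distribution without atoms has a continuous distribution function. -/
lemma continuous_cdf [NullSingletonClass μ] : Continuous (cdf μ) := by
  refine continuous_iff_continuousAt.2 fun x => ?_
  rw [Monotone.continuousAt_iff_leftLim_eq_rightLim (monotone_cdf μ)]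
  have h1 := StieltjesFunction.measure_singleton (cdf μ) x
  rw [measure_cdf, measure_singleton] at h1
  have h2 := (cdf μ).rightLim_eq x
  have h3 : Function.leftLim (cdf μ) x ≤ cdf μ x := (monotone_cdf μ).leftLim_le le_rfl
  have h4 := ENNReal.ofReal_eq_zero.1 h1.symm
  rw [h2]
  linarith

lemma cdf_left (h : HasDensityOn μ a b) : cdf μ a = 0 := by
  have := h.noAtoms
  rw [cdf_eq_real, measureReal_eq_zero_iff, ← Set.Iio_union_right]
  refine measure_union_null (measure_mono_null (fun x hx => ?_) h.ac) (measure_singleton _)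
  simp only [Set.mem_Iio] at hx
  simp [Set.mem_Icc]; intro; linarith

lemma cdf_right (h : HasDensityOn μ a b) : cdf μ b = 1 := by
  have h1 : μ (Set.Iic b)ᶜ = 0 := measure_mono_null (fun x hx => by
    simp only [Set.mem_compl_iff, Set.mem_Iic, not_le] at hx
    simp [Set.mem_Icc]; intro; linarith) h.ac
  rw [cdf_eq_real, measureReal_def, (prob_compl_eq_zero_iff measurableSet_Iic).1 h1]
  simp

lemma real_Ioc (x y : ℝ) (hxy : x ≤ y) : μ.real (Set.Ioc x y) = cdf μ y - cdf μ x := by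
  rw [cdf_eq_real, cdf_eq_real, ← Set.Iic_sdiff_Iic, measureReal_sdiff (Set.Iic_subset_Iic.2 hxy)
    measurableSet_Iic]

lemma real_Icc [NullSingletonClass μ] (x y : ℝ) (hxy : x ≤ y) :
    μ.real (Set.Icc x y) = cdf μ y - cdf μ x := by
  rw [← real_Ioc x y hxy, measureReal_def, measureReal_def, measure_congr Ioc_ae_eq_Icc]

/-- Points that cut the interval into `B` blocks of equal mass. -/
lemma exists_quantiles (h : HasDensityOn μ a b) {B : ℕ} (hB : 0 < B) :
    ∃ t : ℕ → ℝ, ∀ i ≤ B, cdf μ (t i) = i / B := by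
  have := h.noAtoms
  have hB' : (0 : ℝ) < B := by exact_mod_cast hB
  have hab : a ≤ b := by
    by_contra hc
    have h1 := monotone_cdf μ (le_of_not_ge hc)
    rw [cdf_left h, cdf_right h] at h1
    linarith
  have : ∀ i, ∃ x, i ≤ B → cdf μ x = i / B := fun i => by
    by_cases hi : i ≤ B
    · have h1 := intermediate_value_Icc hab (continuous_cdf (μ := μ)).continuousOn
      rw [cdf_left h, cdf_right h] at h1
      have hi' : (i : ℝ) ≤ B := by exact_mod_cast hi
      obtain ⟨x, -, hx⟩ := h1 ⟨by positivity, (div_le_one hB').2 hi'⟩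
      exact ⟨x, fun _ => hx⟩
    · exact ⟨0, fun h => absurd h hi⟩
  choose t ht using this
  exact ⟨t, ht⟩

/-- Every block of equal mass contains a sample point, and at most `T` of them. -/
def Balanced (t : ℕ → ℝ) (B T : ℕ) (J : Finset ℕ) (x : ℕ → ℝ) : Prop :=
  ∀ i < B, (∃ j ∈ J, x j ∈ Set.Ioc (t i) (t (i + 1))) ∧
    (J.filter fun j => x j ∈ Set.Ioc (t i) (t (i + 1))).card ≤ T

variable {t : ℕ → ℝ} {B T : ℕ} {J : Finset ℕ} {x : ℕ → ℝ}

lemma quantile_lt {ν : Measure ℝ} (ht : ∀ i ≤ B, cdf ν (t i) = i / B) {i j : ℕ} (hij : i < j)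
    (hj : j ≤ B) :
    t i < t j := by
  have hB : (0 : ℝ) < B := by exact_mod_cast (by omega : 0 < B)
  refine (monotone_cdf ν).reflect_lt ?_
  rw [ht i (by omega), ht j hj]
  have : (i : ℝ) < j := by exact_mod_cast hij
  gcongr

lemma quantile_le {ν : Measure ℝ} (ht : ∀ i ≤ B, cdf ν (t i) = i / B) {i j : ℕ} (hij : i ≤ j)
    (hj : j ≤ B) :
    t i ≤ t j := by
  rcases hij.eq_or_lt with rfl | h
  · exact le_rfl
  · exact (quantile_lt ht h hj).le

/-- The blocks cover the interval from the first to the last of their ends. -/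
lemma exists_block {y : ℝ} (n : ℕ) (hy : y ∈ Set.Ioc (t 0) (t n)) :
    ∃ i < n, y ∈ Set.Ioc (t i) (t (i + 1)) := by
  induction n with
  | zero => exact absurd (hy.1.trans_le hy.2) (lt_irrefl _)
  | succ n ih =>
    by_cases h : y ≤ t n
    · obtain ⟨i, hi, h⟩ := ih ⟨hy.1, h⟩
      exact ⟨i, by omega, h⟩
    · exact ⟨n, by omega, not_le.1 h, hy.2⟩

/-- The points in an interval lie in the blocks that meet it, each with at most `T` points. -/
lemma Balanced.upper [NullSingletonClass μ] (ht : ∀ i ≤ B, cdf μ (t i) = i / B)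
    (hbal : Balanced t B T J x) (hx : ∀ j ∈ J, x j ∈ Set.Ioc (t 0) (t B)) {c₁ c₂ : ℝ}
    (hc : c₁ ≤ c₂) :
    ((J.filter fun j => x j ∈ Set.Ico c₁ c₂).card : ℝ) ≤
      T * (B * μ.real (Set.Icc c₁ c₂) + 2) := by
  classical
  rcases Nat.eq_zero_or_pos B with rfl | hB
  · have : J = ∅ := Finset.eq_empty_of_forall_notMem fun j hj => by
      have := hx j hj; simp at this
    subst this
    simp
  have hB' : (0 : ℝ) < B := by exact_mod_cast hB
  obtain ⟨u, hu⟩ : ∃ u, u = B * cdf μ c₁ := ⟨_, rfl⟩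
  obtain ⟨v, hv⟩ : ∃ v, v = B * cdf μ c₂ := ⟨_, rfl⟩
  have hv0 : 0 ≤ v := by rw [hv]; exact mul_nonneg hB'.le (cdf_nonneg _ _)
  have huv : u ≤ v := by
    rw [hu, hv]; exact mul_le_mul_of_nonneg_left (monotone_cdf μ hc) hB'.le
  have hmeas : B * μ.real (Set.Icc c₁ c₂) = v - u := by rw [real_Icc _ _ hc, hu, hv]; ring
  have hsub : (J.filter fun j => x j ∈ Set.Ico c₁ c₂) ⊆
      ((Finset.Icc ⌈u - 1⌉₊ ⌊v⌋₊).filter (· < B)).biUnion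
        fun i => J.filter fun j => x j ∈ Set.Ioc (t i) (t (i + 1)) := by
    intro j hj
    rw [Finset.mem_filter] at hj
    obtain ⟨i, hi, hb⟩ := exists_block B (hx j hj.1)
    simp only [Finset.mem_biUnion, Finset.mem_filter, Finset.mem_Icc]
    refine ⟨i, ⟨⟨?_, ?_⟩, hi⟩, hj.1, hb⟩
    · rw [Nat.ceil_le]
      have h1 := monotone_cdf μ (hj.2.1.trans hb.2)
      rw [ht (i + 1) (by omega), le_div_iff₀ hB'] at h1
      push_cast at h1
      rw [hu]; linarith
    · refine Nat.le_floor ?_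
      have h1 := monotone_cdf μ (hb.1.trans hj.2.2).le
      rw [ht i (by omega), div_le_iff₀ hB'] at h1
      rw [hv]; linarith
  have h1 := (Finset.card_le_card hsub).trans (Finset.card_biUnion_le_card_mul _ _ T fun i hi =>
    (hbal i (Finset.mem_filter.1 hi).2).2)
  have h2 := (Finset.card_filter_le (Finset.Icc ⌈u - 1⌉₊ ⌊v⌋₊) (· < B))
  rw [Nat.card_Icc] at h2
  have h3 : ((⌊v⌋₊ + 1 - ⌈u - 1⌉₊ : ℕ) : ℝ) ≤ v - u + 2 := by
    have e1 := Nat.floor_le hv0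
    have e2 := Nat.le_ceil (u - 1)
    rcases le_total ⌈u - 1⌉₊ (⌊v⌋₊ + 1) with h | h
    · rw [Nat.cast_sub h]; push_cast; linarith
    · rw [Nat.sub_eq_zero_of_le h]; push_cast; linarith
  have h4 : ((J.filter fun j => x j ∈ Set.Ico c₁ c₂).card : ℝ) ≤
      (⌊v⌋₊ + 1 - ⌈u - 1⌉₊ : ℕ) * T := by
    exact_mod_cast h1.trans (Nat.mul_le_mul_right _ h2)
  rw [hmeas, mul_comm]
  exact h4.trans (mul_le_mul_of_nonneg_right h3 (by positivity))

/-- An interval contains a point of each block inside it. -/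
lemma Balanced.lower [NullSingletonClass μ] (ht : ∀ i ≤ B, cdf μ (t i) = i / B)
    (hbal : Balanced t B T J x) {c₁ c₂ : ℝ} (hc : c₁ ≤ c₂) :
    B * μ.real (Set.Icc c₁ c₂) ≤ (J.filter fun j => x j ∈ Set.Ico c₁ c₂).card + 2 := by
  classical
  rcases Nat.eq_zero_or_pos B with rfl | hB
  · simp; positivity
  have hB' : (0 : ℝ) < B := by exact_mod_cast hB
  obtain ⟨u, hu⟩ : ∃ u, u = B * cdf μ c₁ := ⟨_, rfl⟩
  obtain ⟨v, hv⟩ : ∃ v, v = B * cdf μ c₂ := ⟨_, rfl⟩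
  have hu0 : 0 ≤ u := by rw [hu]; exact mul_nonneg hB'.le (cdf_nonneg _ _)
  have hvB : v ≤ B := by
    rw [hv]; exact (mul_le_mul_of_nonneg_left (cdf_le_one μ c₂) hB'.le).trans (by simp)
  have huv : u ≤ v := by
    rw [hu, hv]; exact mul_le_mul_of_nonneg_left (monotone_cdf μ hc) hB'.le
  have hmeas : B * μ.real (Set.Icc c₁ c₂) = v - u := by rw [real_Icc _ _ hc, hu, hv]; ring
  have hiB : ∀ i ∈ Finset.Ico (⌊u⌋₊ + 1) (⌈v⌉₊ - 1), i < B := fun i hi => by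
    have : ⌈v⌉₊ ≤ B := Nat.ceil_le.2 hvB
    rw [Finset.mem_Ico] at hi; omega
  choose! f hf using fun i (hi : i < B) => (hbal i hi).1
  have hcard : (Finset.Ico (⌊u⌋₊ + 1) (⌈v⌉₊ - 1)).card ≤
      (J.filter fun j => x j ∈ Set.Ico c₁ c₂).card := by
    refine Finset.card_le_card_of_injOn f (fun i hi => ?_) fun i hi k hk hik => ?_
    · rw [Finset.mem_coe] at hi
      have h1 := hf i (hiB i hi)
      have h2 := hiB i hi
      rw [Finset.mem_Ico] at hi
      rw [Finset.mem_coe, Finset.mem_filter]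
      refine ⟨h1.1, (lt_trans ?_ h1.2.1).le, h1.2.2.trans_lt ?_⟩
      · refine (monotone_cdf μ).reflect_lt ?_
        rw [ht i h2.le, lt_div_iff₀ hB', mul_comm, ← hu]
        exact (Nat.floor_lt hu0).1 (by omega)
      · refine (monotone_cdf μ).reflect_lt ?_
        rw [ht (i + 1) h2, div_lt_iff₀ hB', mul_comm, ← hv]
        exact Nat.lt_ceil.1 (by omega)
    · have hi' := hiB i hi
      have hk' := hiB k hk
      have h1 := (hf i hi').2
      have h2 := (hf k hk').2
      rw [hik] at h1
      rcases lt_trichotomy i k with h | h | h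
      · exact absurd (h1.2.trans (quantile_le ht (show i + 1 ≤ k from h) hk'.le)) (not_le.2 h2.1)
      · exact h
      · exact absurd (h2.2.trans (quantile_le ht (show k + 1 ≤ i from h) hi'.le)) (not_le.2 h1.1)
  rw [Nat.card_Ico] at hcard
  have h3 : v - u - 2 ≤ ((⌈v⌉₊ - 1 - (⌊u⌋₊ + 1) : ℕ) : ℝ) := by
    have e1 := Nat.floor_le hu0
    have e2 := Nat.le_ceil v
    rcases le_total (⌊u⌋₊ + 2) ⌈v⌉₊ with h | h
    · rw [show ⌈v⌉₊ - 1 - (⌊u⌋₊ + 1) = ⌈v⌉₊ - (⌊u⌋₊ + 2) by omega, Nat.cast_sub h]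
      push_cast; linarith
    · have h' : (⌈v⌉₊ : ℝ) ≤ ⌊u⌋₊ + 2 := by exact_mod_cast h
      have : (0 : ℝ) ≤ ((⌈v⌉₊ - 1 - (⌊u⌋₊ + 1) : ℕ) : ℝ) := Nat.cast_nonneg _
      linarith
  have h4 : ((⌈v⌉₊ - 1 - (⌊u⌋₊ + 1) : ℕ) : ℝ) ≤
      (J.filter fun j => x j ∈ Set.Ico c₁ c₂).card := by exact_mod_cast hcard
  rw [hmeas]; linarith

end Quantiles

/-! ### The depth of the search for balanced samples -/

/-- The key of an element, as a natural number. -/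
noncomputable def keyOf (w : ℕ) (x : ℝ) : ℕ := (nearestWord w x).toNat

lemma keyOf_eq (w : ℕ) (x : ℝ) : keyOf w x = min ⌊x + 1 / 2⌋₊ (2 ^ w - 1) := by
  have : 0 < 2 ^ w := by positivity
  rw [keyOf, nearestWord, BitVec.toNat_ofNat, Nat.mod_eq_of_lt]
  omega

lemma keyOf_lt (w : ℕ) (x : ℝ) : keyOf w x < 2 ^ w := (nearestWord w x).isLt

/-- The words above `lo` are the roundings of the reals from `lo + 1 / 2` on, as long as `lo` is
not the last word. -/
lemma lt_keyOf {w lo : ℕ} {x : ℝ} (h : lo + 1 < 2 ^ w) : lo < keyOf w x ↔ (lo : ℝ) + 1 / 2 ≤ x := by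
  rw [keyOf_eq, lt_min_iff, ← Nat.succ_le_iff, Nat.le_floor_iff' (by omega)]
  push_cast
  constructor
  · intro h; linarith [h.1]
  · intro h; exact ⟨by linarith, by omega⟩

/-- The words below `hi` are the roundings of the reals below `hi - 1 / 2`, as long as `hi` is
not the first word. -/
lemma keyOf_lt_iff {w hi : ℕ} {x : ℝ} (h0 : 0 < hi) (h : hi < 2 ^ w) :
    keyOf w x < hi ↔ x < (hi : ℝ) - 1 / 2 := by
  rw [keyOf_eq, min_lt_iff, Nat.floor_lt' (by omega)]
  constructor
  · rintro (h | h)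
    · linarith
    · omega
  · intro h; exact Or.inl (by linarith)

section Balanced

variable {μ : Measure ℝ} [IsProbabilityMeasure μ] {a b α δ β γ : ℝ} {t : ℕ → ℝ} {B T : ℕ}
  {J : Finset ℕ} {x : ℕ → ℝ} {w : ℕ}

/-- Keys strictly between two words correspond to reals in an interval; rounding to the first or
the last word does not interfere, since both ends are words. -/
lemma countBetween_map {lo hi : ℕ} (hlh : lo + 1 < hi) (h : hi < 2 ^ w) :
    countBetween (J.val.map fun j => keyOf w (x j)) lo hi =
      (J.filter fun j => x j ∈ Set.Ico ((lo : ℝ) + 1 / 2) ((hi : ℝ) - 1 / 2)).card := by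
  classical
  rw [countBetween, Multiset.filter_map, Multiset.card_map, Finset.card, Finset.filter_val]
  congr 1
  refine Multiset.filter_congr fun j _ => ?_
  rw [Function.comp, lt_keyOf (by omega), keyOf_lt_iff (by omega) h, Set.mem_Ico]

/-- Balanced samples from a smooth distribution are spread. -/
theorem Balanced.spread (hd : HasDensityOn μ a b) (hα : 0 < α) (hδ : 0 < δ)
    (h : SmoothWith (fun s => (s : ℝ) ^ α) (fun s => (s : ℝ) ^ (1 - δ)) β μ a b)
    (hγ : γ ≤ δ / α) (ht : ∀ i ≤ B, cdf μ (t i) = i / B) (hbal : Balanced t B T J x)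
    (hx : ∀ j ∈ J, x j ∈ Set.Ioc (t 0) (t B)) (hab : ∀ j ∈ J, x j ∈ Set.Icc a b) {l : ℝ}
    (hB : 0 < B) (h1 : (T : ℝ) * B ≤ l * J.card) (h2 : 2 * (T : ℝ) ≤ l)
    (h3 : 2 * (J.card : ℝ) ≤ l * B) :
    Spread (J.val.map fun j => keyOf w (x j))
      (fun lo hi => J.card * μ.real (Set.Icc ((lo : ℝ) + 1 / 2) ((hi : ℝ) - 1 / 2)))
      l (|β| * 2 ^ δ + 1) γ := by
  have := hd.noAtoms
  have hB' : (0 : ℝ) < B := by exact_mod_cast hB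
  have hhi : ∀ hi ∈ J.val.map fun j => keyOf w (x j), hi < 2 ^ w := fun hi h => by
    obtain ⟨j, -, rfl⟩ := Multiset.mem_map.1 h
    exact keyOf_lt _ _
  have hpos : ∀ lo hi : ℕ, lo + 1 < hi → (lo : ℝ) + 1 / 2 < (hi : ℝ) - 1 / 2 := fun lo hi h => by
    have : ((lo : ℝ) + 1) + 1 ≤ hi := by exact_mod_cast h
    linarith
  refine ⟨?_, ?_, ?_⟩
  · intro lo _ hi hhi' _ lo' hi' _ hlh hi'h
    rw [countBetween_map hlh (hi'h.trans_lt (hhi hi hhi'))]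
    refine (hbal.upper ht hx (hpos _ _ hlh).le).trans ?_
    have hm : 0 ≤ μ.real (Set.Icc ((lo' : ℝ) + 1 / 2) ((hi' : ℝ) - 1 / 2)) := measureReal_nonneg
    nlinarith [mul_le_mul_of_nonneg_right h1 hm]
  · intro lo _ hi hhi' _ lo' hi' _ hlh hi'h
    rw [countBetween_map hlh (hi'h.trans_lt (hhi hi hhi'))]
    have h4 := hbal.lower ht (hpos _ _ hlh).le
    generalize μ.real (Set.Icc ((lo' : ℝ) + 1 / 2) ((hi' : ℝ) - 1 / 2)) = p at *
    have hN : (0 : ℝ) ≤ ((J.filter fun j =>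
      x j ∈ Set.Ico ((lo' : ℝ) + 1 / 2) ((hi' : ℝ) - 1 / 2)).card : ℝ) := Nat.cast_nonneg _
    generalize ((J.filter fun j =>
      x j ∈ Set.Ico ((lo' : ℝ) + 1 / 2) ((hi' : ℝ) - 1 / 2)).card : ℝ) = N at *
    have hJ : (0 : ℝ) ≤ J.card := Nat.cast_nonneg _
    have : B * ((J.card : ℝ) * p) ≤ B * (l * (N + 1)) := by
      nlinarith [mul_le_mul_of_nonneg_left h4 hJ, mul_le_mul_of_nonneg_right h3 hN]
    exact le_of_mul_le_mul_left this hB'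
  · intro lo hlo hi hhi' hlo0 lo' hi' hll hlh hi'h
    obtain ⟨j, hj, hjl⟩ := Multiset.mem_map.1 hlo
    obtain ⟨j', hj', hjh⟩ := Multiset.mem_map.1 hhi'
    have hlt := hhi hi hhi'
    have ea : a ≤ (lo : ℝ) + 1 / 2 := by
      have e1 : keyOf w (x j) < lo + 1 := by omega
      rw [keyOf_lt_iff (by omega) (by omega)] at e1
      push_cast at e1
      linarith [(hab j hj).1]
    have eb : (hi : ℝ) - 1 / 2 ≤ b := by
      have e1 : hi - 1 < keyOf w (x j') := by omega
      rw [lt_keyOf (by omega), Nat.cast_sub (by omega)] at e1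
      push_cast at e1
      linarith [(hab j' hj').2]
    have e2 : (lo : ℝ) ≤ lo' := by exact_mod_cast hll
    have e3 : (hi' : ℝ) ≤ hi := by exact_mod_cast hi'h
    have := h.measure_le hα hδ hγ ea (by linarith : (lo : ℝ) + 1 / 2 ≤ lo' + 1 / 2) (hpos _ _ hlh)
      (by linarith : (hi' : ℝ) - 1 / 2 ≤ hi - 1 / 2) eb
    have c1 : ((hi' - lo' - 1 : ℕ) : ℝ) = (hi' : ℝ) - 1 / 2 - (lo' + 1 / 2) := by
      rw [Nat.cast_sub (by omega), Nat.cast_sub (by omega)]; push_cast; ring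
    have c2 : ((hi - lo - 1 : ℕ) : ℝ) = (hi : ℝ) - 1 / 2 - (lo + 1 / 2) := by
      rw [Nat.cast_sub (by omega), Nat.cast_sub (by omega)]; push_cast; ring
    rw [c1, c2, mul_left_comm]
    exact mul_le_mul_of_nonneg_left this (Nat.cast_nonneg _)

end Balanced

/-! ### The logarithmic bounds -/

lemma one_le_log_of_three_le {n : ℕ} (hn : 3 ≤ n) : 1 ≤ Real.log n := by
  rw [Real.le_log_iff_exp_le (by positivity)]
  have : (3 : ℝ) ≤ n := by exact_mod_cast hn
  linarith [Real.exp_one_lt_d9]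

lemma natLog_le_two_log (n : ℕ) : (Nat.log 2 n : ℝ) ≤ 2 * Real.log n := by
  rcases Nat.eq_zero_or_pos n with rfl | hn
  · simp
  have h1 : ((2 ^ Nat.log 2 n : ℕ) : ℝ) ≤ n := by exact_mod_cast Nat.pow_log_le_self 2 hn.ne'
  have h2 := Real.log_le_log (by positivity) h1
  push_cast at h2
  rw [Real.log_pow] at h2
  have h3 := Real.log_two_gt_d9
  have h4 : (0 : ℝ) ≤ (Nat.log 2 n : ℝ) := Nat.cast_nonneg _
  nlinarith

/-- The step factor for `l = 26 * Y` is polynomial in `Y`, the logarithm of the number of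
elements. -/
lemma stepFactor_le {g Y β : ℝ} (hY : 1 ≤ Y) (hβ : 1 ≤ β) (hg : g ≤ 4 * Y) :
    2 * (26 * Y) ^ 2 * β * (g * (26 * Y * (2 * β * (26 * Y) + 1))) + 26 * Y ≤
      8000000 * β ^ 2 * Y ^ 5 := by
  have h1 : 2 * β * (26 * Y) + 1 ≤ 53 * β * Y := by nlinarith
  have h2 : g * (26 * Y * (2 * β * (26 * Y) + 1)) ≤ 4 * Y * (26 * Y * (53 * β * Y)) := by
    gcongr
  have h3 : 2 * (26 * Y) ^ 2 * β * (g * (26 * Y * (2 * β * (26 * Y) + 1))) ≤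
      2 * (26 * Y) ^ 2 * β * (4 * Y * (26 * Y * (53 * β * Y))) := by gcongr
  have h4 : Y ≤ β ^ 2 * Y ^ 5 := by
    have e1 : (1 : ℝ) ≤ β ^ 2 := one_le_pow₀ hβ
    have e2 : Y ≤ Y ^ 5 := le_self_pow₀ hY (by norm_num)
    nlinarith
  calc _ ≤ 2 * (26 * Y) ^ 2 * β * (4 * Y * (26 * Y * (53 * β * Y))) + 26 * (β ^ 2 * Y ^ 5) := by
        linarith
    _ = 7452250 * (β ^ 2 * Y ^ 5) := by ring
    _ ≤ _ := by nlinarith [show 0 ≤ β ^ 2 * Y ^ 5 by positivity]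

/-- Spread keys are searched in doubly logarithmic time. -/
theorem searchDepth_le_of_spread {β γ : ℝ} (hγ : 0 < γ) (hγ1 : γ ≤ 1) (hβ : 1 ≤ β) :
    ∃ C : ℝ, ∀ (S : Multiset ℕ) (ν : ℕ → ℕ → ℝ), 3 ≤ S.card →
      Spread S ν (26 * Real.log S.card) β γ →
        (searchDepth S : ℝ) ≤ C * max 1 (Real.log (Real.log S.card)) := by
  have hlc : 0 ≤ Real.log (8000000 * β ^ 2) := by
    refine Real.log_nonneg ?_
    have e1 : (1 : ℝ) ≤ β ^ 2 := one_le_pow₀ hβ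
    linarith
  refine ⟨1 / γ + 6 + 2 * (1 / γ * (1 / γ * (Real.log (8000000 * β ^ 2) + 5) + 1)),
    fun S ν hn hS => ?_⟩
  obtain ⟨Y, hY⟩ : ∃ Y, Y = Real.log S.card := ⟨_, rfl⟩
  have hY1 : 1 ≤ Y := hY ▸ one_le_log_of_three_le hn
  rw [← hY] at hS ⊢
  obtain ⟨Z, hZ⟩ : ∃ Z, Z = Real.log Y := ⟨_, rfl⟩
  have hZ0 : 0 ≤ Z := hZ ▸ Real.log_nonneg hY1
  have hYZ : Y = Real.exp Z := by rw [hZ, Real.exp_log (by linarith)]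
  have hnY : (S.card : ℝ) = Real.exp Y := by
    rw [hY, Real.exp_log]; exact_mod_cast (by omega)
  obtain ⟨q, hq⟩ : ∃ q, q = 1 / γ * (1 / γ * (Real.log (8000000 * β ^ 2) + 5 * Z) + 1) := ⟨_, rfl⟩
  have hq0 : 0 ≤ q := by rw [hq]; positivity
  -- At the depth `⌈log log n / γ⌉` the exponent `(1 - γ) ^ d` is at most `1 / log n`, so that only
  -- a polylogarithmic number of samples, at most `2 + exp q`, is left in a node; halving them takes
  -- `O(q)` iterations.
  have hmain : searchDepth S ≤ ⌈Z / γ⌉₊ + ⌈2 * (2 + q)⌉₊ := by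
    refine searchDepth_le fun m g M D hL y hy => ⟨⌈Z / γ⌉₊, by omega, ?_⟩
    rw [Nat.add_sub_cancel_left]
    have h1 := node_card_le hL hS hγ hγ1 (by linarith : 1 ≤ 26 * Y) hβ hy ⌈Z / γ⌉₊
    generalize (node (fun y => D (y * g)) M ⌈Z / γ⌉₊ y).2 -
      (node (fun y => D (y * g)) M ⌈Z / γ⌉₊ y).1 = N at *
    have hg : (g : ℝ) ≤ 4 * Y := by
      have e1 : (g : ℝ) ≤ Nat.log 2 S.card + 2 := by
        exact_mod_cast hL.g_le.trans (Nat.add_le_add_right (Nat.log_mono_right hL.m_le) 2)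
      have e2 := natLog_le_two_log S.card
      rw [← hY] at e2
      linarith
    have hP : stepFactor g (26 * Y) β ≤ Real.exp (Real.log (8000000 * β ^ 2) + 5 * Z) := by
      rw [Real.exp_add, Real.exp_log (by positivity), mul_comm 5 Z, Real.exp_mul, ← hYZ]
      refine (stepFactor_le hY1 hβ hg).trans_eq ?_
      norm_cast
    have hP0 : 0 ≤ stepFactor g (26 * Y) β := by
      have := (one_le_sampleFactor (l := 26 * Y) hL.g_pos (by linarith) hβ).trans
        (sampleFactor_le_stepFactor hL.g_pos (by linarith) hβ)
      linarith
    have hdecay : (S.card : ℝ) ^ ((1 - γ) ^ ⌈Z / γ⌉₊) ≤ Real.exp 1 := by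
      rw [hnY, ← Real.exp_mul]
      refine Real.exp_le_exp.2 ?_
      have e1 : (1 - γ) ^ ⌈Z / γ⌉₊ ≤ Real.exp (-Z) := by
        calc (1 - γ) ^ ⌈Z / γ⌉₊ ≤ (Real.exp (-γ)) ^ ⌈Z / γ⌉₊ := by
              refine pow_le_pow_left₀ (by linarith) ?_ _
              have := Real.add_one_le_exp (-γ); linarith
          _ = Real.exp (-(γ * ⌈Z / γ⌉₊)) := by rw [← Real.exp_nat_mul]; congr 1; ring
          _ ≤ _ := by
              refine Real.exp_le_exp.2 (neg_le_neg ?_)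
              have := Nat.le_ceil (Z / γ)
              rw [div_le_iff₀ hγ] at this
              linarith
      calc Y * (1 - γ) ^ ⌈Z / γ⌉₊ ≤ Y * Real.exp (-Z) := by gcongr
        _ = 1 := by rw [hYZ, ← Real.exp_add]; simp
    have h2 : (stepFactor g (26 * Y) β ^ (1 / γ) * (S.card : ℝ) ^ ((1 - γ) ^ ⌈Z / γ⌉₊)) ^ (1 / γ)
        ≤ Real.exp q := by
      have e0 : 0 ≤ 1 / γ := by positivity
      calc _ ≤ (Real.exp (Real.log (8000000 * β ^ 2) + 5 * Z) ^ (1 / γ)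
        * Real.exp 1) ^ (1 / γ) := by
            refine Real.rpow_le_rpow (by positivity) ?_ e0
            exact mul_le_mul (Real.rpow_le_rpow hP0 hP e0) hdecay (by positivity) (by positivity)
        _ = Real.exp q := by
            rw [← Real.exp_mul, ← Real.exp_add, ← Real.exp_mul, hq]
            congr 1
            ring
    have h3 : (N : ℝ) ≤ (2 : ℝ) ^ ⌈2 * (2 + q)⌉₊ := by
      have e1 : 2 + Real.exp q ≤ Real.exp (2 + q) := by
        have f1 := Real.add_one_le_exp (2 : ℝ)
        have f2 : 1 ≤ Real.exp q := Real.one_le_exp hq0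
        rw [Real.exp_add]
        nlinarith
      have e2 : Real.exp (2 + q) ≤ (2 : ℝ) ^ ⌈2 * (2 + q)⌉₊ := by
        rw [← Real.exp_log (show (0 : ℝ) < 2 by norm_num), ← Real.exp_nat_mul,
          Real.exp_log (show (0 : ℝ) < 2 by norm_num)]
        refine Real.exp_le_exp.2 ?_
        have f1 := Nat.le_ceil (2 * (2 + q))
        have f2 := Real.log_two_gt_d9
        nlinarith
      linarith
    exact_mod_cast h3
  have h5 : (searchDepth S : ℝ) ≤ ⌈Z / γ⌉₊ + ⌈2 * (2 + q)⌉₊ := by exact_mod_cast hmain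
  have h6 := Nat.ceil_lt_add_one (show 0 ≤ Z / γ by positivity)
  have h7 := Nat.ceil_lt_add_one (show 0 ≤ 2 * (2 + q) by positivity)
  rw [← hZ]
  obtain ⟨V, hV⟩ : ∃ V, V = max 1 Z := ⟨_, rfl⟩
  have hV1 : 1 ≤ V := hV ▸ le_max_left _ _
  have hVZ : Z ≤ V := hV ▸ le_max_right _ _
  rw [← hV]
  have h8 : q ≤ 1 / γ * (1 / γ * (Real.log (8000000 * β ^ 2) + 5) + 1) * V := by
    rw [hq, mul_assoc]
    refine mul_le_mul_of_nonneg_left ?_ (by positivity)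
    rw [add_mul, one_mul, mul_assoc]
    refine add_le_add (mul_le_mul_of_nonneg_left ?_ (by positivity)) hV1
    nlinarith
  have h9 : Z / γ ≤ 1 / γ * V := by
    rw [div_eq_mul_one_div, mul_comm]
    exact mul_le_mul_of_nonneg_left hVZ (by positivity)
  linarith

/-! ### Samples are balanced with high probability -/

/-- The law of the inserted reals. -/
noncomputable abbrev sampleLaw (μ : Measure ℝ) [IsProbabilityMeasure μ] : Measure (ℕ → ℝ) :=
  Measure.infinitePi fun _ : ℕ => μ

section Chernoff

variable {μ : Measure ℝ} [IsProbabilityMeasure μ] {J : Finset ℕ} {I : Set ℝ}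

/-- The probability that a set contains no sample. -/
lemma prob_none (hI : MeasurableSet I) :
    (sampleLaw μ).real {x | ∀ j ∈ J, x j ∉ I} = (1 - μ.real I) ^ J.card := by
  have : {x : ℕ → ℝ | ∀ j ∈ J, x j ∉ I} = Set.pi (J : Set ℕ) fun _ => Iᶜ := by
    ext x; simp
  rw [this, measureReal_def, Measure.infinitePi_pi _ fun _ _ => hI.compl, Finset.prod_const,
    ENNReal.toReal_pow, ← measureReal_def, probReal_compl_eq_one_sub hI]

/-- A Chernoff bound: Markov's inequality for `2 ^ N`, where `N` is the number of samples in
`I`. -/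
lemma prob_many [DecidablePred (· ∈ I)] (hI : MeasurableSet I) (T : ℕ) :
    (sampleLaw μ).real {x | T < (J.filter fun j => x j ∈ I).card} ≤
      (1 + μ.real I) ^ J.card / 2 ^ T := by
  have hf : Measurable fun y : ℝ => (1 : ENNReal) + I.indicator 1 y :=
    (measurable_one.indicator hI).const_add 1
  have hind : iIndepFun (fun (j : ℕ) (x : ℕ → ℝ) => (1 : ENNReal) + I.indicator 1 (x j))
      (sampleLaw μ) := iIndepFun_infinitePi (P := fun _ => μ) fun _ => hf
  have hmean : ∀ j : ℕ, ∫⁻ x, (1 + I.indicator 1 (x j)) ∂sampleLaw μ = 1 + μ I := fun j => by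
    rw [(measurePreserving_eval_infinitePi (fun _ : ℕ => μ) j).lintegral_comp hf,
      lintegral_add_left measurable_const, lintegral_indicator_one hI]
    simp
  -- `2 ^ N` is a product of independent factors with the mean `1 + μ I`.
  have hprod : ∀ x : ℕ → ℝ, ∏ j ∈ J, ((1 : ENNReal) + I.indicator 1 (x j)) =
      2 ^ (J.filter fun j => x j ∈ I).card := fun x => by
    rw [← Finset.prod_const, Finset.prod_filter]
    refine Finset.prod_congr rfl fun j _ => ?_
    by_cases h : x j ∈ I
    · simp [h, one_add_one_eq_two]
    · simp [h]
  have h1 := mul_meas_ge_le_lintegral (μ := sampleLaw μ)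
    (Finset.measurable_prod J fun j _ => hf.comp (measurable_pi_apply j)) (2 ^ T)
  simp only [Function.comp_def] at h1
  rw [lintegral_prod_eq_prod_lintegral_of_indepFun J _ hind
    (fun j => hf.comp (measurable_pi_apply j))] at h1
  simp only [hmean, Finset.prod_const, hprod] at h1
  have h2 : (sampleLaw μ) {x | T < (J.filter fun j => x j ∈ I).card} ≤
    (1 + μ I) ^ J.card / 2 ^ T := by
    rw [ENNReal.le_div_iff_mul_le (by simp) (by simp), mul_comm]
    refine le_trans (mul_le_mul_right (measure_mono fun x hx => ?_) _) h1
    exact Set.mem_ofPred.2 (pow_le_pow_right₀ (one_le_two : (1 : ENNReal) ≤ 2) (le_of_lt hx))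
  have h3 := ENNReal.toReal_mono (ENNReal.div_ne_top (by finiteness) (by simp)) h2
  rw [ENNReal.toReal_div, ENNReal.toReal_pow, ENNReal.toReal_pow, ENNReal.toReal_add (by simp)
    (by finiteness)] at h3
  simpa [measureReal_def] using h3

end Chernoff

section Depth

variable {μ : Measure ℝ} [IsProbabilityMeasure μ] {a b α δ β γ : ℝ} {t : ℕ → ℝ} {B T : ℕ}
  {J : Finset ℕ}

/-- The union bound over the blocks. A block has mass `1 / B`, hence `J.card / B` samples on
average. -/
lemma prob_unbalanced (ht : ∀ i ≤ B, cdf μ (t i) = i / B) (hB : 0 < B)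
    (hT : 3 * (J.card : ℝ) ≤ T * B) :
    (sampleLaw μ).real {x | ¬ Balanced t B T J x} ≤ B * (2 * Real.exp (-((J.card : ℝ) / B))) := by
  have hB' : (0 : ℝ) < B := by exact_mod_cast hB
  have hsub : {x | ¬ Balanced t B T J x} ⊆ ⋃ i ∈ Finset.range B,
      ({x : ℕ → ℝ | ∀ j ∈ J, x j ∉ Set.Ioc (t i) (t (i + 1))} ∪
        {x | T < (J.filter fun j => x j ∈ Set.Ioc (t i) (t (i + 1))).card}) := by
    intro x hx
    simp only [Balanced, Set.mem_ofPred_eq, not_forall] at hx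
    obtain ⟨i, hi, h⟩ := hx
    simp only [Set.mem_iUnion, Finset.mem_range]
    refine ⟨i, hi, ?_⟩
    by_contra hc
    simp only [Set.mem_union, Set.mem_ofPred_eq, not_or, not_forall, not_not, not_lt] at hc
    obtain ⟨⟨j, hj, hjx⟩, h2⟩ := hc
    exact h ⟨⟨j, hj, hjx⟩, h2⟩
  have hblock : ∀ i ∈ Finset.range B, (sampleLaw μ).real
      ({x : ℕ → ℝ | ∀ j ∈ J, x j ∉ Set.Ioc (t i) (t (i + 1))} ∪
        {x | T < (J.filter fun j => x j ∈ Set.Ioc (t i) (t (i + 1))).card}) ≤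
      2 * Real.exp (-((J.card : ℝ) / B)) := by
    intro i hi
    rw [Finset.mem_range] at hi
    have hp : μ.real (Set.Ioc (t i) (t (i + 1))) = 1 / B := by
      rw [real_Ioc _ _ (quantile_le ht (Nat.le_succ i) hi), ht i hi.le, ht (i + 1) hi]
      push_cast; field_simp; ring
    refine (measureReal_union_le _ _).trans ?_
    rw [prob_none measurableSet_Ioc, two_mul]
    refine add_le_add ?_ ((prob_many measurableSet_Ioc T).trans ?_)
    · rw [hp]
      have h1 : (1 : ℝ) / B ≤ 1 := by
        rw [div_le_one hB']; exact_mod_cast hB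
      calc (1 - 1 / (B : ℝ)) ^ J.card ≤ Real.exp (-(1 / B)) ^ J.card := by
            refine pow_le_pow_left₀ (by linarith) ?_ _
            have := Real.add_one_le_exp (-(1 / (B : ℝ))); linarith
        _ = _ := by rw [← Real.exp_nat_mul]; congr 1; ring
    · rw [hp, div_le_iff₀ (by positivity)]
      have h1 : (1 + 1 / (B : ℝ)) ^ J.card ≤ Real.exp ((J.card : ℝ) / B) := by
        calc (1 + 1 / (B : ℝ)) ^ J.card ≤ Real.exp (1 / B) ^ J.card := by
              refine pow_le_pow_left₀ (by positivity) ?_ _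
              have := Real.add_one_le_exp (1 / (B : ℝ)); linarith
          _ = _ := by rw [← Real.exp_nat_mul]; congr 1; ring
      have h2 : Real.exp (2 * ((J.card : ℝ) / B)) ≤ 2 ^ T := by
        rw [← Real.exp_log (show (0 : ℝ) < 2 by norm_num), ← Real.exp_nat_mul,
          Real.exp_log (show (0 : ℝ) < 2 by norm_num)]
        refine Real.exp_le_exp.2 ?_
        have f1 : 3 * ((J.card : ℝ) / B) ≤ T := by
          rw [← mul_div_assoc, div_le_iff₀ hB']; exact hT
        have f2 := Real.log_two_gt_d9
        have f3 : 0 ≤ (J.card : ℝ) / B := by positivity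
        nlinarith
      refine h1.trans ?_
      calc Real.exp ((J.card : ℝ) / B) =
            Real.exp (-((J.card : ℝ) / B)) * Real.exp (2 * ((J.card : ℝ) / B)) := by
              rw [← Real.exp_add]; congr 1; ring
        _ ≤ _ := by gcongr
  refine (measureReal_mono hsub (measure_ne_top _ _)).trans
    ((measureReal_biUnion_finset_le _ _).trans ?_)
  refine (Finset.sum_le_sum hblock).trans_eq ?_
  simp

/-- Almost surely all samples lie in the interval and in the blocks. -/
lemma sample_ae (hd : HasDensityOn μ a b) (hB : 0 < B) (ht : ∀ i ≤ B, cdf μ (t i) = i / B) :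
    ∀ᵐ x ∂sampleLaw μ, ∀ j, x j ∈ Set.Ioc (t 0) (t B) ∧ x j ∈ Set.Icc a b := by
  have hB' : (0 : ℝ) < B := by exact_mod_cast hB
  have h1 : ∀ᵐ y ∂μ, y ∈ Set.Ioc (t 0) (t B) ∧ y ∈ Set.Icc a b := by
    have e1 : ∀ᵐ y ∂μ, y ∈ Set.Ioc (t 0) (t B) := by
      refine (mem_ae_iff_prob_eq_one measurableSet_Ioc).2 ?_
      have h1 := real_Ioc (μ := μ) _ _ (quantile_le ht (Nat.zero_le B) le_rfl)
      rw [ht 0 (Nat.zero_le _), ht B le_rfl, div_self hB'.ne', Nat.cast_zero, zero_div, sub_zero,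
        measureReal_def, ENNReal.toReal_eq_one_iff] at h1
      exact h1
    filter_upwards [e1, mem_ae_iff.2 hd.ac] with y h1 h2 using ⟨h1, h2⟩
  rw [ae_all_iff]
  intro j
  exact (measurePreserving_eval_infinitePi (fun _ : ℕ => μ) j).quasiMeasurePreserving.ae h1

/-- The choice of the number of blocks. -/
lemma exists_blocks {n : ℕ} (hn : 3 ≤ n) : ∃ B T : ℕ, 0 < B ∧ B ≤ n ∧
    2 * Real.log n ≤ (n : ℝ) / B ∧ 3 * (n : ℝ) ≤ T * B ∧ (T : ℝ) * B ≤ 26 * Real.log n * n ∧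
    2 * (T : ℝ) ≤ 26 * Real.log n ∧ 2 * (n : ℝ) ≤ 26 * Real.log n * B := by
  have hY := one_le_log_of_three_le hn
  have hn' : (3 : ℝ) ≤ n := by exact_mod_cast hn
  have hlog : 2 * Real.log n ≤ n := by
    have h1 := Real.log_le_sub_one_of_pos (show (0 : ℝ) < n / 2 by positivity)
    rw [Real.log_div (by positivity) (by norm_num)] at h1
    have := Real.log_two_lt_d9
    linarith
  generalize Real.log n = Y at *
  -- There are `⌊n / (2 * log n)⌋` blocks, with between `2 * log n` and `4 * log n` samples each on
  -- average, and at most three times as many (rounded up) are allowed.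
  have hq1 : 1 ≤ (n : ℝ) / (2 * Y) := by rw [le_div_iff₀ (by linarith)]; linarith
  have hB1 : 1 ≤ ⌊(n : ℝ) / (2 * Y)⌋₊ := Nat.one_le_floor_iff _ |>.2 hq1
  have hB2 := Nat.floor_le (show 0 ≤ (n : ℝ) / (2 * Y) by linarith)
  have hB3 := Nat.lt_floor_add_one ((n : ℝ) / (2 * Y))
  generalize ⌊(n : ℝ) / (2 * Y)⌋₊ = B at *
  have hB1' : (1 : ℝ) ≤ B := by exact_mod_cast hB1
  have h4 : (n : ℝ) < 4 * Y * B := by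
    rw [div_lt_iff₀ (by linarith)] at hB3
    nlinarith
  have h5 : 2 * Y * B ≤ n := by
    rw [le_div_iff₀ (by linarith)] at hB2
    linarith
  have h6 : (B : ℝ) ≤ n := by nlinarith
  have h7 : (n : ℝ) / B ≤ 4 * Y := by rw [div_le_iff₀ (by linarith)]; linarith
  have hT1 := Nat.le_ceil (3 * ((n : ℝ) / B))
  have hT2 := Nat.ceil_lt_add_one (show 0 ≤ 3 * ((n : ℝ) / B) by positivity)
  generalize ⌈3 * ((n : ℝ) / B)⌉₊ = T at *
  refine ⟨B, T, hB1, by exact_mod_cast h6, ?_, ?_, ?_, ?_, ?_⟩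
  · rw [le_div_iff₀ (by linarith)]; linarith
  · rw [← mul_div_assoc, div_le_iff₀ (by linarith)] at hT1; exact hT1
  · have : (T : ℝ) ≤ 26 * Y := by linarith
    exact mul_le_mul this h6 (by linarith) (by linarith)
  · linarith
  · nlinarith

/-- The expected depth of the search among samples from a smooth distribution. -/
theorem lintegral_searchDepth_le (hα : 0 < α) (hδ : 0 < δ) (β : ℝ) :
    ∃ C : ℝ, 0 ≤ C ∧ ∀ (w : ℕ) (a b : ℝ) (μ : Measure ℝ) [IsProbabilityMeasure μ],
      HasDensityOn μ a b →
      SmoothWith (fun s => (s : ℝ) ^ α) (fun s => (s : ℝ) ^ (1 - δ)) β μ a b →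
      ∀ J : Finset ℕ, ∫⁻ x, searchDepth (J.val.map fun j => keyOf w (x j)) ∂sampleLaw μ ≤
        ENNReal.ofReal (C * max 1 (Real.log (Real.log J.card))) := by
  obtain ⟨C, hC⟩ := searchDepth_le_of_spread (β := |β| * 2 ^ δ + 1) (γ := min (δ / α) 1)
    (lt_min (by positivity) one_pos) (min_le_right _ _) (by
      have : 0 ≤ |β| * 2 ^ δ := by positivity
      linarith)
  refine ⟨|C| + 2, by positivity, fun w a b μ _ hd hs J => ?_⟩
  obtain ⟨V, hV⟩ : ∃ V, V = max 1 (Real.log (Real.log J.card)) := ⟨_, rfl⟩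
  have hV1 : 1 ≤ V := hV ▸ le_max_left _ _
  rw [← hV]
  have hcard : ∀ x : ℕ → ℝ, (J.val.map fun j => keyOf w (x j)).card = J.card := fun x => by simp
  by_cases hn : J.card < 3
  · calc ∫⁻ x, (searchDepth (J.val.map fun j => keyOf w (x j)) : ENNReal) ∂sampleLaw μ
        ≤ ∫⁻ _, 2 ∂sampleLaw μ := by
          refine lintegral_mono fun x => ?_
          have h1 := searchDepth_le_log (J.val.map fun j => keyOf w (x j))
          rw [hcard] at h1
          have h2 : Nat.log 2 J.card < 2 := Nat.log_lt_of_lt_pow' (by norm_num) (by omega)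
          exact ((Nat.cast_le (α := ENNReal)).2 (by omega : _ ≤ 2)).trans (by norm_num)
      _ = ENNReal.ofReal 2 := by simp
      _ ≤ _ := ENNReal.ofReal_le_ofReal (by have := abs_nonneg C; nlinarith)
  push Not at hn
  obtain ⟨B, T, hB, hBn, h1, h2, h3, h4, h5⟩ := exists_blocks hn
  obtain ⟨t, ht⟩ := exists_quantiles hd hB
  have hB' : (0 : ℝ) < B := by exact_mod_cast hB
  have hn' : (3 : ℝ) ≤ J.card := by exact_mod_cast hn
  -- The measurable hull makes it unnecessary to know that unbalanced samples form a measurable set.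
  obtain ⟨E, hE⟩ : ∃ E, E = toMeasurable (sampleLaw μ) {x | ¬ Balanced t B T J x} := ⟨_, rfl⟩
  have hEm : MeasurableSet E := hE ▸ measurableSet_toMeasurable _ _
  have hEp : (sampleLaw μ).real E ≤ 2 / J.card := by
    rw [hE, measureReal_def, measure_toMeasurable, ← measureReal_def]
    refine (prob_unbalanced ht hB h2).trans ?_
    have e1 : Real.exp (-((J.card : ℝ) / B)) ≤ ((J.card : ℝ) ^ 2)⁻¹ := by
      rw [← Real.exp_log (show (0 : ℝ) < ((J.card : ℝ) ^ 2)⁻¹ by positivity), Real.log_inv,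
        Real.log_pow]
      exact Real.exp_le_exp.2 (by push_cast; linarith)
    have e2 : (B : ℝ) ≤ J.card := by exact_mod_cast hBn
    calc (B : ℝ) * (2 * Real.exp (-((J.card : ℝ) / B))) ≤ J.card * (2 * ((J.card : ℝ) ^ 2)⁻¹) := by
          gcongr
      _ = _ := by field_simp
  have hpt : ∀ᵐ x ∂sampleLaw μ, (searchDepth (J.val.map fun j => keyOf w (x j)) : ENNReal) ≤
      ENNReal.ofReal (|C| * V) + E.indicator (fun _ => (J.card : ENNReal)) x := by
    filter_upwards [sample_ae hd hB ht] with x hx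
    by_cases hbal : Balanced t B T J x
    · have hsp := hbal.spread (w := w) hd hα hδ hs (min_le_left _ 1) ht (fun j _ => (hx j).1)
        (fun j _ => (hx j).2) hB h3 h4 h5
      have := hC _ _ (by rw [hcard x]; exact hn) (by rw [hcard x]; exact hsp)
      rw [hcard, ← hV] at this
      refine le_add_right ?_
      rw [← ENNReal.ofReal_natCast]
      refine ENNReal.ofReal_le_ofReal (this.trans ?_)
      have := le_abs_self C
      nlinarith
    · have hxE : x ∈ E := hE ▸ subset_toMeasurable _ _ hbal
      refine le_add_left ?_
      rw [Set.indicator_of_mem hxE]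
      have h6 := searchDepth_le_log (J.val.map fun j => keyOf w (x j))
      rw [hcard] at h6
      have h7 := Nat.log_lt_self 2 (show J.card ≠ 0 by omega)
      exact_mod_cast (by omega : searchDepth (J.val.map fun j => keyOf w (x j)) ≤ J.card)
  refine (lintegral_mono_ae hpt).trans ?_
  rw [lintegral_add_left measurable_const, lintegral_const, measure_univ, mul_one,
    lintegral_indicator_const hEm, ← ofReal_measureReal, ← ENNReal.ofReal_natCast,
    ← ENNReal.ofReal_mul (by positivity), ← ENNReal.ofReal_add (by positivity) (by positivity)]
  refine ENNReal.ofReal_le_ofReal ?_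
  have h8 : (J.card : ℝ) * (sampleLaw μ).real E ≤ 2 := by
    calc _ ≤ (J.card : ℝ) * (2 / J.card) := by gcongr
      _ = 2 := by field_simp
  nlinarith

end Depth

/-! ### The expected length of the walk along the list -/

lemma measurable_keyOf (w : ℕ) : Measurable (keyOf w) := by
  have : keyOf w = fun x => min ⌊x + 1 / 2⌋₊ (2 ^ w - 1) := funext (keyOf_eq w)
  rw [this]
  exact (Nat.measurable_floor.comp (measurable_id.add_const _)).min measurable_const

section Walk

variable {μ : Measure ℝ} [IsProbabilityMeasure μ] {w : ℕ}

/-- Independent and identically distributed samples are exchangeable. -/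
lemma measurePreserving_reindex (e : ℕ ≃ ℕ) :
    MeasurePreserving (fun x : ℕ → ℝ => x ∘ e) (sampleLaw μ) (sampleLaw μ) := by
  have h := Measure.infinitePi_map_piCongrLeft (fun _ : ℕ => μ) e.symm
  have h2 : (⇑(MeasurableEquiv.piCongrLeft (fun _ : ℕ => ℝ) e.symm)) = fun x : ℕ → ℝ => x ∘ e := by
    funext x i
    simp [MeasurableEquiv.coe_piCongrLeft, Equiv.piCongrLeft_apply]
  rw [h2] at h
  exact ⟨measurable_pi_lambda _ fun i => measurable_pi_apply _, h⟩

/-- Among the elements of `S` whose keys are related to `k` by `Q`, the element `j` comes strictly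
first in the order `r` of the keys. -/
def First (w : ℕ) (Q r : ℕ → ℕ → Prop) (S : Finset ℕ) (k : (ℕ → ℝ) → ℕ) (j : ℕ) : Set (ℕ → ℝ) :=
  {x | Q (k x) (keyOf w (x j)) ∧
    ∀ i ∈ S, i ≠ j → Q (k x) (keyOf w (x i)) → r (keyOf w (x j)) (keyOf w (x i))}

lemma measurableSet_first {Q r : ℕ → ℕ → Prop} {S : Finset ℕ} {k : (ℕ → ℝ) → ℕ}
    (hk : Measurable k) (j : ℕ) : MeasurableSet (First w Q r S k j) := by
  have hm : ∀ i, Measurable fun x : ℕ → ℝ => keyOf w (x i) := fun i =>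
    (measurable_keyOf w).comp (measurable_pi_apply i)
  have hQ : ∀ i, MeasurableSet {x : ℕ → ℝ | Q (k x) (keyOf w (x i))} := fun i =>
    (hk.prodMk (hm i)) (MeasurableSet.of_discrete (s := {p : ℕ × ℕ | Q p.1 p.2}))
  have hr : ∀ i, MeasurableSet {x : ℕ → ℝ | r (keyOf w (x j)) (keyOf w (x i))} := fun i =>
    ((hm j).prodMk (hm i)) (MeasurableSet.of_discrete (s := {p : ℕ × ℕ | r p.1 p.2}))
  have : First w Q r S k j = {x | Q (k x) (keyOf w (x j))} ∩ ⋂ i ∈ S.filter (· ≠ j),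
      ({x | Q (k x) (keyOf w (x i))}ᶜ ∪ {x | r (keyOf w (x j)) (keyOf w (x i))}) := by
    ext x
    simp only [First, Set.mem_ofPred_eq, Set.mem_inter_iff, Set.mem_iInter, Finset.mem_filter,
      Set.mem_union, Set.mem_compl_iff, ← imp_iff_not_or, and_imp]
  rw [this]
  exact (hQ j).inter (Finset.measurableSet_biInter _ fun i _ => (hQ i).compl.union (hr i))

/-- By symmetry every element of `S` is equally likely to come first. -/
theorem prob_first_le {Q r : ℕ → ℕ → Prop} (hr : ∀ p q, r p q → ¬ r q p) {S : Finset ℕ}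
    {k : (ℕ → ℝ) → ℕ} (hk : Measurable k)
    (hinv : ∀ i ∈ S, ∀ j ∈ S, ∀ x, k (x ∘ Equiv.swap i j) = k x) {j : ℕ} (hj : j ∈ S) :
    (sampleLaw μ).real (First w Q r S k j) ≤ 1 / S.card := by
  have heq : ∀ i ∈ S, (sampleLaw μ).real (First w Q r S k i) =
      (sampleLaw μ).real (First w Q r S k j) := by
    intro i hi
    rw [measureReal_def, measureReal_def]
    congr 1
    rw [← (measurePreserving_reindex (μ := μ) (Equiv.swap i j)).measure_preimage
      (measurableSet_first hk j).nullMeasurableSet]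
    congr 1
    ext x
    simp only [First, Set.mem_ofPred_eq, Set.mem_preimage, hinv i hi j hj x, Function.comp,
      Equiv.swap_apply_right]
    refine and_congr_right fun _ => ?_
    have key : ∀ l, (Equiv.swap i j l ∈ S ↔ l ∈ S) := fun l => by
      rcases eq_or_ne l i with rfl | h1
      · simp [hi, hj]
      rcases eq_or_ne l j with rfl | h2
      · simp [hi, hj]
      · rw [Equiv.swap_apply_of_ne_of_ne h1 h2]
    constructor
    · intro h l hl hlj
      refine h _ ((key l).2 hl) fun h' => hlj ?_
      have := congrArg (Equiv.swap i j) h'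
      simpa using this
    · intro h l hl hli
      have h3 := h (Equiv.swap i j l) ((key l).2 hl) fun h' => hli (by
        have := congrArg (Equiv.swap i j) h'
        simpa using this)
      rwa [Equiv.swap_apply_self] at h3
  have hdisj : (S : Set ℕ).PairwiseDisjoint (First w Q r S k) := by
    intro p hp q hq hpq
    refine Set.disjoint_left.2 fun x hx hy => ?_
    exact hr _ _ (hx.2 q hq hpq.symm hy.1) (hy.2 p hp hpq hx.1)
  have hsum := measureReal_biUnion_finset (μ := sampleLaw μ) hdisj
    fun i _ => measurableSet_first (w := w) hk i
  rw [Finset.sum_congr rfl heq, Finset.sum_const, nsmul_eq_mul] at hsum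
  have hc : (0 : ℝ) < S.card := by exact_mod_cast Finset.card_pos.2 ⟨j, hj⟩
  rw [le_div_iff₀ hc, mul_comm, ← hsum]
  exact measureReal_le_one

/-- The expected number of elements of `T` that come before all elements of `E` is at most one, if
`T` has at most one element more than `E`. -/
theorem lintegral_card_first_le {Q r : ℕ → ℕ → Prop} (hr : ∀ p q, r p q → ¬ r q p)
    {T E : Finset ℕ} (hTE : Disjoint T E) (hcard : T.card ≤ E.card + 1) {k : (ℕ → ℝ) → ℕ}
    (hk : Measurable k)
    (hinv : ∀ i ∈ T ∪ E, ∀ j ∈ T ∪ E, ∀ x, k (x ∘ Equiv.swap i j) = k x) :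
    ∫⁻ x, ∑ j ∈ T, (First w Q r (insert j E) k j).indicator 1 x ∂sampleLaw μ ≤ 1 := by
  rw [lintegral_finsetSum' _ fun j _ =>
    (measurable_one.indicator (measurableSet_first hk j)).aemeasurable]
  have h1 : ∀ j ∈ T, ∫⁻ x, (First w Q r (insert j E) k j).indicator 1 x ∂sampleLaw μ ≤
      ENNReal.ofReal (1 / (E.card + 1 : ℕ)) := by
    intro j hj
    have hjE : j ∉ E := Finset.disjoint_left.1 hTE hj
    have hsub : insert j E ⊆ T ∪ E := Finset.insert_subset (Finset.mem_union_left _ hj)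
      Finset.subset_union_right
    rw [lintegral_indicator_one (measurableSet_first hk j), ← ofReal_measureReal,
      ← Finset.card_insert_of_notMem hjE]
    exact ENNReal.ofReal_le_ofReal (prob_first_le hr hk
      (fun i hi l hl => hinv i (hsub hi) l (hsub hl)) (Finset.mem_insert_self _ _))
  refine (Finset.sum_le_sum h1).trans ?_
  rw [Finset.sum_const, nsmul_eq_mul, ← ENNReal.ofReal_natCast,
    ← ENNReal.ofReal_mul (by positivity),
    ← ENNReal.ofReal_one]
  refine ENNReal.ofReal_le_ofReal ?_
  rw [mul_one_div, div_le_one (by positivity)]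
  exact_mod_cast hcard

end Walk

/-! ### The state in terms of the insertion times -/

/-- The abstract state of the data structure, with the insertion times of the elements in place of
their keys. -/
structure History where
  /-- the elements stored at the start of the epoch -/
  base : Finset ℕ
  /-- the elements stored at some time of the epoch -/
  seen : Finset ℕ
  /-- the number of updates to come before the one that ends the epoch -/
  left : ℕ
  /-- the elements stored now -/
  now : Finset ℕ

namespace History

/-- The end of an update: the epoch goes on, or a new epoch starts. -/
def tick (A : History) : History :=
  if A.left = 0 then ⟨A.now, A.now, A.now.card / 2, A.now⟩ else { A with left := A.left - 1 }

/-- The insertion of the element `j`. -/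
def insert (A : History) (j : ℕ) : History :=
  tick { A with seen := Insert.insert j A.seen, now := Insert.insert j A.now }

/-- The deletion of the element `j`. -/
def delete (A : History) (j : ℕ) : History := tick { A with now := A.now.erase j }

/-- The state with the keys of the elements. -/
noncomputable def epoch (A : History) (w : ℕ) (x : ℕ → ℝ) : Epoch :=
  ⟨A.base.val.map fun j => keyOf w (x j), Insert.insert 0 (A.seen.image fun j => keyOf w (x j)),
    A.left, A.now.val.map fun j => keyOf w (x j)⟩

lemma epoch_tick (A : History) (w : ℕ) (x : ℕ → ℝ) : A.tick.epoch w x = (A.epoch w x).tick := by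
  simp only [tick, Epoch.tick, epoch]
  by_cases h : A.left = 0
  · simp only [h, if_true, Multiset.card_map]
    rfl
  · simp only [h, if_false]

/-- The request for the new element `j` and the insertion of `j` have the same effect. -/
lemma epoch_insert (A : History) {w j : ℕ} (hj : j ∉ A.now) (x : ℕ → ℝ) :
    (A.insert j).epoch w x = (A.epoch w x).step (.insert (nearestWord w (x j))) := by
  rw [insert, epoch_tick, Epoch.step]
  congr 1
  simp only [epoch, Finset.insert_val_of_notMem hj, Multiset.map_cons, Finset.image_insert,
    Finset.insert_comm _ 0]
  rfl

/-- The request for the key of `j` and the deletion of `j` have the same effect, since elements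
with equal keys need not be told apart in the multiset of keys. -/
lemma epoch_delete (A : History) {w j : ℕ} (hj : j ∈ A.now) (x : ℕ → ℝ) :
    (A.delete j).epoch w x = (A.epoch w x).step (.delete (nearestWord w (x j))) := by
  rw [delete, epoch_tick, Epoch.step]
  congr 1
  simp only [epoch, Finset.erase_val]
  rw [Multiset.map_erase_of_mem _ _ hj]
  rfl

/-- The elements present throughout the epoch. -/
def stable (A : History) : Finset ℕ := A.base ∩ A.now

/-- Most elements of the start of the epoch are still there, and there are few others. -/
structure Sound (A : History) : Prop where
  others : (A.seen \ A.stable).card + A.left ≤ A.base.card / 2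
  stay : A.base.card + A.left ≤ A.stable.card + A.base.card / 2

/-- The slack of one update is used up by the decrease of `left`. -/
lemma sound_tick {A : History} (h1 : (A.seen \ A.stable).card + A.left ≤ A.base.card / 2 + 1)
    (h2 : A.base.card + A.left ≤ A.stable.card + A.base.card / 2 + 1) : A.tick.Sound := by
  rw [tick]
  split_ifs with h
  · exact ⟨by simp [stable], by simp [stable]⟩
  · refine ⟨?_, ?_⟩
    · change (A.seen \ A.stable).card + (A.left - 1) ≤ A.base.card / 2
      omega
    · change A.base.card + (A.left - 1) ≤ A.stable.card + A.base.card / 2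
      omega

lemma Sound.insert {A : History} (h : A.Sound) (j : ℕ) : (A.insert j).Sound := by
  have hsub : A.stable ⊆ A.base ∩ Insert.insert j A.now :=
    Finset.inter_subset_inter_left (Finset.subset_insert _ _)
  refine sound_tick ?_ ?_
  · have h1 : Insert.insert j A.seen \ (A.base ∩ Insert.insert j A.now) ⊆
        Insert.insert j (A.seen \ A.stable) := by
      intro i hi
      simp only [Finset.mem_sdiff, Finset.mem_insert] at hi ⊢
      rcases hi.1 with h | h
      · exact Or.inl h
      · exact Or.inr ⟨h, fun h' => hi.2 (hsub h')⟩
    have h2 := (Finset.card_le_card h1).trans (Finset.card_insert_le _ _)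
    have h3 := h.others
    change (Insert.insert j A.seen \ (A.base ∩ Insert.insert j A.now)).card + A.left ≤ _ / 2 + 1
    simp only
    omega
  · have h2 := Finset.card_le_card hsub
    have h3 := h.stay
    change A.base.card + A.left ≤ (A.base ∩ Insert.insert j A.now).card + A.base.card / 2 + 1
    omega

lemma Sound.delete {A : History} (h : A.Sound) (j : ℕ) : (A.delete j).Sound := by
  have hsub : A.stable.erase j ⊆ A.base ∩ A.now.erase j := by
    intro i hi
    simp only [stable, Finset.mem_erase, Finset.mem_inter] at hi ⊢
    tauto
  refine sound_tick ?_ ?_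
  · have h1 : A.seen \ (A.base ∩ A.now.erase j) ⊆ Insert.insert j (A.seen \ A.stable) := by
      intro i hi
      simp only [stable, Finset.mem_sdiff, Finset.mem_insert, Finset.mem_inter,
        Finset.mem_erase] at hi ⊢
      tauto
    have h2 := (Finset.card_le_card h1).trans (Finset.card_insert_le _ _)
    have h3 := h.others
    change (A.seen \ (A.base ∩ A.now.erase j)).card + A.left ≤ A.base.card / 2 + 1
    omega
  · have h2 := (Finset.pred_card_le_card_erase (s := A.stable) (a := j)).trans
      (Finset.card_le_card hsub)
    have h3 := h.stay
    change A.base.card + A.left ≤ (A.base ∩ A.now.erase j).card + A.base.card / 2 + 1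
    omega

/-- At least half of the elements from the start of the epoch are still stored, so that costs in
terms of their number are costs in terms of the current number. -/
lemma Sound.base_card_le {A : History} (h : A.Sound) : A.base.card ≤ 2 * A.now.card := by
  have h1 := h.stay
  have h2 : A.stable.card ≤ A.now.card := Finset.card_le_card Finset.inter_subset_right
  omega

/-- The part of the cost that depends on the elements inserted or deleted during the epoch. The
element `j₀`, on whose sample the key `k` of the request may depend, is left out of the events on
the right: it adds at most one key to each of the two sets, and the sentinel another one. -/
lemma walk_le (A : History) {w : ℕ} (x : ℕ → ℝ) (k : (ℕ → ℝ) → ℕ) (j₀ : ℕ) :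
    (above (A.epoch w x).keys (A.epoch w x).stable (k x)).card +
      (below (A.epoch w x).keys (A.epoch w x).stable (k x)).card ≤
    (3 : ENNReal) +
      ∑ j ∈ (A.seen \ A.stable).erase j₀, (First w (fun k a => k < a) (fun a b => a < b)
        (Insert.insert j (A.stable.erase j₀)) k j).indicator 1 x +
      ∑ j ∈ (A.seen \ A.stable).erase j₀, (First w (fun k a => a ≤ k) (fun a b => b < a)
        (Insert.insert j (A.stable.erase j₀)) k j).indicator 1 x := by
  classical
  have hst : ∀ i ∈ A.stable, keyOf w (x i) ∈ (A.epoch w x).stable := fun i hi => by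
    rw [stable, Finset.mem_inter] at hi
    rw [Epoch.stable, Finset.mem_inter, Multiset.mem_toFinset, Multiset.mem_toFinset]
    exact ⟨Multiset.mem_map_of_mem _ hi.1, Multiset.mem_map_of_mem _ hi.2⟩
  have hsum : ∀ F : ℕ → Set (ℕ → ℝ),
      ∑ j ∈ (A.seen \ A.stable).erase j₀, (F j).indicator (1 : (ℕ → ℝ) → ENNReal) x =
        (((A.seen \ A.stable).erase j₀).filter fun j => x ∈ F j).card := fun F => by
    rw [Finset.card_filter, Nat.cast_sum]
    refine Finset.sum_congr rfl fun j _ => ?_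
    by_cases h : x ∈ F j <;> simp [h]
  rw [hsum, hsum]
  have ha : (above (A.epoch w x).keys (A.epoch w x).stable (k x)) ⊆
      Insert.insert (keyOf w (x j₀)) ((((A.seen \ A.stable).erase j₀).filter fun j =>
        x ∈ First w (fun k a => k < a) (fun a b => a < b)
          (Insert.insert j (A.stable.erase j₀)) k j).image fun j => keyOf w (x j)) := by
    intro a ha
    rw [above, Finset.mem_filter] at ha
    obtain ⟨ha1, ha2, ha3⟩ := ha
    simp only [epoch, Finset.mem_insert, Finset.mem_image] at ha1
    rcases ha1 with rfl | ⟨j, hj, rfl⟩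
    · omega
    rcases eq_or_ne j j₀ with rfl | hj₀
    · exact Finset.mem_insert_self _ _
    refine Finset.mem_insert_of_mem (Finset.mem_image_of_mem _ (Finset.mem_filter.2 ⟨?_, ha2, ?_⟩))
    · refine Finset.mem_erase.2 ⟨hj₀, Finset.mem_sdiff.2 ⟨hj, fun h => ?_⟩⟩
      exact lt_irrefl _ (ha3 _ (hst j h) ha2)
    · intro i hi hij hik
      exact ha3 _ (hst i (Finset.mem_of_mem_erase ((Finset.mem_insert.1 hi).resolve_left hij))) hik
  have hb : (below (A.epoch w x).keys (A.epoch w x).stable (k x)) ⊆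
      Insert.insert 0 (Insert.insert (keyOf w (x j₀)) (
        (((A.seen \ A.stable).erase j₀).filter fun j =>
        x ∈ First w (fun k a => a ≤ k) (fun a b => b < a)
          (Insert.insert j (A.stable.erase j₀)) k j).image fun j => keyOf w (x j))) := by
    intro a ha
    rw [below, Finset.mem_filter] at ha
    obtain ⟨ha1, ha2, ha3⟩ := ha
    simp only [epoch, Finset.mem_insert, Finset.mem_image] at ha1
    rcases ha1 with rfl | ⟨j, hj, rfl⟩
    · exact Finset.mem_insert_self _ _
    refine Finset.mem_insert_of_mem ?_
    rcases eq_or_ne j j₀ with rfl | hj₀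
    · exact Finset.mem_insert_self _ _
    refine Finset.mem_insert_of_mem (Finset.mem_image_of_mem _ (Finset.mem_filter.2 ⟨?_, ha2, ?_⟩))
    · refine Finset.mem_erase.2 ⟨hj₀, Finset.mem_sdiff.2 ⟨hj, fun h => ?_⟩⟩
      exact lt_irrefl _ (ha3 _ (hst j h) ha2)
    · intro i hi hij hik
      exact ha3 _ (hst i (Finset.mem_of_mem_erase ((Finset.mem_insert.1 hi).resolve_left hij))) hik
  have ha' := (Finset.card_le_card ha).trans ((Finset.card_insert_le _ _).trans
    (Nat.add_le_add_right Finset.card_image_le 1))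
  have hb' := (Finset.card_le_card hb).trans ((Finset.card_insert_le _ _).trans
    (Nat.add_le_add_right ((Finset.card_insert_le _ _).trans
      (Nat.add_le_add_right Finset.card_image_le 1)) 1))
  norm_cast
  omega

end History

/-! ### The expected cost of a request -/

section Real

/-- The doubly logarithmic costs of numbers within a factor of two are comparable. -/
lemma loglog_double {n N : ℕ} (h : N ≤ 2 * n) :
    max 1 (Real.log (Real.log N)) ≤ 2 * max 1 (Real.log (Real.log n)) := by
  have h1 : 1 ≤ max 1 (Real.log (Real.log n)) := le_max_left _ _
  refine max_le (by linarith) ?_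
  have hlog2 := Real.log_two_lt_d9
  rcases Nat.lt_or_ge N 3 with hN | hN
  · have e1 : Real.log (Real.log N) ≤ 0 := by
      refine Real.log_nonpos (Real.log_natCast_nonneg N) ?_
      rcases Nat.eq_zero_or_pos N with rfl | hN0
      · simp
      have : Real.log N ≤ Real.log 2 :=
        Real.log_le_log (by exact_mod_cast hN0) (by exact_mod_cast (by omega : N ≤ 2))
      linarith
    linarith
  · have hn : 2 ≤ n := by omega
    have hn' : (2 : ℝ) ≤ n := by exact_mod_cast hn
    have e1 : Real.log N ≤ 2 * Real.log n := by
      have f1 : Real.log N ≤ Real.log (2 * n) :=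
        Real.log_le_log (by exact_mod_cast (by omega : 0 < N)) (by exact_mod_cast h)
      rw [Real.log_mul (by norm_num) (by positivity)] at f1
      have f2 := Real.log_le_log (by norm_num) hn'
      linarith
    have e2 := one_le_log_of_three_le hN
    have e3 : 0 < Real.log n := by linarith
    have e4 := Real.log_le_log (by linarith) e1
    rw [Real.log_mul (by norm_num) e3.ne'] at e4
    have e5 := le_max_right 1 (Real.log (Real.log n))
    linarith

/-- The cost of a binary search between two samples. -/
lemma log_log_le (N : ℕ) :
    (Nat.log 2 (Nat.log 2 N + 2) : ℝ) ≤ 5 * max 1 (Real.log (Real.log N)) := by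
  have h1 : 1 ≤ max 1 (Real.log (Real.log N)) := le_max_left _ _
  rcases Nat.lt_or_ge N 3 with hN | hN
  · have e1 : Nat.log 2 N < 2 := Nat.log_lt_of_lt_pow' (by norm_num) (by omega)
    have e2 : Nat.log 2 (Nat.log 2 N + 2) < 2 := Nat.log_lt_of_lt_pow' (by norm_num) (by omega)
    have e3 : (Nat.log 2 (Nat.log 2 N + 2) : ℝ) ≤ 1 := by
      exact_mod_cast (by omega : Nat.log 2 (Nat.log 2 N + 2) ≤ 1)
    linarith
  · have e2 := one_le_log_of_three_le hN
    have e3 := natLog_le_two_log N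
    have e4 := natLog_le_two_log (Nat.log 2 N + 2)
    push_cast at e4
    have e5 : Real.log (Nat.log 2 N + 2) ≤ Real.log (2 * 2 * Real.log N) :=
      Real.log_le_log (by positivity) (by linarith)
    rw [Real.log_mul (by norm_num) (by linarith), Real.log_mul (by norm_num) (by norm_num)] at e5
    have hlog2 := Real.log_two_lt_d9
    have e6 := le_max_right 1 (Real.log (Real.log N))
    linarith

end Real

section Expectation

variable {w : ℕ}

/-- A function of finitely many keys is measurable, as it factors through a countable discrete
space. -/
lemma measurable_keys (J : Finset ℕ) (F : Multiset ℕ → ENNReal) :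
    Measurable fun x : ℕ → ℝ => F (J.val.map fun j => keyOf w (x j)) := by
  have h : (fun x : ℕ → ℝ => F (J.val.map fun j => keyOf w (x j))) =
      (fun f : J → ℕ => F (J.attach.val.map f)) ∘
        fun (x : ℕ → ℝ) (j : J) => keyOf w (x j) := by
    funext x
    simp only [Function.comp]
    congr 1
    have := congrArg (Multiset.map fun j => keyOf w (x j)) (Multiset.attach_map_val J.val)
    rw [Multiset.map_map] at this
    exact this.symm
  rw [h]
  refine Measurable.comp (measurable_of_countable _) ?_
  exact measurable_pi_lambda _ fun j => (measurable_keyOf w).comp (measurable_pi_apply _)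

/-- A bound for the cost of a search in the state `A` that is a measurable function of the sample;
the element `j₀` is the one that the request concerns. -/
noncomputable def History.costBound (A : History) (w : ℕ) (k : (ℕ → ℝ) → ℕ) (j₀ : ℕ) (x : ℕ → ℝ) :
    ENNReal :=
  ((4 + Nat.log 2 (Nat.log 2 A.base.card + 2) : ℕ) : ENNReal) +
    (searchDepth (A.base.val.map fun j => keyOf w (x j)) +
    (∑ j ∈ (A.seen \ A.stable).erase j₀, (First w (fun k a => k < a) (fun a b => a < b)
        (Insert.insert j (A.stable.erase j₀)) k j).indicator 1 x +
      ∑ j ∈ (A.seen \ A.stable).erase j₀, (First w (fun k a => a ≤ k) (fun a b => b < a)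
        (Insert.insert j (A.stable.erase j₀)) k j).indicator 1 x))

/-- The bound for the cost of a search in terms of the samples. -/
lemma History.cost_le (A : History) (k : (ℕ → ℝ) → ℕ) (j₀ : ℕ) (x : ℕ → ℝ) :
    ((A.epoch w x).cost (k x) : ENNReal) ≤ A.costBound w k j₀ x := by
  have h := A.walk_le (w := w) x k j₀
  have hb : (A.epoch w x).base = A.base.val.map fun j => keyOf w (x j) := rfl
  rw [Epoch.cost, hb, Multiset.card_map, Finset.card_val, costBound]
  push_cast
  calc _ = (1 : ENNReal) + searchDepth (A.base.val.map fun j => keyOf w (x j)) +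
        Nat.log 2 (Nat.log 2 A.base.card + 2) +
        ((above (A.epoch w x).keys (A.epoch w x).stable (k x)).card +
          (below (A.epoch w x).keys (A.epoch w x).stable (k x)).card) := by ring
    _ ≤ _ := add_le_add_right h _
    _ = _ := by ring

lemma measurable_sum_first {Q r : ℕ → ℕ → Prop} {k : (ℕ → ℝ) → ℕ} (hk : Measurable k)
    (T E : Finset ℕ) : Measurable fun x : ℕ → ℝ =>
      ∑ j ∈ T, (First w Q r (Insert.insert j E) k j).indicator (1 : (ℕ → ℝ) → ENNReal) x :=
  Finset.measurable_sum _ fun j _ => measurable_one.indicator (measurableSet_first hk j)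

lemma History.measurable_costBound (A : History) {k : (ℕ → ℝ) → ℕ} (hk : Measurable k) (j₀ : ℕ) :
    Measurable (A.costBound w k j₀) :=
  ((measurable_keys A.base fun S => (searchDepth S : ENNReal)).add
    ((measurable_sum_first hk _ _).add (measurable_sum_first hk _ _))).const_add _

/-- The expected cost of a search. -/
theorem lintegral_costBound_le {α δ : ℝ} (hα : 0 < α) (hδ : 0 < δ) (β : ℝ) :
    ∃ C : ℝ, 0 ≤ C ∧ ∀ (w : ℕ) (a b : ℝ) (μ : Measure ℝ) [IsProbabilityMeasure μ],
      HasDensityOn μ a b →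
      SmoothWith (fun s => (s : ℝ) ^ α) (fun s => (s : ℝ) ^ (1 - δ)) β μ a b →
      ∀ (A : History), A.Sound → ∀ (k : (ℕ → ℝ) → ℕ) (j₀ : ℕ), Measurable k →
        (∀ i j x, i ≠ j₀ → j ≠ j₀ → k (x ∘ Equiv.swap i j) = k x) →
        ∫⁻ x, A.costBound w k j₀ x ∂sampleLaw μ ≤
          ENNReal.ofReal (C * max 1 (Real.log (Real.log A.now.card))) := by
  obtain ⟨C, hC0, hC⟩ := lintegral_searchDepth_le hα hδ β
  refine ⟨16 + 2 * C, by positivity, fun w a b μ _ hd hs A hA k j₀ hk hinv => ?_⟩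
  have hcard : ((A.seen \ A.stable).erase j₀).card ≤ (A.stable.erase j₀).card + 1 := by
    have h1 := hA.others
    have h2 := hA.stay
    have h3 := Finset.card_erase_le (s := A.seen \ A.stable) (a := j₀)
    have h4 := Finset.pred_card_le_card_erase (s := A.stable) (a := j₀)
    omega
  have hdisj : Disjoint ((A.seen \ A.stable).erase j₀) (A.stable.erase j₀) :=
    (Finset.sdiff_disjoint.mono_left (Finset.erase_subset _ _)).mono_right (Finset.erase_subset _ _)
  have hne : ∀ i ∈ (A.seen \ A.stable).erase j₀ ∪ A.stable.erase j₀, i ≠ j₀ := fun i hi => by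
    rcases Finset.mem_union.1 hi with h | h <;> exact (Finset.mem_erase.1 h).1
  have hw1 := lintegral_card_first_le (μ := μ) (w := w) (Q := fun k a => k < a)
    (r := fun a b => a < b)
    (fun p q h => by omega) hdisj hcard hk fun i hi j hj x => hinv i j x (hne i hi) (hne j hj)
  have hw2 := lintegral_card_first_le (μ := μ) (w := w) (Q := fun k a => a ≤ k)
    (r := fun a b => b < a)
    (fun p q h => by omega) hdisj hcard hk fun i hi j hj x => hinv i j x (hne i hi) (hne j hj)
  have hD := hC w a b μ hd hs A.base
  simp only [History.costBound]
  rw [lintegral_add_left measurable_const,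
    lintegral_add_left (measurable_keys A.base fun S => (searchDepth S : ENNReal)),
    lintegral_add_left (measurable_sum_first hk _ _), lintegral_const, measure_univ, mul_one]
  refine (add_le_add_right (add_le_add hD (add_le_add hw1 hw2)) _).trans ?_
  rw [← ENNReal.ofReal_natCast, ← ENNReal.ofReal_one,
    ← ENNReal.ofReal_add (by norm_num) (by norm_num),
    ← ENNReal.ofReal_add (by positivity) (by norm_num),
    ← ENNReal.ofReal_add (by positivity) (by positivity)]
  refine ENNReal.ofReal_le_ofReal ?_
  have h1 := log_log_le A.base.card
  have h2 := loglog_double hA.base_card_le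
  have h3 : 1 ≤ max 1 (Real.log (Real.log A.now.card)) := le_max_left _ _
  have h4 := mul_le_mul_of_nonneg_left h2 hC0
  push_cast
  linarith

end Expectation

/-! ### The input model -/

section Input

variable {w : ℕ}

/-- The numbers of stored elements during the requests occur among those during the operations,
so that the words are long enough for the requests. A deletion from the empty structure leads to
no request, hence `i'` may differ from `i`. -/
lemma card_contents (X : ℕ → ℝ) (U : (p : ℕ × ℕ) → Fin (p.2 + 1)) (ks : List (Kind w)) :
    ∀ (t : ℕ) (L : List (BitVec w)) (i : ℕ), ∃ i',
      (((requests X U t L ks).take i).foldl (fun S r => r.apply S) (L : Multiset (BitVec w))).card =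
        (ks.take i').foldl Kind.next L.length := by
  induction ks with
  | nil => intro t L i; exact ⟨0, by simp [requests]⟩
  | cons o ks ih =>
    intro t L i
    cases o with
    | insert =>
      rcases i with _ | i
      · exact ⟨0, by simp⟩
      · obtain ⟨i', h⟩ := ih (t + 1) (nearestWord w (X t) :: L) i
        refine ⟨i' + 1, ?_⟩
        simp only [requests, List.take_succ_cons, List.foldl_cons, Request.apply, Kind.next]
        exact h
    | delete =>
      rcases L with _ | ⟨k, L⟩
      · obtain ⟨i', h⟩ := ih (t + 1) [] i
        exact ⟨i' + 1, by simpa [requests, Kind.next] using h⟩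
      · rcases i with _ | i
        · exact ⟨0, by simp⟩
        · obtain ⟨i', h⟩ := ih (t + 1) ((k :: L).eraseIdx (U (t, L.length))) i
          refine ⟨i' + 1, ?_⟩
          have hlt : (U (t, L.length) : ℕ) < (k :: L).length := (U (t, L.length)).isLt
          have e : (((k :: L).erase ((k :: L).get (U (t, L.length))) : List (BitVec w)) :
              Multiset (BitVec w)) = ((k :: L).eraseIdx (U (t, L.length)) : List (BitVec w)) :=
            Multiset.coe_eq_coe.2 (List.erase_getElem hlt)
          simp only [requests, List.take_succ_cons, List.foldl_cons, Request.apply, Kind.next,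
            Multiset.coe_erase]
          rw [List.length_eraseIdx_of_lt hlt] at h
          rw [e]
          exact h
    | pred q =>
      rcases i with _ | i
      · exact ⟨0, by simp⟩
      · obtain ⟨i', h⟩ := ih (t + 1) L i
        refine ⟨i' + 1, ?_⟩
        simp only [requests, List.take_succ_cons, List.foldl_cons, Request.apply, Kind.next]
        exact h

/-- The request that a deletion leads to, when the stored elements are given by their insertion
times and `f` is the key of an element. -/
lemma requests_delete {X : ℕ → ℝ} {U : (p : ℕ × ℕ) → Fin (p.2 + 1)} {t l u : ℕ} {L : List ℕ}
    (f : ℕ → BitVec w) (ks : List (Kind w)) (hu : u = U (t, L.length)) (h : u < (l :: L).length) :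
    requests X U t ((l :: L).map f) (.delete :: ks) =
      .delete (f (l :: L)[u]) :: requests X U (t + 1) (((l :: L).eraseIdx u).map f) ks := by
  have e : ∀ n, n = L.length → (U (t, n) : ℕ) = u := by rintro _ rfl; exact hu.symm
  have e1 := e (L.map f).length (by simp)
  simp only [List.map_cons, requests, List.get_eq_getElem, e1]
  simp only [← List.map_cons, List.getElem_map, List.eraseIdx_map]

/-- The expected total cost of a sequence of operations, for fixed positions of the deletions. -/
theorem lintegral_totalCost_le {α δ : ℝ} (hα : 0 < α) (hδ : 0 < δ) (β : ℝ) :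
    ∃ C : ℝ, 0 ≤ C ∧ ∀ (w : ℕ) (a b : ℝ) (μ : Measure ℝ) [IsProbabilityMeasure μ],
      HasDensityOn μ a b →
      SmoothWith (fun s => (s : ℝ) ^ α) (fun s => (s : ℝ) ^ (1 - δ)) β μ a b →
      ∀ (U : (p : ℕ × ℕ) → Fin (p.2 + 1)) (ks : List (Kind w)) (t : ℕ) (L : List ℕ) (A : History),
        A.Sound → L.Nodup → A.now = L.toFinset → (∀ j ∈ L, j < t) →
        ∫⁻ x, (A.epoch w x).totalCost
            (requests x U t (L.map fun j => nearestWord w (x j)) ks) ∂sampleLaw μ ≤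
          ENNReal.ofReal (C * ∑ i ∈ Finset.range ks.length,
            max 1 (Real.log (Real.log ((ks.take i).foldl Kind.next L.length : ℕ)))) := by
  obtain ⟨C, hC0, hC⟩ := lintegral_costBound_le hα hδ β
  refine ⟨C, hC0, fun w a b μ _ hd hs U ks => ?_⟩
  -- The cost `f` of the operation `o` and its successors consists of the cost of one search and of
  -- the cost `g` of the successors.
  have hstep : ∀ (A : History) (L : List ℕ) (o : Kind w) (ks : List (Kind w)) (k : (ℕ → ℝ) → ℕ)
      (j₀ : ℕ) (f g : (ℕ → ℝ) → ENNReal), A.Sound → L.Nodup → A.now = L.toFinset → Measurable k →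
      (∀ i j x, i ≠ j₀ → j ≠ j₀ → k (x ∘ Equiv.swap i j) = k x) →
      (∀ x, f x ≤ (A.epoch w x).cost (k x) + g x) →
      ∫⁻ x, g x ∂sampleLaw μ ≤ ENNReal.ofReal (C * ∑ i ∈ Finset.range ks.length,
            max 1 (Real.log (Real.log ((ks.take i).foldl Kind.next (o.next L.length) : ℕ)))) →
      ∫⁻ x, f x ∂sampleLaw μ ≤ ENNReal.ofReal (C * ∑ i ∈ Finset.range (o :: ks).length,
            max 1 (Real.log (Real.log (((o :: ks).take i).foldl Kind.next L.length : ℕ)))) := by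
    intro A L o ks k j₀ f g hA hL hnow hk hinv hf hg
    have h1 := hC w a b μ hd hs A hA k j₀ hk hinv
    rw [hnow, List.toFinset_card_of_nodup hL] at h1
    calc ∫⁻ x, f x ∂sampleLaw μ ≤ ∫⁻ x, (A.costBound w k j₀ x + g x) ∂sampleLaw μ :=
          lintegral_mono fun x => (hf x).trans (add_le_add_left (A.cost_le k j₀ x) _)
      _ = _ := lintegral_add_left (A.measurable_costBound hk j₀) _
      _ ≤ _ := add_le_add h1 hg
      _ = _ := by
        have hpos : ∀ m : ℕ, 0 ≤ max 1 (Real.log (Real.log m)) := fun m =>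
          zero_le_one.trans (le_max_left _ _)
        rw [← ENNReal.ofReal_add (mul_nonneg hC0 (hpos _))
          (mul_nonneg hC0 (Finset.sum_nonneg fun i _ => hpos _)), ← mul_add, List.length_cons,
          Finset.sum_range_succ']
        simp only [List.take_succ_cons, List.foldl_cons, List.take_zero, List.foldl_nil]
        rw [add_comm]
  induction ks with
  | nil => intro t L A _ _ _ _; simp [requests, Epoch.totalCost]
  | cons o ks ih =>
    intro t L A hA hL hnow hlt
    cases o with
    | insert =>
      have htL : t ∉ L := fun h => lt_irrefl _ (hlt t h)
      have htA : t ∉ A.now := by rwa [hnow, List.mem_toFinset]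
      refine hstep A L .insert ks (fun x => keyOf w (x t)) t _ _ hA hL hnow
        ((measurable_keyOf w).comp (measurable_pi_apply t)) (fun i j x hi hj => ?_) (fun x => ?_)
        (ih (t + 1) (t :: L) (A.insert t) (hA.insert t) (List.nodup_cons.2 ⟨htL, hL⟩) ?_ ?_)
      · simp [Equiv.swap_apply_of_ne_of_ne hi.symm hj.symm]
      · simp only [requests, Epoch.totalCost, A.epoch_insert htA, List.map_cons]
        push_cast
        exact le_rfl
      · rw [List.toFinset_cons, ← hnow, History.insert, History.tick]
        split_ifs <;> rfl
      · intro j hj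
        rcases List.mem_cons.1 hj with rfl | h
        · omega
        · have := hlt j h; omega
    | delete =>
      rcases L with _ | ⟨l, L⟩
      · refine hstep A [] .delete ks (fun x => 0) 0 _ _ hA hL hnow measurable_const
          (fun i j x hi hj => rfl) (fun x => ?_)
          (ih (t + 1) [] A hA hL hnow (fun j hj => by simp at hj))
        simp only [requests, List.map_nil]
        exact le_add_self
      · obtain ⟨u, hu⟩ : ∃ u : ℕ, u = U (t, L.length) := ⟨_, rfl⟩
        have hul : u < (l :: L).length := hu ▸ (U (t, L.length)).isLt
        have hmem : (l :: L)[u] ∈ A.now := by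
          rw [hnow, List.mem_toFinset]; exact List.getElem_mem _
        have hrec := ih (t + 1) ((l :: L).eraseIdx u) (A.delete (l :: L)[u]) (hA.delete _)
          (hL.sublist (List.eraseIdx_sublist _ _)) ?_ ?_
        · rw [List.length_eraseIdx_of_lt hul] at hrec
          refine hstep A (l :: L) .delete ks (fun x => keyOf w (x (l :: L)[u]))
            (l :: L)[u] _ _ hA hL
            hnow ((measurable_keyOf w).comp (measurable_pi_apply _)) (fun i j x hi hj => ?_)
            (fun x => ?_) hrec
          · simp only [Function.comp, Equiv.swap_apply_of_ne_of_ne hi.symm hj.symm]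
          · rw [requests_delete _ _ hu hul, Epoch.totalCost, A.epoch_delete hmem]
            push_cast
            exact le_rfl
        · have h1 : (A.delete (l :: L)[u]).now = A.now.erase (l :: L)[u] := by
            rw [History.delete, History.tick]
            split_ifs <;> rfl
          rw [h1, hnow, ← hL.erase_getElem u hul]
          ext j
          simp only [Finset.mem_erase, List.mem_toFinset, hL.mem_erase_iff]
        · intro j hj
          have := hlt j (List.mem_of_mem_eraseIdx hj); omega
    | pred q =>
      refine hstep A L (.pred q) ks (fun x => q.toNat - 1) 0 _ _ hA hL hnow measurable_const
        (fun i j x hi hj => rfl) (fun x => ?_)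
        (ih (t + 1) L A hA hL hnow fun j hj => by have := hlt j hj; omega)
      simp only [requests, Epoch.totalCost, Epoch.step, Request.target]
      push_cast
      exact le_rfl

end Input

/-! ### The expected time -/

/-- The input can be averaged with the samples innermost. As only an upper bound is asked for,
`f` need not be measurable. -/
lemma lintegral_inputLaw_le (μ : Measure ℝ) [IsProbabilityMeasure μ] {w : ℕ}
    (f : (ℕ → ℝ) → ((p : ℕ × ℕ) → Fin (p.2 + 1)) → (ℕ → Fin (2 ^ w)) → ENNReal) {c : ENNReal}
    (h : ∀ U ω, ∫⁻ x, f x U ω ∂sampleLaw μ ≤ c) :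
    ∫⁻ z, f z.1 z.2.1 z.2.2 ∂inputLaw μ w ≤ c := by
  have : IsProbabilityMeasure (coinLaw w) := by rw [coinLaw]; infer_instance
  rw [inputLaw, ← Measure.prod_swap]
  have h1 := lintegral_map_equiv (μ := ((Measure.infinitePi fun p : ℕ × ℕ =>
      (PMF.uniformOfFintype (Fin (p.2 + 1))).toMeasure).prod (coinLaw w)).prod (sampleLaw μ))
    (fun z => f z.1 z.2.1 z.2.2) MeasurableEquiv.prodComm
  refine h1.trans_le ((lintegral_prod_le _).trans ?_)
  refine (lintegral_mono (g := fun _ => c) ?_).trans ?_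
  · intro u
    exact h u.1 u.2
  rw [lintegral_const, measure_univ, mul_one]

/-- The expected total time is governed by the doubly logarithmic costs of the single operations. -/
theorem expectedTime_le {α δ : ℝ} (hα : 0 < α) (hδ : 0 < δ) (β : ℝ) :
    ∃ C : ℝ, ∀ (w : ℕ) (a b : ℝ) (μ : Measure ℝ) [IsProbabilityMeasure μ],
      HasDensityOn μ a b →
      SmoothWith (fun s => (s : ℝ) ^ α) (fun s => (s : ℝ) ^ (1 - δ)) β μ a b →
      ∀ ks : List (Kind w), (∀ i, 64 * (size (ks.take i) + 1) ≤ 2 ^ w) →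
        predecessorStructure.expectedTime μ ks ≤ ENNReal.ofReal (C *
          ∑ i ∈ Finset.range ks.length, max 1 (Real.log (Real.log (size (ks.take i))))) := by
  obtain ⟨C, hC0, hC⟩ := lintegral_totalCost_le hα hδ β
  refine ⟨(5000 * costUnit : ℕ) * C, fun w a b μ _ hd hs ks hK => ?_⟩
  refine lintegral_inputLaw_le μ
    (fun x U ω => predecessorStructure.totalTime ω (requests x U 0 [] ks)) fun U ω => ?_
  have h1 : ∀ x : ℕ → ℝ, predecessorStructure.totalTime ω (requests x U 0 [] ks) ≤
      ((5000 * costUnit : ℕ) : ENNReal) * (Epoch.init.totalCost (requests x U 0 [] ks) : ℕ) := by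
    intro x
    rw [← Nat.cast_mul]
    refine totalTime_le _ fun i => ?_
    obtain ⟨i', h⟩ := card_contents x U ks 0 [] i
    have h2 := hK i'
    rw [size] at h2
    exact (congrArg (fun n => 64 * (n + 1)) h).trans_le h2
  have h2 := hC w a b μ hd hs U ks 0 [] ⟨∅, ∅, 0, ∅⟩ ⟨by simp [History.stable], by simp⟩
    List.nodup_nil rfl (fun j hj => by simp at hj)
  refine (lintegral_mono h1).trans ?_
  rw [lintegral_const_mul' _ _ (ENNReal.natCast_ne_top _), mul_assoc,
    ENNReal.ofReal_mul (Nat.cast_nonneg _), ENNReal.ofReal_natCast]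
  exact mul_le_mul_right h2 _

end WordRAM

theorem mainTheorem2 :
    ∃ (D : WordRAM.DataStructure) (K : ℕ),
      (∀ (w : ℕ) (rs : List (WordRAM.Request w)),
        (∀ i, K * ((WordRAM.contents (rs.take i)).card + 1) ≤ 2 ^ w) →
          ∀ᵐ ω ∂WordRAM.coinLaw w, D.Serves K ω rs 0 (WordRAM.State.zero w)) ∧
      ∀ α δ β : ℝ, 0 < α → 0 < δ →
        ∃ C : ℝ, ∀ (w : ℕ) (a b : ℝ) (μ : Measure ℝ) [IsProbabilityMeasure μ],
          WordRAM.HasDensityOn μ a b →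
          WordRAM.SmoothWith (fun s => (s : ℝ) ^ α) (fun s => (s : ℝ) ^ (1 - δ)) β μ a b →
          ∀ ks : List (WordRAM.Kind w),
            (∀ i, K * (WordRAM.size (ks.take i) + 1) ≤ 2 ^ w) →
            D.expectedTime μ ks ≤ ENNReal.ofReal (C * ∑ i ∈ Finset.range ks.length,
              max 1 (Real.log (Real.log (WordRAM.size (ks.take i))))) := by
  exact ⟨WordRAM.predecessorStructure, 64,
    fun w rs hK => ae_of_all _ fun ω => WordRAM.serves rs hK,
    fun α δ β hα hδ => WordRAM.expectedTime_le hα hδ β⟩
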